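/- **Bipartite coloring problem.** Given a finite set $C$ of colors, sets $C_i,C_f\subseteq C$ and sets $S,UT,LT\subseteq C^2$, decide whether there are positive integers $n,m$ and a function $f:\{0,\dots,n-1\}\times\{0,\dots,m-1\}\to C$ with $f(0,0)\in C_i$, $f(n-1,m-1)\in C_f$, such that no pair $(f(x,y),f(x+1,y+1))$ belongs to $S$, no pair $(f(x,y),f(x+1,y))$ belongs to $UT$, and no pair $(f(x,y),f(x,y+1))$ belongs to $LT$ (for all $x,y$ for which both entries of the pair are defined). **Distributed control problem.** An asynchronous automaton on a finite set of processes $\mathbb P$ consists of finite sets of actions $A_p$ and of states $Q_p$, an initial state $i_p\in Q_p$ and a set $F_p\subseteq Q_p$ of final states for each $p\in\mathbb P$, and a set of deterministic transitions $(a,(q_p,q'_p)_{p\in\mathrm{dom}(a)})$ with $a\in A=\bigcup_p A_p$ and $\mathrm{dom}(a)=\{p\mid a\in A_p\}$. Its plays are the Mazurkiewicz traces on $A$ (words modulo commutation of letters with disjoint domains) that can be executed from the initial state. A distributed game is such an automaton together with a partition $A=A_c\sqcup A_e$ into controllable and environment (uncontrollable) actions. The view of a play $u$ by $p$ is the trace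 $w$ such that $u=wv$, where $v$ is the longest suffix of $u$ containing no action of $A_p$. A distributed strategy assigns to each process $p$ and play $u$ a set $\sigma_p(u)$ of actions that contains $A_e$ and depends only on the view of $u$ by $p$. A play $a_1\cdots a_k$ is consistent with $\sigma$ if $a_j\in\sigma_p(a_1\cdots a_{j-1})$ for all $j$ and all $p\in\mathrm{dom}(a_j)$; it is maximal if it is not a strict prefix of another consistent play. The strategy is winning if it has finitely many consistent plays and after every maximal one every process $p$ is in a state of $F_p$. The problem is: given a distributed game, decide whether it has a winning distributed strategy. **Theorem.** There is an effective reduction from the bipartite coloring problem to the distributed control problem with six processes, arranged as two pools of three. That is, there is a computable function that maps every instance $(C,C_i,C_f,S,UT,LT)$ of the bipartite coloring problem to a distributed game $G$ with six processes $T_0,T_1,T_2,B_0,B_1,B_2$ such that $G$ has a winning distributed strategy if and only if the instance has a solution. Moreover, every action of $G$ is either local to one process, or controllable and shared by two processes $X_\ell,X_{\ell+1 \bmod 3}$ of the same pool $X\in\{T,B\}$, or shared by $T_\ell,B_\ell$ for some $\ell$, or shared by all six processes; and for each $\ell\in\{0,1,2\}$ there is an uncontrollable ("check") action shared by exactly $T_\ell$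 and $B_\ell$. -/

import Mathlib

/-! ### Asynchronous automata, traces and plays -/

/-- An asynchronous automaton on the alphabet `A` with set of processes `P`.  Every process `p` has
a set of actions `Act p`, a set of states, an initial state and a set of final states.  The domain
of a letter `a` is `{p | a ∈ Act p}`.  `trans a q q'` says that `(a, (q_p, q'_p)_{p ∈ dom a})` is a
transition; a transition only reads and writes the states of the processes in the domain of its
letter. -/
structure AsyncAutomaton (P A : Type) where
  Act : P → Set A
  State : P → Type
  init : ∀ p, State p
  final : ∀ p, Set (State p)
  trans : (a : A) → ((p : {p : P // a ∈ Act p}) → State p.1) →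
    ((p : {p : P // a ∈ Act p}) → State p.1) → Prop
  covers : ∀ a, ∃ p, a ∈ Act p
  det : ∀ a q q' q'', trans a q q' → trans a q q'' → q' = q''

/-- A distributed game: an asynchronous automaton together with the partition of its alphabet into
controllable letters (those in `ctrl`) and environment letters (those not in `ctrl`). -/
structure DistributedGame (P A : Type) extends AsyncAutomaton P A where
  ctrl : Set A

namespace AsyncAutomaton

variable {P A : Type} (G : AsyncAutomaton P A)

/-- The domain of a letter. -/
def dom (a : A) : Set P := {p | a ∈ G.Act p}

/-- Two letters are independent iff they have no process in common. -/
def Indep (a b : A) : Prop := Disjoint (G.dom a) (G.dom b)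

/-- The commutation rules `ab = ba` for independent letters `a`, `b`. -/
def commRel (u v : FreeMonoid A) : Prop :=
  ∃ a b, G.Indep a b ∧ u = FreeMonoid.of a * FreeMonoid.of b ∧
    v = FreeMonoid.of b * FreeMonoid.of a

/-- Mazurkiewicz traces: words modulo the smallest congruence that commutes independent letters.
The empty trace is `1` and concatenation is multiplication. -/
abbrev Trace : Type := PresentedMonoid G.commRel

/-- The trace of a one-letter word. -/
def letter (a : A) : G.Trace := PresentedMonoid.of G.commRel a

/-- The trace of a word. -/
def ofWord (w : List A) : G.Trace := PresentedMonoid.mk G.commRel (FreeMonoid.ofList w)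

/-- The multiset of letters of a trace, which is the same for all its linearizations. -/
def lettersHom : G.Trace →* Multiplicative (Multiset A) :=
  PresentedMonoid.lift (fun a => Multiplicative.ofAdd ({a} : Multiset A)) (by
    rintro _ _ ⟨a, b, -, rfl, rfl⟩
    simp only [map_mul]
    exact mul_comm _ _)

/-- The multiset of letters of a trace. -/
def letters (u : G.Trace) : Multiset A := Multiplicative.toAdd (G.lettersHom u)

/-- The length of a trace. -/
def length (u : G.Trace) : ℕ := Multiset.card (G.letters u)

/-- The domain of a trace: the processes that play at least one of its letters. -/
def traceDom (u : G.Trace) : Set P := {p | ∃ a ∈ G.letters u, a ∈ G.Act p}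

/-- `u` is a prefix of `v`. -/
def IsPrefix (u v : G.Trace) : Prop := ∃ w, u * w = v

/-- `G.PlayState u s`: the trace `u` is a play, and `s` is its global state. -/
inductive PlayState : G.Trace → (∀ p, G.State p) → Prop
  | nil : PlayState 1 G.init
  | snoc (u : G.Trace) (s s' : ∀ p, G.State p) (a : A) : PlayState u s →
      G.trans a (fun p => s p.1) (fun p => s' p.1) → (∀ p, p ∉ G.dom a → s' p = s p) →
      PlayState (u * G.letter a) s'

/-- The plays of the automaton. -/
def IsPlay (u : G.Trace) : Prop := ∃ s, G.PlayState u s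

/-- `w` is the causal view of `u` by `p`: `u = w * v` where `v` is the longest suffix of `u` in
which `p` does not play. -/
def IsView (p : P) (u w : G.Trace) : Prop :=
  ∃ v, u = w * v ∧ p ∉ G.traceDom v ∧
    ∀ w' v' : G.Trace, u = w' * v' → p ∉ G.traceDom v' → G.length v' ≤ G.length v

end AsyncAutomaton

/-! ### Distributed strategies -/

namespace DistributedGame

variable {P A : Type} (G : DistributedGame P A)

/-- A distributed strategy: every process `p` associates with every play `u` a set of allowed
actions, which contains all environment actions and depends only on the causal view of `p`.
(The values on traces that are not plays are irrelevant.) -/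
structure Strategy where
  allow : P → G.Trace → Set A
  env : ∀ p u, G.IsPlay u → ∀ a, a ∉ G.ctrl → a ∈ allow p u
  view : ∀ p u w, G.IsPlay u → G.IsView p u w → allow p u = allow p w

variable {G}

/-- The plays `a₁ ⋯ aₖ` that are consistent with `σ`: every letter is allowed by all the processes
of its domain after the letters before it. -/
def Strategy.Consistent (σ : G.Strategy) (u : G.Trace) : Prop :=
  G.IsPlay u ∧ ∃ w : List A, u = G.ofWord w ∧
    ∀ (w₁ : List A) (a : A) (w₂ : List A), w = w₁ ++ a :: w₂ →
      ∀ p ∈ G.dom a, a ∈ σ.allow p (G.ofWord w₁)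

/-- The maximal consistent plays: those that are not strict prefixes of other consistent plays. -/
def Strategy.Maximal (σ : G.Strategy) (u : G.Trace) : Prop :=
  σ.Consistent u ∧ ∀ v, σ.Consistent v → G.IsPrefix u v → u = v

/-- A strategy is winning if it has finitely many consistent plays and all processes are in a final
state after every maximal one. -/
def Strategy.Winning (σ : G.Strategy) : Prop :=
  {u | σ.Consistent u}.Finite ∧
    ∀ u, σ.Maximal u → ∀ s, G.PlayState u s → ∀ p, s p ∈ G.final p

variable (G)

/-- There is a winning distributed strategy. -/
def HasWinningStrategy : Prop := ∃ σ : G.Strategy, σ.Winning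

end DistributedGame

/-! ### Finite games as inputs of algorithms -/

/-- A finite description of a distributed game with `n` processes.  The states of process `p` are
`0, …, numStates p - 1`; `final p` lists its final states.  The `i`-th entry `(d, c)` of `letters`
describes the letter `i`: `d p` tells whether `p` is in its domain, and `c` whether it is
controllable.  An entry `(i, q, q')` of `trans` describes a transition on the letter `i` from the
states `q` to the states `q'`, where only the values at processes in the domain of `i` matter. -/
structure GameCode (n : ℕ) where
  numStates : Fin n → ℕ
  init : Fin n → ℕ
  final : Fin n → List ℕ
  letters : List ((Fin n → Bool) × Bool)
  trans : List (ℕ × (Fin n → ℕ) × (Fin n → ℕ))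

namespace GameCode

variable {n : ℕ}

/-- A description of a game as a tuple. -/
def equivTuple (n : ℕ) : GameCode n ≃
    (Fin n → ℕ) × (Fin n → ℕ) × (Fin n → List ℕ) × List ((Fin n → Bool) × Bool) ×
      List (ℕ × (Fin n → ℕ) × (Fin n → ℕ)) where
  toFun c := (c.numStates, c.init, c.final, c.letters, c.trans)
  invFun t := ⟨t.1, t.2.1, t.2.2.1, t.2.2.2.1, t.2.2.2.2⟩
  left_inv _ := rfl
  right_inv _ := rfl

instance (n : ℕ) : Primcodable (GameCode n) := Primcodable.ofEquiv _ (equivTuple n)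

/-- The alphabet. -/
abbrev Letter (c : GameCode n) : Type := Fin c.letters.length

/-- The actions of a process. -/
def Act (c : GameCode n) (p : Fin n) : Set c.Letter := {a | (c.letters.get a).1 p = true}

/-- The transition relation described by the list of transitions. -/
def Trans (c : GameCode n) (a : c.Letter)
    (q q' : (p : {p : Fin n // a ∈ c.Act p}) → Fin (c.numStates p.1)) : Prop :=
  ∃ t ∈ c.trans, t.1 = (a : ℕ) ∧ ∀ p, t.2.1 p.1 = (q p : ℕ) ∧ t.2.2 p.1 = (q' p : ℕ)

/-- The description is one of a distributed game: the initial states are states, every letter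
belongs to some process, and transitions are deterministic. -/
structure WellFormed (c : GameCode n) : Prop where
  init_lt : ∀ p, c.init p < c.numStates p
  covers : ∀ a : c.Letter, ∃ p, a ∈ c.Act p
  det : ∀ a q q' q'', c.Trans a q q' → c.Trans a q q'' → q' = q''

/-- The distributed game with processes `0, …, n - 1` that is described by a well-formed code. -/
def toGame (c : GameCode n) (h : c.WellFormed) : DistributedGame (Fin n) c.Letter where
  Act := c.Act
  State p := Fin (c.numStates p)
  init p := ⟨c.init p, h.init_lt p⟩
  final p := {q | (q : ℕ) ∈ c.final p}
  trans := c.Trans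
  covers := h.covers
  det := h.det
  ctrl := {a | (c.letters.get a).2 = true}

end GameCode

/-! ### Two pools of three processes -/

/-- The three processes `T₀, T₁, T₂` of the top pool. -/
def topProc (l : Fin 3) : Fin 6 := Fin.castAdd 3 l

/-- The three processes `B₀, B₁, B₂` of the bottom pool. -/
def botProc (l : Fin 3) : Fin 6 := Fin.natAdd 3 l

/-- The six processes of the game are arranged as two pools of three: every action is either local
to one process, or a controllable action shared by two cyclically consecutive processes of one pool,
or shared by a pair `T_l, B_l`, or shared by all six processes.  Moreover every pair `T_l, B_l` has
an uncontrollable (check) action. -/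
def DistributedGame.TwoPools {A : Type} (G : DistributedGame (Fin 6) A) : Prop :=
  (∀ a, (∃ p, G.dom a = {p}) ∨
    (a ∈ G.ctrl ∧ ∃ l : Fin 3, G.dom a = {topProc l, topProc (l + 1)} ∨
      G.dom a = {botProc l, botProc (l + 1)}) ∨
    (∃ l, G.dom a = {topProc l, botProc l}) ∨
    G.dom a = Set.univ) ∧
  ∀ l, ∃ a, a ∉ G.ctrl ∧ G.dom a = {topProc l, botProc l}

/-! ### The bipartite coloring problem -/

/-- A finite bipartite coloring `[n] × [m] → C` with `n` and `m` positive. -/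
structure BipartiteColoring (C : Type) where
  n : ℕ
  m : ℕ
  n_pos : 0 < n
  m_pos : 0 < m
  f : Fin n × Fin m → C

namespace BipartiteColoring

variable {C : Type} (F : BipartiteColoring C)

/-- The initial color `f(0, 0)`. -/
def initialColor : C := F.f (⟨0, F.n_pos⟩, ⟨0, F.m_pos⟩)

/-- The final color `f(n - 1, m - 1)`. -/
def finalColor : C :=
  F.f (⟨F.n - 1, Nat.sub_lt F.n_pos one_pos⟩, ⟨F.m - 1, Nat.sub_lt F.m_pos one_pos⟩)

/-- The squares `(f(x, y), f(x + 1, y + 1))`. -/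
def squares : Set (C × C) :=
  {c | ∃ (x y : ℕ) (hx : x + 1 < F.n) (hy : y + 1 < F.m),
    c = (F.f (⟨x, by omega⟩, ⟨y, by omega⟩), F.f (⟨x + 1, hx⟩, ⟨y + 1, hy⟩))}

/-- The upper-triangles `(f(x, y), f(x + 1, y))`. -/
def upperTriangles : Set (C × C) :=
  {c | ∃ (x y : ℕ) (hx : x + 1 < F.n) (hy : y < F.m),
    c = (F.f (⟨x, by omega⟩, ⟨y, hy⟩), F.f (⟨x + 1, hx⟩, ⟨y, hy⟩))}

/-- The lower-triangles `(f(x, y), f(x, y + 1))`. -/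
def lowerTriangles : Set (C × C) :=
  {c | ∃ (x y : ℕ) (hx : x < F.n) (hy : y + 1 < F.m),
    c = (F.f (⟨x, hx⟩, ⟨y, by omega⟩), F.f (⟨x, hx⟩, ⟨y + 1, hy⟩))}

end BipartiteColoring

/-- A coloring constraint: allowed initial and final colors, and forbidden squares, upper-triangles
and lower-triangles. -/
structure ColoringConstraint (C : Type) where
  Ci : Set C
  Cf : Set C
  S : Set (C × C)
  UT : Set (C × C)
  LT : Set (C × C)

/-- The coloring satisfies the constraint. -/
def BipartiteColoring.Satisfies {C : Type} (F : BipartiteColoring C) (K : ColoringConstraint C) :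
    Prop :=
  F.initialColor ∈ K.Ci ∧ F.finalColor ∈ K.Cf ∧ Disjoint F.squares K.S ∧
    Disjoint F.upperTriangles K.UT ∧ Disjoint F.lowerTriangles K.LT

/-- An instance of the bipartite coloring problem, as a finite object: the colors are
`0, …, numColors - 1` and the five sets of the constraint are given as lists. -/
structure ColoringInstance where
  numColors : ℕ
  Ci : List ℕ
  Cf : List ℕ
  S : List (ℕ × ℕ)
  UT : List (ℕ × ℕ)
  LT : List (ℕ × ℕ)

namespace ColoringInstance

/-- An instance as a tuple. -/
def equivTuple : ColoringInstance ≃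
    ℕ × List ℕ × List ℕ × List (ℕ × ℕ) × List (ℕ × ℕ) × List (ℕ × ℕ) where
  toFun I := (I.numColors, I.Ci, I.Cf, I.S, I.UT, I.LT)
  invFun t := ⟨t.1, t.2.1, t.2.2.1, t.2.2.2.1, t.2.2.2.2.1, t.2.2.2.2.2⟩
  left_inv _ := rfl
  right_inv _ := rfl

instance : Primcodable ColoringInstance := Primcodable.ofEquiv _ equivTuple

/-- The set of pairs of colors given by a list. -/
def pairs (k : ℕ) (L : List (ℕ × ℕ)) : Set (Fin k × Fin k) := {c | ((c.1 : ℕ), (c.2 : ℕ)) ∈ L}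

/-- The coloring constraint described by an instance. -/
def toConstraint (I : ColoringInstance) : ColoringConstraint (Fin I.numColors) where
  Ci := {c | (c : ℕ) ∈ I.Ci}
  Cf := {c | (c : ℕ) ∈ I.Cf}
  S := pairs _ I.S
  UT := pairs _ I.UT
  LT := pairs _ I.LT

/-- The instance has a solution: some finite bipartite coloring satisfies the constraint. -/
def HasSolution (I : ColoringInstance) : Prop :=
  ∃ F : BipartiteColoring (Fin I.numColors), F.Satisfies I.toConstraint

end ColoringInstance

/-! ### Traces -/

namespace AsyncAutomaton

variable {P A : Type} (G : AsyncAutomaton P A)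

/-! The two pools are two independent clocks. In a pool the synchronizations `X₀X₁`, `X₁X₂`, `X₂X₀`
repeat; three of them form a round, and only the processes of the pool decide which round is the
last one. A strategy thus fixes numbers of rounds n (top) and m (bottom), neither of which can
depend on the other pool. In suitable windows the environment checks a pair `T_l`, `B_l`, which has
to answer a color. What the pair knows is given by its two synchronization counts, so its answers
are colors attached to positions of the grid [n] × [m].

From a winning strategy to a coloring: let f(x, y) be the answer of the pair 1 at the counts (3x+2,
3y+2). Each pair is absent from one synchronization out of three, and its answer cannot change while
that synchronization is played. Hence two pairs can be checked in the same play at slightly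
different counts, and the environment wins if their answers at one position differ. This forces the
pair 0 at (3x+1, 3y+1), and the pair 2 at (3x+3, 3y+2), (3x+2, 3y+3) and (3x+3, 3y+3), to answer
f(x, y) as well (`Rounds.answer₀`, `Rounds.answer_upper` and its companions). Moreover `X₂` is
absent from the first synchronization of the next round, so one play contains the answer of the pair
2 for the old position and that of the pair 0 for the new one. All adjacent pairs of colors are
exposed in this way, and the environment wins on the forbidden ones. The initial and final colors
are enforced by the answers available to the pair 0. The main tools are `Winning.final_of_stuck` (a
checked pair that refuses to answer loses), `Reach.answer` (stability of answers) and
`exists_rounds` (independence of the clocks).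

From a solution g to a strategy: every process counts synchronizations, the pools stop after n and m
rounds, and a checked pair answers the value of g at its two rounds. The invariant `Inv` describes
all consistent plays; it excludes the letter by which the environment wins (`Inv.step`). A strictly
increasing bounded progress makes the plays finite in number, and the `enabled` lemmas show that a
play cannot stop outside the final states.

Both directions rest on the fact that a process does not see a suffix in which it does not play
(`Strategy.allow_mul`), which comes from Levi's lemma for traces. The game is computable because its
transitions are assembled by primitive recursive list operations, and deterministic because the
target of a transition is a function of its letter and source (`target`). -/

theorem ofWord_nil : G.ofWord [] = 1 := rfl

theorem ofWord_append (u v : List A) : G.ofWord (u ++ v) = G.ofWord u * G.ofWord v := by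
  simp [ofWord, FreeMonoid.ofList_append]

theorem ofWord_snoc (u : List A) (a : A) : G.ofWord (u ++ [a]) = G.ofWord u * G.letter a :=
  G.ofWord_append u [a]

theorem exists_ofWord (u : G.Trace) : ∃ w : List A, G.ofWord w = u := by
  obtain ⟨w, rfl⟩ := PresentedMonoid.surjective_mk u
  exact ⟨FreeMonoid.toList w, rfl⟩

/-- Induction on traces, adding letters at the end. -/
theorem trace_induction {p : G.Trace → Prop} (one : p 1)
    (snoc : ∀ u a, p u → p (u * G.letter a)) (u : G.Trace) : p u := by
  obtain ⟨w, rfl⟩ := G.exists_ofWord u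
  induction w using List.reverseRecOn with
  | nil => exact one
  | append_singleton w a ih => rw [ofWord_snoc]; exact snoc _ _ ih

theorem letters_one : G.letters 1 = 0 := by simp [letters]

theorem letters_mul (u v : G.Trace) : G.letters (u * v) = G.letters u + G.letters v := by
  simp [letters]

theorem letters_letter (a : A) : G.letters (G.letter a) = {a} := rfl

theorem length_one : G.length 1 = 0 := by simp [length, letters_one]

theorem length_mul (u v : G.Trace) : G.length (u * v) = G.length u + G.length v := by
  simp [length, letters_mul]

theorem length_letter (a : A) : G.length (G.letter a) = 1 := rfl

theorem eq_one_of_length_eq_zero {u : G.Trace} (h : G.length u = 0) : u = 1 := by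
  induction u using G.trace_induction with
  | one => rfl
  | snoc u a _ => simp [length_mul, length_letter] at h

theorem mem_traceDom {u : G.Trace} {p : P} :
    p ∈ G.traceDom u ↔ ∃ a ∈ G.letters u, p ∈ G.dom a := Iff.rfl

theorem traceDom_one : G.traceDom 1 = ∅ := by
  ext p; simp [mem_traceDom, letters_one]

theorem traceDom_letter (a : A) : G.traceDom (G.letter a) = G.dom a := by
  ext p; simp [mem_traceDom, letters_letter]

theorem traceDom_mul (u v : G.Trace) : G.traceDom (u * v) = G.traceDom u ∪ G.traceDom v := by
  ext p; simp [mem_traceDom, letters_mul, or_and_right, exists_or]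

theorem letter_commute {a b : A} (h : G.Indep a b) :
    G.letter a * G.letter b = G.letter b * G.letter a :=
  PresentedMonoid.mk_eq_mk_of_rel ⟨a, b, h, rfl, rfl⟩

/-- Traces with disjoint domains commute. -/
theorem mul_comm_of_disjoint {u v : G.Trace} (h : Disjoint (G.traceDom u) (G.traceDom v)) :
    u * v = v * u := by
  induction v using G.trace_induction with
  | one => simp
  | snoc v b ih =>
    rw [traceDom_mul, traceDom_letter, Set.disjoint_union_right] at h
    have hb : u * G.letter b = G.letter b * u := by
      have h := h.2
      clear ih
      induction u using G.trace_induction with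
      | one => simp
      | snoc u a ih =>
        rw [traceDom_mul, traceDom_letter, Set.disjoint_union_left] at h
        have hu := ih (by simp_all [Set.disjoint_union_left, traceDom_mul]) h.1
        rw [mul_assoc, G.letter_commute h.2, ← mul_assoc, hu, mul_assoc]
    rw [← mul_assoc, ih h.1, mul_assoc, hb, mul_assoc]

/-! ### Cancelling a letter at the end of a trace, and Levi's lemma. -/

open Classical in
/-- The action of a letter `a` on pairs `(u, r)`, where `u` is a trace and `r` is the trace that
remains after `x` is removed from the end of `u`, if this is possible. -/
noncomputable def cancelStep (x a : A) (t : G.Trace × Option G.Trace) :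
    G.Trace × Option G.Trace :=
  (t.1 * G.letter a,
    if a = x then some t.1 else if G.Indep a x then t.2.map (· * G.letter a) else none)

-- This is what makes cancellation well defined on traces. If one of the two letters is x, the other
-- one is independent of x and is appended to the remainder; otherwise both orders append both
-- letters or both give `none`.
open Classical in
theorem cancelStep_comm (x : A) {a b : A} (h : G.Indep a b) (t : G.Trace × Option G.Trace) :
    G.cancelStep x b (G.cancelStep x a t) = G.cancelStep x a (G.cancelStep x b t) := by
  have hab := G.letter_commute h
  have h' : G.Indep b a := h.symm
  obtain ⟨u, r⟩ := t
  by_cases ha : a = x <;> by_cases hb : b = x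
  · rw [ha, hb]
  · subst ha
    simp [cancelStep, hb, h', mul_assoc, hab]
  · subst hb
    simp [cancelStep, ha, h, mul_assoc, hab]
  · by_cases h1 : G.Indep a x <;> by_cases h2 : G.Indep b x <;>
      simp [cancelStep, ha, hb, h1, h2, mul_assoc, hab, Function.comp_def]

/-- The action of traces on pairs that is generated by `cancelStep`. -/
noncomputable def cancelHom (x : A) :
    G.Trace →* (Function.End (G.Trace × Option G.Trace))ᵐᵒᵖ :=
  PresentedMonoid.lift (M := (Function.End (G.Trace × Option G.Trace))ᵐᵒᵖ)
    (fun a => MulOpposite.op (G.cancelStep x a)) (by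
    rintro _ _ ⟨a, b, h, rfl, rfl⟩
    simp only [map_mul, FreeMonoid.lift_eval_of]
    exact congrArg MulOpposite.op (funext fun t => G.cancelStep_comm x h t))

/-- `cancel x u` is the trace that remains after `x` is removed from the end of `u`, if this is
possible. -/
noncomputable def cancel (x : A) (u : G.Trace) : Option G.Trace :=
  ((G.cancelHom x u).unop (1, none)).2

theorem cancelHom_snoc (x a : A) (u : G.Trace) (t : G.Trace × Option G.Trace) :
    (G.cancelHom x (u * G.letter a)).unop t = G.cancelStep x a ((G.cancelHom x u).unop t) := by
  rw [map_mul]; rfl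

theorem cancelHom_fst (x : A) (u : G.Trace) : ((G.cancelHom x u).unop (1, none)).1 = u := by
  induction u using G.trace_induction with
  | one => rw [map_one]; rfl
  | snoc u a ih => rw [cancelHom_snoc, cancelStep, ih]

open Classical in
theorem cancel_snoc (x a : A) (u : G.Trace) : G.cancel x (u * G.letter a) =
    if a = x then some u else if G.Indep a x then (G.cancel x u).map (· * G.letter a)
      else none := by
  rw [cancel, cancelHom_snoc, cancelStep, cancelHom_fst]; rfl

/-- Levi's lemma for a single letter. -/
theorem levi_letter {x : A} {w u v : G.Trace} (h : w * G.letter x = u * v) :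
    (∃ v', v = v' * G.letter x ∧ w = u * v') ∨
      ∃ u', u = u' * G.letter x ∧ w = u' * v ∧ ∀ b ∈ G.letters v, G.Indep b x := by
  classical
  -- Cancelling x on the left side of the equation returns w, so only the recursive computation of
  -- `cancel x (u * v)` along v has to be analysed.
  have hw : G.cancel x (u * v) = some w := by rw [← h, cancel_snoc, if_pos rfl]
  have key : ∀ u w : G.Trace, G.cancel x u = some w → u = w * G.letter x := by
    intro u
    induction u using G.trace_induction with
    | one => intro w hw; rw [cancel, map_one] at hw; cases hw
    | snoc u a ih =>
      intro w hw
      rw [cancel_snoc] at hw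
      split_ifs at hw with h1 h2
      · cases hw; rw [h1]
      · obtain ⟨w', hw', rfl⟩ := Option.map_eq_some_iff.1 hw
        conv_lhs => rw [ih w' hw', mul_assoc, ← G.letter_commute h2, ← mul_assoc]
  clear h
  induction v using G.trace_induction generalizing w with
  | one =>
    rw [mul_one] at hw
    exact .inr ⟨w, key _ _ hw, by simp, by simp [letters_one]⟩
  | snoc v b ih =>
    rw [← mul_assoc, cancel_snoc] at hw
    split_ifs at hw with h1 h2
    · cases hw; exact .inl ⟨v, by rw [h1], rfl⟩
    · obtain ⟨w', hw', rfl⟩ := Option.map_eq_some_iff.1 hw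
      rcases ih hw' with ⟨v', rfl, rfl⟩ | ⟨u', rfl, rfl, h⟩
      · refine .inl ⟨v' * G.letter b, ?_, by rw [mul_assoc]⟩
        rw [mul_assoc, mul_assoc, G.letter_commute h2]
      · refine .inr ⟨u', rfl, by rw [mul_assoc], fun c hc => ?_⟩
        rw [letters_mul, letters_letter, Multiset.mem_add, Multiset.mem_singleton] at hc
        rcases hc with hc | rfl
        exacts [h c hc, h2]

/-- Levi's lemma for two letters. -/
theorem levi_letters {x y : A} {w u : G.Trace} (h : w * G.letter x = u * G.letter y) :
    (x = y ∧ w = u) ∨ ∃ u', u = u' * G.letter x ∧ w = u' * G.letter y ∧ G.Indep y x := by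
  rcases G.levi_letter h with ⟨v', h1, rfl⟩ | ⟨u', h1, h2, h3⟩
  · left
    -- Comparing lengths, the remaining factor is empty and the two last letters are equal.
    have hl := congrArg G.length h1
    simp only [length_mul, length_letter] at hl
    obtain rfl := G.eq_one_of_length_eq_zero (u := v') (by omega)
    rw [one_mul] at h1
    have := congrArg G.letters h1
    simp only [letters_letter, Multiset.singleton_inj] at this
    exact ⟨this.symm, by simp⟩
  · exact .inr ⟨u', h1, h2, h3 y (by simp [letters_letter])⟩

/-! ### Causal views. -/

/-- If `p` does not play in `v` then the suffixes of `u * v` without `p` are obtained by appending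
`v` to the suffixes of `u` without `p`, up to length. -/
theorem exists_suffix_of_mul {p : P} {u v u' v' : G.Trace} (hv : p ∉ G.traceDom v)
    (hv' : p ∉ G.traceDom v') (h : u * v = u' * v') :
    ∃ u₁ v₁, u = u₁ * v₁ ∧ p ∉ G.traceDom v₁ ∧ G.length v' ≤ G.length v₁ + G.length v := by
  induction v using G.trace_induction generalizing u' v' with
  | one => exact ⟨u', v', by simpa using h, hv', by simp [length_one]⟩
  | snoc v a ih =>
    rw [traceDom_mul, Set.mem_union, not_or] at hv
    rw [← mul_assoc] at h
    -- The last letter of `v * a` is either the end of `v'`, which then shortens by one, or lies in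
    -- `u'` and commutes past `v'`.
    rcases G.levi_letter h with ⟨v'', rfl, h1⟩ | ⟨u'', rfl, h1, -⟩
    · rw [traceDom_mul, Set.mem_union, not_or] at hv'
      obtain ⟨u₁, v₁, h2, h3, h4⟩ := ih hv.1 hv'.1 h1
      exact ⟨u₁, v₁, h2, h3, by simp only [length_mul, length_letter]; omega⟩
    · obtain ⟨u₁, v₁, h2, h3, h4⟩ := ih hv.1 hv' h1
      exact ⟨u₁, v₁, h2, h3, by simp only [length_mul, length_letter]; omega⟩

theorem exists_isView (p : P) (u : G.Trace) : ∃ w, G.IsView p u w := by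
  let S : Set ℕ := {k | ∃ w v, u = w * v ∧ p ∉ G.traceDom v ∧ G.length v = k}
  have hne : S.Nonempty := ⟨0, u, 1, by simp, by simp [traceDom_one], G.length_one⟩
  have hbd : BddAbove S := ⟨G.length u, by
    rintro k ⟨w, v, rfl, -, rfl⟩; simp [length_mul]⟩
  obtain ⟨w, v, h1, h2, h3⟩ := Nat.sSup_mem hne hbd
  exact ⟨w, v, h1, h2, fun w' v' h h' => h3 ▸ le_csSup hbd ⟨w', v', h, h', rfl⟩⟩

/-- A view of `u` by `p` is a view of `u * v` if `p` does not play in `v`. -/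
theorem IsView.mul {p : P} {u v w : G.Trace} (h : G.IsView p u w) (hv : p ∉ G.traceDom v) :
    G.IsView p (u * v) w := by
  obtain ⟨v₀, rfl, h2, h3⟩ := h
  refine ⟨v₀ * v, by rw [mul_assoc], by simp [traceDom_mul, h2, hv], fun w' v' h h' => ?_⟩
  obtain ⟨u₁, v₁, h4, h5, h6⟩ := G.exists_suffix_of_mul hv h' h
  have := h3 u₁ v₁ h4 h5
  rw [length_mul]; omega

/-! ### States of plays -/

/-- The step relation between global states. -/
def Step (a : A) (s s' : ∀ p, G.State p) : Prop :=
  G.trans a (fun p => s p.1) (fun p => s' p.1) ∧ ∀ p, p ∉ G.dom a → s' p = s p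

variable {G}

theorem PlayState.step {u : G.Trace} {s s' : ∀ p, G.State p} {a : A} (h : G.PlayState u s)
    (hs : G.Step a s s') : G.PlayState (u * G.letter a) s' :=
  .snoc u s s' a h hs.1 hs.2

/-- A step reads and writes only its domain, so it can be replayed from any state that agrees there.
-/
theorem Step.congr {a : A} {s s' t : ∀ p, G.State p} (h : G.Step a s s')
    (hst : ∀ p ∈ G.dom a, s p = t p) :
    ∃ t', G.Step a t t' ∧ ∀ p ∈ G.dom a, t' p = s' p := by
  classical
  refine ⟨fun p => if p ∈ G.dom a then s' p else t p, ⟨?_, fun p hp => if_neg hp⟩,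
    fun p hp => if_pos hp⟩
  convert h.1 using 1
  · funext p; exact (hst _ p.2).symm
  · funext p; exact if_pos p.2

theorem Step.det {a : A} {s s' s'' : ∀ p, G.State p} (h : G.Step a s s') (h' : G.Step a s s'') :
    s' = s'' := by
  funext p
  by_cases hp : p ∈ G.dom a
  · exact congrFun (G.det _ _ _ _ h.1 h'.1) ⟨p, hp⟩
  · rw [h.2 p hp, h'.2 p hp]

/-- Independent steps commute. -/
theorem Step.diamond {a b : A} (hab : G.Indep a b) {s s₁ s₂ : ∀ p, G.State p}
    (h₁ : G.Step a s s₁) (h₂ : G.Step b s₁ s₂) : ∃ t, G.Step b s t ∧ G.Step a t s₂ := by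
  have hd := Set.disjoint_left.1 hab
  have hd' := Set.disjoint_right.1 hab
  obtain ⟨t, ht, ht'⟩ := h₂.congr (t := s) fun p hp => h₁.2 p (hd' hp)
  obtain ⟨t', h3, h4⟩ := h₁.congr (t := t) fun p hp => (ht.2 p (hd hp)).symm
  refine ⟨t, ht, ?_⟩
  convert h3
  funext p
  by_cases ha : p ∈ G.dom a
  · rw [h4 p ha, h₂.2 p (hd ha)]
  · rw [h3.2 p ha]
    by_cases hb : p ∈ G.dom b
    · rw [ht' p hb]
    · rw [ht.2 p hb, h₂.2 p hb, h₁.2 p ha]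

theorem PlayState.eq_init {s : ∀ p, G.State p} (h : G.PlayState 1 s) : s = G.init := by
  generalize hu : (1 : G.Trace) = u at h
  cases h with
  | nil => rfl
  | snoc u s s' a =>
    have := congrArg G.length hu
    simp [length_mul, length_letter, length_one] at this

/-- `PlayState` remembers one linearization, but any letter that can be put last may be undone: if
the recorded last letter is another one, the two are independent by Levi's lemma and the steps are
exchanged by `Step.diamond`. -/
theorem PlayState.exists_step {u : G.Trace} {a : A} {s : ∀ p, G.State p}
    (h : G.PlayState (u * G.letter a) s) : ∃ t, G.PlayState u t ∧ G.Step a t s := by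
  generalize hw : u * G.letter a = w at h
  induction h generalizing u a with
  | nil =>
    have := congrArg G.length hw
    simp [length_mul, length_letter, length_one] at this
  | snoc w t s b hwt h1 h2 ih =>
    rcases G.levi_letters hw with ⟨rfl, rfl⟩ | ⟨u', rfl, rfl, hab⟩
    · exact ⟨t, hwt, h1, h2⟩
    · obtain ⟨r, hr, hrt⟩ := ih rfl
      obtain ⟨r', h3, h4⟩ := hrt.diamond hab.symm ⟨h1, h2⟩
      exact ⟨r', hr.step h3, h4⟩

theorem PlayState.unique {u : G.Trace} {s s' : ∀ p, G.State p} (h : G.PlayState u s)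
    (h' : G.PlayState u s') : s = s' := by
  induction u using G.trace_induction generalizing s s' with
  | one => rw [h.eq_init, h'.eq_init]
  | snoc u a ih =>
    obtain ⟨t, ht, hs⟩ := h.exists_step
    obtain ⟨t', ht', hs'⟩ := h'.exists_step
    cases ih ht ht'
    exact hs.det hs'

theorem PlayState.of_mul {u v : G.Trace} {s : ∀ p, G.State p} (h : G.PlayState (u * v) s) :
    ∃ t, G.PlayState u t ∧ ∀ p ∉ G.traceDom v, s p = t p := by
  induction v using G.trace_induction generalizing s with
  | one => exact ⟨s, by simpa using h, fun _ _ => rfl⟩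
  | snoc v a ih =>
    rw [← mul_assoc] at h
    obtain ⟨r, hr, hs⟩ := h.exists_step
    obtain ⟨t, ht, h1⟩ := ih hr
    refine ⟨t, ht, fun p hp => ?_⟩
    rw [traceDom_mul, traceDom_letter, Set.mem_union, not_or] at hp
    rw [hs.2 p hp.2, h1 p hp.1]

theorem IsPlay.of_mul {u v : G.Trace} (h : G.IsPlay (u * v)) : G.IsPlay u := by
  obtain ⟨s, hs⟩ := h
  obtain ⟨t, ht, -⟩ := hs.of_mul
  exact ⟨t, ht⟩

variable (G)

theorem isPlay_one : G.IsPlay 1 := ⟨_, .nil⟩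

/-! ### Local memories -/

section Memory

variable {M : Type} (upd : A → (P → M) → P → M) (d : M)

open Classical in
/-- The update of the memories of the processes by a letter: only the processes in the domain of the
letter update their memories, and they only see the memories of each other (the memories of the
other processes are replaced by `d`). -/
noncomputable def memStep (a : A) (m : P → M) (p : P) : M :=
  if p ∈ G.dom a then upd a (fun q => if q ∈ G.dom a then m q else d) p else m p

/-- Independent letters update the memories of disjoint sets of processes, and each update reads
only its own set. Masking the other memories by `d` is what makes this work for arbitrary `upd`. -/
theorem memStep_comm {a b : A} (h : G.Indep a b) (m : P → M) :
    G.memStep upd d b (G.memStep upd d a m) = G.memStep upd d a (G.memStep upd d b m) := by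
  classical
  have hd := Set.disjoint_left.1 h
  have hd' := Set.disjoint_right.1 h
  have key : ∀ {a b : A} (_ : ∀ p ∈ G.dom a, p ∉ G.dom b) (q : P),
      (if q ∈ G.dom a then G.memStep upd d b m q else d) = if q ∈ G.dom a then m q else d := by
    intro a b hab q
    split_ifs with hq
    · rw [memStep, if_neg (hab q hq)]
    · rfl
  funext p
  by_cases ha : p ∈ G.dom a
  · simp only [memStep, if_pos ha, if_neg (hd ha)]
    exact congrArg (fun f => upd a f p) (funext fun q => (key (fun _ h => hd h) q).symm)
  · by_cases hb : p ∈ G.dom b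
    · simp only [memStep, if_pos hb, if_neg ha]
      exact congrArg (fun f => upd b f p) (funext fun q => (key (fun _ h => hd' h) q))
    · simp only [memStep, if_neg ha, if_neg hb]

/-- The action of traces on memories. -/
noncomputable def memHom : G.Trace →* (Function.End (P → M))ᵐᵒᵖ :=
  PresentedMonoid.lift (M := (Function.End (P → M))ᵐᵒᵖ)
    (fun a => MulOpposite.op (G.memStep upd d a)) (by
    rintro _ _ ⟨a, b, h, rfl, rfl⟩
    simp only [map_mul, FreeMonoid.lift_eval_of]
    exact congrArg MulOpposite.op (funext fun t => G.memStep_comm upd d h t))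

/-- The memories of the processes after a trace; all memories are `d` at the beginning. -/
noncomputable def mem (u : G.Trace) : P → M := (G.memHom upd d u).unop fun _ => d

theorem mem_one : G.mem upd d 1 = fun _ => d := by
  rw [mem, map_one]; rfl

theorem mem_snoc (u : G.Trace) (a : A) :
    G.mem upd d (u * G.letter a) = G.memStep upd d a (G.mem upd d u) := by
  rw [mem, map_mul]; rfl

/-- Hence a strategy that decides from the memories depends only on the causal view. -/
theorem mem_mul {u v : G.Trace} {p : P} (h : p ∉ G.traceDom v) :
    G.mem upd d (u * v) p = G.mem upd d u p := by
  induction v using G.trace_induction with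
  | one => rw [mul_one]
  | snoc v a ih =>
    rw [traceDom_mul, traceDom_letter, Set.mem_union, not_or] at h
    rw [← mul_assoc, mem_snoc, memStep, if_neg h.2, ih h.1]

end Memory

end AsyncAutomaton

/-! ### Strategies -/

namespace DistributedGame

variable {P A : Type} {G : DistributedGame P A}

namespace Strategy

variable (σ : G.Strategy)

/-- What a process allows only depends on the part of a play before a suffix in which it does not
play. -/
theorem allow_mul {p : P} {u v : G.Trace} (h : G.IsPlay (u * v)) (hv : p ∉ G.traceDom v) :
    σ.allow p (u * v) = σ.allow p u := by
  obtain ⟨w, hw⟩ := G.exists_isView p u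
  rw [σ.view p u w h.of_mul hw, σ.view p (u * v) w h (hw.mul _ hv)]

variable {σ}

theorem consistent_one : σ.Consistent 1 :=
  ⟨G.isPlay_one, [], rfl, by simp⟩

theorem Consistent.snoc {u : G.Trace} {a : A} (h : σ.Consistent u)
    (hp : G.IsPlay (u * G.letter a)) (ha : ∀ p ∈ G.dom a, a ∈ σ.allow p u) :
    σ.Consistent (u * G.letter a) := by
  obtain ⟨h1, w, rfl, h2⟩ := h
  refine ⟨hp, w ++ [a], (G.ofWord_snoc w a).symm, fun w₁ b w₂ hw => ?_⟩
  rcases List.eq_nil_or_concat w₂ with rfl | ⟨w₃, c, rfl⟩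
  · obtain ⟨rfl, h⟩ := List.append_inj' hw rfl
    cases h
    exact ha
  · rw [List.concat_eq_append, ← List.cons_append, ← List.append_assoc] at hw
    obtain ⟨h, -⟩ := List.append_inj' hw rfl
    exact h2 w₁ b w₃ h

/-- The letters of a consistent play are consistent with the strategy in every linearization. -/
theorem Consistent.of_snoc {u : G.Trace} {a : A} (h : σ.Consistent (u * G.letter a)) :
    σ.Consistent u ∧ ∀ p ∈ G.dom a, a ∈ σ.allow p u := by
  obtain ⟨hp, w, hw, h⟩ := h
  induction w using List.reverseRecOn generalizing u a with
  | nil =>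
    have := congrArg G.length hw
    simp [G.length_mul, G.length_letter, G.ofWord_nil, G.length_one] at this
  | append_singleton w b ih =>
    rw [G.ofWord_snoc] at hw
    have hw' : ∀ w₁ c w₂, w = w₁ ++ c :: w₂ → ∀ p ∈ G.dom c, c ∈ σ.allow p (G.ofWord w₁) :=
      fun w₁ c w₂ e => h w₁ c (w₂ ++ [b]) (by rw [e]; simp)
    have hb := h w b [] rfl
    -- Either a is also the last letter of the given linearization, or it can be commuted with that
    -- letter; in the second case neither permission changes under the exchange, because the
    -- processes of one letter do not see the other.
    rcases G.levi_letters hw.symm with ⟨rfl, hu⟩ | ⟨u', rfl, h2, hab⟩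
    · subst hu
      exact ⟨⟨hp.of_mul, w, rfl, hw'⟩, hb⟩
    · have hpw : G.IsPlay (u' * G.letter a) := by
        rw [← h2]; rw [hw] at hp; exact hp.of_mul
      obtain ⟨h3, h4⟩ := ih hpw h2.symm hw'
      have hd := Set.disjoint_left.1 hab
      have hd' := Set.disjoint_right.1 hab
      refine ⟨h3.snoc hp.of_mul fun p hpb => ?_, fun p hpa => ?_⟩
      · have := hb p hpb
        rwa [h2, σ.allow_mul hpw (by rw [G.traceDom_letter]; exact hd' hpb)] at this
      · rw [σ.allow_mul hp.of_mul (by rw [G.traceDom_letter]; exact hd hpa)]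
        exact h4 p hpa

theorem Consistent.of_mul {u v : G.Trace} (h : σ.Consistent (u * v)) : σ.Consistent u := by
  induction v using G.trace_induction with
  | one => simpa using h
  | snoc v a ih => rw [← mul_assoc] at h; exact ih h.of_snoc.1

/-- As there are finitely many consistent plays, a longest extension exists, and it is maximal. -/
theorem Winning.exists_maximal (hσ : σ.Winning) {u : G.Trace} (hu : σ.Consistent u) :
    ∃ v, σ.Maximal (u * v) := by
  obtain ⟨w, ⟨hw, v, rfl⟩, hmax⟩ := (hσ.1.subset fun w (hw : w ∈ {w | σ.Consistent w ∧
    G.IsPrefix u w}) => hw.1).exists_maximalFor G.length _ ⟨u, hu, 1, mul_one u⟩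
  refine ⟨v, hw, ?_⟩
  rintro _ h ⟨v', rfl⟩
  have := hmax ⟨h, v * v', by rw [mul_assoc]⟩ (by simp [G.length_mul])
  rw [G.length_mul] at this
  rw [G.eq_one_of_length_eq_zero (u := v') (by omega), mul_one]

/-- If a set of processes is stuck after a consistent play then these processes are in final states:
every letter of such a process that can be played when these processes are in their current states
belongs to these processes only, and one of them does not allow it. -/
theorem Winning.final_of_stuck (hσ : σ.Winning) {u : G.Trace} (hu : σ.Consistent u)
    {s : ∀ p, G.State p} (hs : G.PlayState u s) (D : Set P)
    (hD : ∀ t t' a, (∀ p ∈ D, t p = s p) → G.Step a t t' → (∃ p ∈ D, p ∈ G.dom a) →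
      G.dom a ⊆ D ∧ ∃ p ∈ G.dom a, a ∉ σ.allow p u) : ∀ p ∈ D, s p ∈ G.final p := by
  obtain ⟨v, hv⟩ := hσ.exists_maximal hu
  obtain ⟨t, ht⟩ := hv.1.1
  -- No consistent continuation ever touches D: before its first letter in D the states on D are
  -- still those of s, so `hD` puts that letter inside D, where a process that has seen nothing new
  -- refuses it.
  have key : ∀ v, σ.Consistent (u * v) → ∀ p ∈ D, p ∉ G.traceDom v := by
    intro v hv
    induction v using G.trace_induction with
    | one => simp [G.traceDom_one]
    | snoc v a ih =>
      rw [← mul_assoc] at hv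
      obtain ⟨h1, h2⟩ := hv.of_snoc
      have ih := ih h1
      intro p hp
      rw [G.traceDom_mul, G.traceDom_letter, Set.mem_union, not_or]
      refine ⟨ih p hp, fun hpa => ?_⟩
      obtain ⟨t', ht'⟩ := hv.1
      obtain ⟨t, ht, hst⟩ := ht'.exists_step
      obtain ⟨r, hr, hrt⟩ := ht.of_mul
      cases hs.unique hr
      obtain ⟨hsub, q, hq, hna⟩ := hD t t' a (fun q hq => hrt q (ih q hq)) hst ⟨p, hp, hpa⟩
      refine hna ?_
      rw [← σ.allow_mul h1.1 (ih q (hsub hq))]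
      exact h2 q hq
  obtain ⟨s', hs', h1⟩ := ht.of_mul
  cases hs.unique hs'
  intro p hp
  rw [← h1 p (key v hv.1 p hp)]
  exact hσ.2 _ hv t ht p

end Strategy

end DistributedGame

/-! ### The game of a coloring instance

The processes of each pool synchronize in the cyclic order `X₀X₁, X₁X₂, X₂X₀, X₀X₁, …`; three
consecutive synchronizations form a round.  The states of a process are coded by numbers:

* `0` the initial state of `X₀`, `1` the state before the first synchronization,
* `2` (first round) and `3` (other rounds) after the synchronization `X₀X₁`,
* `4` after `X₁X₂`, `5` after `X₂X₀`, and `6` for `X₀` after the last synchronization `X₂X₀`,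
* `7` the process has left the game, `8` the process `B_l` has answered a check,
* `9` the game is lost,
* `10`, `11`, `12` the process `T_l` is being checked; the three values are the kinds of the check,
* `13` the process `B_l` is being checked,
* `14 + 3 * c + i` the process `T_l` has answered a check of kind `i` with the color `c`.

The letters are, where `X = 0` for the top pool and `X = 1` for the bottom pool,

* `X` (join) and `2 + X` (quit), environment letters of `X₀`,
* `4 + X`, `6 + X`, `8 + X` the synchronizations, `10 + X` the last synchronization,
* `12 + X` and `14 + X`: the process `X₀` leaves after `X₁`, respectively `X₂`, answered a check,
* `16 + l` the check of `T_l` and `B_l`,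
* `19` the environment wins,
* `20 + 3 * c + l` the processes `T_l` and `B_l` answer the color `c`. -/

namespace ColoringInstance

/-- The domains of the letters below `20` and of the answers of the three pairs, and whether the
letter is controllable. -/
def letterTable : List ((Fin 6 → Bool) × Bool) :=
  [(![true, false, false, false, false, false], false),
   (![false, false, false, true, false, false], false),
   (![true, false, false, false, false, false], false),
   (![false, false, false, true, false, false], false),
   (![true, true, false, false, false, false], true),
   (![false, false, false, true, true, false], true),
   (![false, true, true, false, false, false], true),
   (![false, false, false, false, true, true], true),
   (![true, false, true, false, false, false], true),
   (![false, false, false, true, false, true], true),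
   (![true, false, true, false, false, false], true),
   (![false, false, false, true, false, true], true),
   (![true, true, false, false, false, false], true),
   (![false, false, false, true, true, false], true),
   (![true, false, true, false, false, false], true),
   (![false, false, false, true, false, true], true),
   (![true, false, false, true, false, false], false),
   (![false, true, false, false, true, false], false),
   (![false, false, true, false, false, true], false),
   (![true, true, true, true, true, true], false),
   (![true, false, false, true, false, false], true),
   (![false, true, false, false, true, false], true),
   (![false, false, true, false, false, true], true)]

/-- The position of a letter in the table. -/
def letterIndex (j : ℕ) : ℕ := if j < 20 then j else 20 + (j + 1) % 3

/-- The domain of a letter, and whether it is controllable. -/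
def letterInfo (j : ℕ) : (Fin 6 → Bool) × Bool :=
  letterTable.getD (letterIndex j) (fun _ => true, true)

/-- A transition. -/
abbrev Rule : Type := ℕ × (Fin 6 → ℕ) × (Fin 6 → ℕ)

/-- The transitions that do not involve colors. -/
def fixedRules : List Rule :=
  [(0, ![0, 0, 0, 0, 0, 0], ![1, 0, 0, 0, 0, 0]),
   (1, ![0, 0, 0, 0, 0, 0], ![0, 0, 0, 1, 0, 0]),
   (2, ![0, 0, 0, 0, 0, 0], ![7, 0, 0, 0, 0, 0]),
   (3, ![0, 0, 0, 0, 0, 0], ![0, 0, 0, 7, 0, 0]),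
   (4, ![1, 1, 0, 0, 0, 0], ![2, 3, 0, 0, 0, 0]),
   (5, ![0, 0, 0, 1, 1, 0], ![0, 0, 0, 2, 3, 0]),
   (4, ![5, 4, 0, 0, 0, 0], ![3, 3, 0, 0, 0, 0]),
   (5, ![0, 0, 0, 5, 4, 0], ![0, 0, 0, 3, 3, 0]),
   (6, ![0, 3, 1, 0, 0, 0], ![0, 4, 4, 0, 0, 0]),
   (7, ![0, 0, 0, 0, 3, 1], ![0, 0, 0, 0, 4, 4]),
   (6, ![0, 3, 5, 0, 0, 0], ![0, 4, 4, 0, 0, 0]),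
   (7, ![0, 0, 0, 0, 3, 5], ![0, 0, 0, 0, 4, 4]),
   (8, ![2, 0, 4, 0, 0, 0], ![5, 0, 5, 0, 0, 0]),
   (9, ![0, 0, 0, 2, 0, 4], ![0, 0, 0, 5, 0, 5]),
   (8, ![3, 0, 4, 0, 0, 0], ![5, 0, 5, 0, 0, 0]),
   (9, ![0, 0, 0, 3, 0, 4], ![0, 0, 0, 5, 0, 5]),
   (10, ![2, 0, 4, 0, 0, 0], ![6, 0, 5, 0, 0, 0]),
   (11, ![0, 0, 0, 2, 0, 4], ![0, 0, 0, 6, 0, 5]),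
   (10, ![3, 0, 4, 0, 0, 0], ![6, 0, 5, 0, 0, 0]),
   (11, ![0, 0, 0, 3, 0, 4], ![0, 0, 0, 6, 0, 5]),
   (13, ![0, 0, 0, 5, 8, 0], ![0, 0, 0, 7, 8, 0]),
   (15, ![0, 0, 0, 2, 0, 8], ![0, 0, 0, 7, 0, 8]),
   (15, ![0, 0, 0, 3, 0, 8], ![0, 0, 0, 7, 0, 8]),
   (16, ![2, 0, 0, 2, 0, 0], ![10, 0, 0, 13, 0, 0]),
   (16, ![2, 0, 0, 3, 0, 0], ![11, 0, 0, 13, 0, 0]),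
   (16, ![3, 0, 0, 2, 0, 0], ![11, 0, 0, 13, 0, 0]),
   (16, ![3, 0, 0, 3, 0, 0], ![11, 0, 0, 13, 0, 0]),
   (16, ![6, 0, 0, 6, 0, 0], ![12, 0, 0, 13, 0, 0]),
   (17, ![0, 4, 0, 0, 4, 0], ![0, 10, 0, 0, 13, 0]),
   (18, ![0, 0, 5, 0, 0, 4], ![0, 0, 10, 0, 0, 13]),
   (18, ![0, 0, 4, 0, 0, 5], ![0, 0, 11, 0, 0, 13]),
   (18, ![0, 0, 5, 0, 0, 5], ![0, 0, 12, 0, 0, 13])]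

/-- The transitions for the color `c`. -/
def colorRules (c : ℕ) : List Rule :=
  [(12, ![5, 14 + 3 * c, 0, 0, 0, 0], ![7, 14 + 3 * c, 0, 0, 0, 0]),
   (14, ![2, 0, 14 + 3 * c, 0, 0, 0], ![7, 0, 14 + 3 * c, 0, 0, 0]),
   (14, ![2, 0, 15 + 3 * c, 0, 0, 0], ![7, 0, 15 + 3 * c, 0, 0, 0]),
   (14, ![2, 0, 16 + 3 * c, 0, 0, 0], ![7, 0, 16 + 3 * c, 0, 0, 0]),
   (14, ![3, 0, 14 + 3 * c, 0, 0, 0], ![7, 0, 14 + 3 * c, 0, 0, 0]),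
   (14, ![3, 0, 15 + 3 * c, 0, 0, 0], ![7, 0, 15 + 3 * c, 0, 0, 0]),
   (14, ![3, 0, 16 + 3 * c, 0, 0, 0], ![7, 0, 16 + 3 * c, 0, 0, 0]),
   (20 + 3 * c, ![11, 0, 0, 13, 0, 0], ![14 + 3 * c, 0, 0, 8, 0, 0]),
   (21 + 3 * c, ![0, 10, 0, 0, 13, 0], ![0, 14 + 3 * c, 0, 0, 8, 0]),
   (22 + 3 * c, ![0, 0, 10, 0, 0, 13], ![0, 0, 14 + 3 * c, 0, 0, 8]),
   (22 + 3 * c, ![0, 0, 11, 0, 0, 13], ![0, 0, 15 + 3 * c, 0, 0, 8]),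
   (22 + 3 * c, ![0, 0, 12, 0, 0, 13], ![0, 0, 16 + 3 * c, 0, 0, 8])]

/-- The answer of an allowed initial color. -/
def initialRule (c : ℕ) : Rule :=
  (20 + 3 * c, ![10, 0, 0, 13, 0, 0], ![14 + 3 * c, 0, 0, 8, 0, 0])

/-- The answer of an allowed final color. -/
def finalRule (c : ℕ) : Rule :=
  (20 + 3 * c, ![12, 0, 0, 13, 0, 0], ![15 + 3 * c, 0, 0, 8, 0, 0])

/-- The environment wins. -/
def loseRule (q : Fin 6 → ℕ) : Rule := (19, q, ![9, 9, 9, 9, 9, 9])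

/-- The states in which two checks at the same position are answered with the colors `c` and `d`. -/
def equalRules (c d : ℕ) : List Rule :=
  [loseRule ![14 + 3 * c, 14 + 3 * d, 4, 8, 8, 4],
   loseRule ![15 + 3 * c, 14 + 3 * d, 5, 8, 8, 5],
   loseRule ![5, 14 + 3 * d, 14 + 3 * c, 2, 8, 8],
   loseRule ![5, 14 + 3 * d, 14 + 3 * c, 3, 8, 8],
   loseRule ![2, 14 + 3 * d, 15 + 3 * c, 5, 8, 8],
   loseRule ![3, 14 + 3 * d, 15 + 3 * c, 5, 8, 8],
   loseRule ![5, 14 + 3 * d, 16 + 3 * c, 5, 8, 8]]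

/-- The state in which an upper-triangle is answered. -/
def upperRule (c : ℕ × ℕ) : Rule := loseRule ![14 + 3 * c.2, 3, 14 + 3 * c.1, 8, 4, 8]

/-- The state in which a lower-triangle is answered. -/
def lowerRule (c : ℕ × ℕ) : Rule := loseRule ![14 + 3 * c.2, 4, 15 + 3 * c.1, 8, 3, 8]

/-- The state in which a square is answered. -/
def squareRule (c : ℕ × ℕ) : Rule := loseRule ![14 + 3 * c.2, 3, 16 + 3 * c.1, 8, 3, 8]

/-- All transitions. -/
def rules (I : ColoringInstance) : List Rule :=
  fixedRules ++ (List.range I.numColors).flatMap colorRules ++ I.Ci.map initialRule ++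
    I.Cf.map finalRule ++
    (List.range I.numColors).flatMap (fun d => (List.range d).flatMap fun c =>
      equalRules c d ++ equalRules d c) ++
    I.UT.map upperRule ++ I.LT.map lowerRule ++ I.S.map squareRule

/-- The final states. -/
def finals (I : ColoringInstance) (p : Fin 6) : List ℕ :=
  (if p = 0 ∨ p = 3 then [6, 7, 8] else [1, 3, 4, 5, 8]) ++
    (List.range (3 * I.numColors)).map (14 + ·)

/-- The game of a coloring instance. -/
def code (I : ColoringInstance) : GameCode 6 where
  numStates _ := 14 + 3 * I.numColors
  init := ![0, 1, 1, 0, 1, 1]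
  final := I.finals
  letters := (List.range (20 + 3 * I.numColors)).map letterInfo
  trans := I.rules

/-! ### The game is computable -/

section Primrec

variable {α : Type} [Primcodable α]

/-- Functions on `Fin n` are encoded through vectors of length n. -/
theorem primrec_fun {σ : Type} [Primcodable σ] {n : ℕ} {f : Fin n → α → σ}
    (h : ∀ i, Primrec (f i)) : Primrec fun a i => f i a := by
  refine (Primrec.vector_get'.comp (Primrec.vector_ofFn h)).of_eq fun a => ?_
  funext i; simp

theorem primrec_vec6 {f₀ f₁ f₂ f₃ f₄ f₅ : α → ℕ} (h₀ : Primrec f₀) (h₁ : Primrec f₁)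
    (h₂ : Primrec f₂) (h₃ : Primrec f₃) (h₄ : Primrec f₄) (h₅ : Primrec f₅) :
    Primrec fun a => ![f₀ a, f₁ a, f₂ a, f₃ a, f₄ a, f₅ a] := by
  refine (primrec_fun (f := ![f₀, f₁, f₂, f₃, f₄, f₅]) ?_).of_eq fun a => ?_
  · intro i; fin_cases i <;> assumption
  · funext i; fin_cases i <;> rfl

theorem primrec_affine (k : ℕ) {f : α → ℕ} (h : Primrec f) : Primrec fun a => k + 3 * f a :=
  Primrec.nat_add.comp (.const k) (Primrec.nat_mul.comp (.const 3) h)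

theorem primrec_nil {σ : Type} [Primcodable σ] : Primrec fun _ : α => ([] : List σ) := .const _

theorem primrec_cons {σ : Type} [Primcodable σ] {f : α → σ} {g : α → List σ} (hf : Primrec f)
    (hg : Primrec g) : Primrec fun a => f a :: g a := Primrec.list_cons.comp hf hg

theorem primrec_colorRules : Primrec colorRules := by
  unfold colorRules
  repeat' first
    | exact primrec_nil
    | exact Primrec.const _
    | exact primrec_affine _ .id
    | refine primrec_cons (Primrec.pair ?_ (Primrec.pair ?_ ?_)) ?_
    | refine primrec_vec6 ?_ ?_ ?_ ?_ ?_ ?_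

theorem primrec_initialRule : Primrec initialRule := by
  unfold initialRule
  refine Primrec.pair ?_ (Primrec.pair ?_ ?_)
  all_goals repeat' first
    | exact Primrec.const _
    | exact primrec_affine _ .id
    | refine primrec_vec6 ?_ ?_ ?_ ?_ ?_ ?_

theorem primrec_finalRule : Primrec finalRule := by
  unfold finalRule
  refine Primrec.pair ?_ (Primrec.pair ?_ ?_)
  all_goals repeat' first
    | exact Primrec.const _
    | exact primrec_affine _ .id
    | refine primrec_vec6 ?_ ?_ ?_ ?_ ?_ ?_

theorem primrec_loseRule : Primrec loseRule :=
  Primrec.pair (.const _) (Primrec.pair .id (.const _))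

theorem primrec_pairRules : Primrec upperRule ∧ Primrec lowerRule ∧ Primrec squareRule := by
  unfold upperRule lowerRule squareRule
  refine ⟨primrec_loseRule.comp ?_, primrec_loseRule.comp ?_, primrec_loseRule.comp ?_⟩
  all_goals repeat' first
    | exact Primrec.const _
    | exact primrec_affine _ .fst
    | exact primrec_affine _ .snd
    | refine primrec_vec6 ?_ ?_ ?_ ?_ ?_ ?_

theorem primrec_equalRules {f g : α → ℕ} (hf : Primrec f) (hg : Primrec g) :
    Primrec fun a => equalRules (f a) (g a) := by
  unfold equalRules
  repeat' first
    | exact primrec_nil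
    | exact Primrec.const _
    | exact primrec_affine _ hf
    | exact primrec_affine _ hg
    | refine primrec_cons (primrec_loseRule.comp ?_) ?_
    | refine primrec_vec6 ?_ ?_ ?_ ?_ ?_ ?_

theorem primrec_letterInfo : Primrec letterInfo := by
  refine (Primrec.list_getD (fun _ => true, true)).comp (.const _) ?_
  exact Primrec.ite (Primrec.nat_lt.comp .id (.const _)) .id
    (Primrec.nat_add.comp (.const _) (Primrec.nat_mod.comp Primrec.succ (.const _)))

theorem primrec_code : Primrec code := by
  have hI : Primrec equivTuple := Primrec.of_equiv
  have hk : Primrec numColors := Primrec.fst.comp hI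
  have h1 := Primrec.snd.comp hI
  have h2 := Primrec.snd.comp h1
  have h3 := Primrec.snd.comp h2
  have h4 := Primrec.snd.comp h3
  have hCi : Primrec Ci := Primrec.fst.comp h1
  have hCf : Primrec Cf := Primrec.fst.comp h2
  have hS : Primrec S := Primrec.fst.comp h3
  have hUT : Primrec UT := Primrec.fst.comp h4
  have hLT : Primrec LT := Primrec.snd.comp h4
  have hr : Primrec fun I : ColoringInstance => List.range I.numColors :=
    Primrec.list_range.comp hk
  have hrules : Primrec rules := by
    refine Primrec.list_append.comp (Primrec.list_append.comp (Primrec.list_append.comp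
      (Primrec.list_append.comp (Primrec.list_append.comp (Primrec.list_append.comp
      (Primrec.list_append.comp (.const _) ?_) ?_) ?_) ?_) ?_) ?_) ?_
    · exact Primrec.list_flatMap hr (primrec_colorRules.comp .snd)
    · exact Primrec.list_map hCi (primrec_initialRule.comp .snd)
    · exact Primrec.list_map hCf (primrec_finalRule.comp .snd)
    · refine Primrec.list_flatMap hr (Primrec.list_flatMap (Primrec.list_range.comp .snd) ?_)
      have hc : Primrec fun a : (ColoringInstance × ℕ) × ℕ => a.2 := .snd
      have hd : Primrec fun a : (ColoringInstance × ℕ) × ℕ => a.1.2 := Primrec.snd.comp .fst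
      exact Primrec.list_append.comp (primrec_equalRules hc hd) (primrec_equalRules hd hc)
    · exact Primrec.list_map hUT (primrec_pairRules.1.comp .snd)
    · exact Primrec.list_map hLT (primrec_pairRules.2.1.comp .snd)
    · exact Primrec.list_map hS (primrec_pairRules.2.2.comp .snd)
  have hfin : Primrec finals := by
    refine primrec_fun fun p => Primrec.list_append.comp (.const _) ?_
    exact Primrec.list_map (Primrec.list_range.comp (Primrec.nat_mul.comp (.const _) hk))
      (Primrec.nat_add.comp (.const _) .snd)
  refine (Primrec.of_equiv_iff (GameCode.equivTuple 6)).1 ?_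
  refine Primrec.pair ?_ (Primrec.pair (.const _) (Primrec.pair hfin (Primrec.pair ?_ hrules)))
  · exact primrec_fun fun _ => primrec_affine _ hk
  · exact Primrec.list_map (Primrec.list_range.comp (primrec_affine _ hk))
      (primrec_letterInfo.comp .snd)

end Primrec

end ColoringInstance

namespace ColoringInstance

/-! ### The game is well-formed -/

theorem letterInfo_answer₀ (c : ℕ) :
    letterInfo (20 + 3 * c) = (![true, false, false, true, false, false], true) := by
  have : letterIndex (20 + 3 * c) = 20 := by unfold letterIndex; split_ifs <;> omega
  rw [letterInfo, this]; rfl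

theorem letterInfo_answer₁ (c : ℕ) :
    letterInfo (21 + 3 * c) = (![false, true, false, false, true, false], true) := by
  have : letterIndex (21 + 3 * c) = 21 := by unfold letterIndex; split_ifs <;> omega
  rw [letterInfo, this]; rfl

theorem letterInfo_answer₂ (c : ℕ) :
    letterInfo (22 + 3 * c) = (![false, false, true, false, false, true], true) := by
  have : letterIndex (22 + 3 * c) = 22 := by unfold letterIndex; split_ifs <;> omega
  rw [letterInfo, this]; rfl

/-- The letter `j` is one of the letters of the table or an answer. -/
theorem letter_cases (j : ℕ) :
    j < 20 ∨ (∃ c, j = 20 + 3 * c) ∨ (∃ c, j = 21 + 3 * c) ∨ ∃ c, j = 22 + 3 * c := by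
  by_cases h : j < 20
  · exact .inl h
  · have : (j - 20) % 3 = 0 ∨ (j - 20) % 3 = 1 ∨ (j - 20) % 3 = 2 := by omega
    rcases this with h | h | h
    · exact .inr (.inl ⟨(j - 20) / 3, by omega⟩)
    · exact .inr (.inr (.inl ⟨(j - 20) / 3, by omega⟩))
    · exact .inr (.inr (.inr ⟨(j - 20) / 3, by omega⟩))

theorem mem_rules {I : ColoringInstance} {t : Rule} : t ∈ I.rules ↔
    t ∈ fixedRules ∨ (∃ c < I.numColors, t ∈ colorRules c) ∨ (∃ c ∈ I.Ci, initialRule c = t) ∨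
      (∃ c ∈ I.Cf, finalRule c = t) ∨
      (∃ d < I.numColors, ∃ c < d, t ∈ equalRules c d ∨ t ∈ equalRules d c) ∨
      (∃ c ∈ I.UT, upperRule c = t) ∨ (∃ c ∈ I.LT, lowerRule c = t) ∨
      ∃ c ∈ I.S, squareRule c = t := by
  simp only [rules, List.mem_append, List.mem_flatMap, List.mem_range, List.mem_map, or_assoc]

/-- The target of a transition, as a function of its letter and its source. -/
def target (a : ℕ) (q : Fin 6 → ℕ) : Fin 6 → ℕ :=
  if a < 2 then fun _ => 1
  else if a < 4 then fun _ => 7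
  else if a = 4 then ![if q 0 = 1 then 2 else 3, 3, 0, 0, 0, 0]
  else if a = 5 then ![0, 0, 0, if q 3 = 1 then 2 else 3, 3, 0]
  else if a < 8 then fun _ => 4
  else if a < 10 then fun _ => 5
  else if a < 12 then ![6, 0, 5, 6, 0, 5]
  else if a < 16 then fun p => if p = 0 ∨ p = 3 then 7 else q p
  else if a = 16 then
    ![if q 0 = 6 then 12 else if q 0 = 2 ∧ q 3 = 2 then 10 else 11, 0, 0, 13, 0, 0]
  else if a = 17 then ![0, 10, 0, 0, 13, 0]
  else if a = 18 then ![0, 0, if q 2 = 4 then 11 else if q 5 = 4 then 10 else 12, 0, 0, 13]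
  else if a = 19 then fun _ => 9
  else if (a - 20) % 3 = 0 then ![if q 0 = 12 then a - 5 else a - 6, 0, 0, 8, 0, 0]
  else if (a - 20) % 3 = 1 then ![0, a - 7, 0, 0, 8, 0]
  else ![0, 0, a - 8 + (q 2 - 10), 0, 0, 8]

theorem target_of_lt {a : ℕ} (ha : 19 < a) (q : Fin 6 → ℕ) : target a q =
    if (a - 20) % 3 = 0 then ![if q 0 = 12 then a - 5 else a - 6, 0, 0, 8, 0, 0]
    else if (a - 20) % 3 = 1 then ![0, a - 7, 0, 0, 8, 0]
    else ![0, 0, a - 8 + (q 2 - 10), 0, 0, 8] := by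
  unfold target
  iterate 12 rw [if_neg (by omega)]

theorem target_answer₀ (c : ℕ) (q : Fin 6 → ℕ) : target (20 + 3 * c) q =
    ![if q 0 = 12 then 15 + 3 * c else 14 + 3 * c, 0, 0, 8, 0, 0] := by
  rw [target_of_lt (by omega), if_pos (by omega)]
  congr 2 <;> omega

theorem target_answer₁ (c : ℕ) (q : Fin 6 → ℕ) : target (21 + 3 * c) q =
    ![0, 14 + 3 * c, 0, 0, 8, 0] := by
  rw [target_of_lt (by omega), if_neg (by omega), if_pos (by omega)]
  congr 2; omega

theorem target_answer₂ (c : ℕ) (q : Fin 6 → ℕ) : target (22 + 3 * c) q =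
    ![0, 0, 14 + 3 * c + (q 2 - 10), 0, 0, 8] := by
  rw [target_of_lt (by omega), if_neg (by omega), if_neg (by omega)]
  congr 3; omega

/-- `target` reads the source only inside the domain of the letter. With `target_of_mem` this gives
determinism without comparing transitions two by two. -/
theorem target_congr {a : ℕ} {q q' : Fin 6 → ℕ} (h : ∀ p, (letterInfo a).1 p = true → q p = q' p)
    {p : Fin 6} (hp : (letterInfo a).1 p = true) : target a q p = target a q' p := by
  have h0 := h 0
  have h2 := h 2
  have h3 := h 3
  have h5 := h 5
  have hq := h p hp
  rcases letter_cases a with ha | ⟨c, rfl⟩ | ⟨c, rfl⟩ | ⟨c, rfl⟩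
  · clear h hp
    interval_cases a <;> simp_all [target, letterInfo, letterTable, letterIndex]
  · rw [target_answer₀, target_answer₀, h0 (by rw [letterInfo_answer₀]; rfl)]
  · rw [target_answer₁, target_answer₁]
  · rw [target_answer₂, target_answer₂, h2 (by rw [letterInfo_answer₂]; rfl)]

theorem target_of_mem {I : ColoringInstance} {t : Rule} (ht : t ∈ I.rules) {p : Fin 6}
    (hp : (letterInfo t.1).1 p = true) : t.2.2 p = target t.1 t.2.1 p := by
  rcases mem_rules.1 ht with h | ⟨c, -, h⟩ | ⟨c, -, rfl⟩ | ⟨c, -, rfl⟩ | ⟨d, -, c, -, h⟩ |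
    ⟨c, -, rfl⟩ | ⟨c, -, rfl⟩ | ⟨c, -, rfl⟩
  · have : ∀ t ∈ fixedRules, ∀ p, (letterInfo t.1).1 p = true →
        t.2.2 p = target t.1 t.2.1 p := by decide
    exact this t h p hp
  · clear ht
    simp only [colorRules, List.mem_cons, List.not_mem_nil, or_false] at h
    rcases h with rfl | rfl | rfl | rfl | rfl | rfl | rfl | rfl | rfl | rfl | rfl | rfl
    all_goals
      simp only [letterInfo_answer₀, letterInfo_answer₁, letterInfo_answer₂] at hp
      fin_cases p <;> simp [letterInfo, letterTable, letterIndex] at hp <;>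
        first
          | simp [target_answer₀, target_answer₁, target_answer₂]; done
          | simp [target_answer₂]; omega
          | simp [target]
  · simp only [initialRule, letterInfo_answer₀] at hp
    fin_cases p <;> simp at hp <;> simp [initialRule, target_answer₀]
  · simp only [finalRule, letterInfo_answer₀] at hp
    fin_cases p <;> simp at hp <;> simp [finalRule, target_answer₀]
  · have : ∃ q, t = loseRule q := by
      simp only [equalRules, List.mem_cons, List.not_mem_nil, or_false] at h
      rcases h with h | h <;> rcases h with h | h | h | h | h | h | h <;> exact ⟨_, h⟩
    obtain ⟨q, rfl⟩ := this
    fin_cases p <;> rfl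
  all_goals fin_cases p <;> rfl

variable (I : ColoringInstance)

theorem get_letters (a : I.code.Letter) : I.code.letters.get a = letterInfo a := by
  have (n : ℕ) (a : Fin ((List.range n).map letterInfo).length) :
      ((List.range n).map letterInfo).get a = letterInfo a := by simp
  exact this _ a

theorem length_letters : I.code.letters.length = 20 + 3 * I.numColors := by simp [code]

theorem exists_dom (a : ℕ) : (∃ p : Fin 6, {q | (letterInfo a).1 q = true} = {p}) ∨
    ((letterInfo a).2 = true ∧ ∃ l : Fin 3,
      {q | (letterInfo a).1 q = true} = {topProc l, topProc (l + 1)} ∨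
      {q | (letterInfo a).1 q = true} = {botProc l, botProc (l + 1)}) ∨
    (∃ l, {q | (letterInfo a).1 q = true} = {topProc l, botProc l}) ∨
    {q | (letterInfo a).1 q = true} = Set.univ := by
  simp only [Set.ext_iff, Set.mem_ofPred_eq, Set.mem_insert_iff, Set.mem_singleton_iff,
    Set.mem_univ, iff_true]
  rcases letter_cases a with ha | ⟨c, rfl⟩ | ⟨c, rfl⟩ | ⟨c, rfl⟩
  · revert a; decide
  · rw [letterInfo_answer₀]; decide
  · rw [letterInfo_answer₁]; decide
  · rw [letterInfo_answer₂]; decide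

theorem wellFormed : I.code.WellFormed where
  init_lt p := by fin_cases p <;> simp [code] <;> omega
  covers a := by
    have : ∃ p : Fin 6, (letterInfo a).1 p = true := by
      rcases letter_cases a with ha | ⟨c, hc⟩ | ⟨c, hc⟩ | ⟨c, hc⟩
      · generalize (a : ℕ) = b at ha
        revert b; decide
      · rw [hc, letterInfo_answer₀]; decide
      · rw [hc, letterInfo_answer₁]; decide
      · rw [hc, letterInfo_answer₂]; decide
    obtain ⟨p, hp⟩ := this
    exact ⟨p, by rw [GameCode.Act, Set.mem_ofPred_eq, get_letters]; exact hp⟩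
  det := by
    rintro a q q' q'' ⟨t, ht, hta, h⟩ ⟨t', ht', hta', h'⟩
    funext ⟨p, hp⟩
    have hdom : ∀ p, p ∈ {p | a ∈ I.code.Act p} ↔ (letterInfo a).1 p = true := fun p => by
      rw [Set.mem_ofPred_eq, GameCode.Act, Set.mem_ofPred_eq, get_letters]
    have hp' := (hdom p).1 hp
    refine Fin.ext ?_
    rw [← (h ⟨p, hp⟩).2, ← (h' ⟨p, hp⟩).2, target_of_mem ht (hta ▸ hp'),
      target_of_mem ht' (hta' ▸ hp'), hta, hta']
    exact target_congr (fun p hp => by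
      rw [(h ⟨p, (hdom p).2 hp⟩).1, (h' ⟨p, (hdom p).2 hp⟩).1]) hp'

/-- The distributed game of a coloring instance. -/
def game : DistributedGame (Fin 6) I.code.Letter := I.code.toGame I.wellFormed

theorem mem_dom {a : I.code.Letter} {p : Fin 6} :
    p ∈ I.game.dom a ↔ (letterInfo a).1 p = true := by
  change (I.code.letters.get a).1 p = true ↔ _
  rw [get_letters]

theorem mem_ctrl {a : I.code.Letter} : a ∈ I.game.ctrl ↔ (letterInfo a).2 = true := by
  change (I.code.letters.get a).2 = true ↔ _
  rw [get_letters]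

theorem twoPools : I.game.TwoPools := by
  have hdom : ∀ a, I.game.dom a = {p | (letterInfo a).1 p = true} :=
    fun a => Set.ext fun p => I.mem_dom
  constructor
  · intro a
    rw [hdom, mem_ctrl]
    exact exists_dom a
  · intro l
    refine ⟨⟨16 + l, by rw [length_letters]; omega⟩, ?_, ?_⟩
    · rw [mem_ctrl]; fin_cases l <;> exact Bool.false_ne_true
    · rw [hdom]
      simp only [Set.ext_iff, Set.mem_ofPred_eq, Set.mem_insert_iff, Set.mem_singleton_iff]
      fin_cases l <;> decide

/-! ### Steps of the game -/

/-- The transition `t` leads from the global state `s` to the global state `s'`. -/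
def Fires (t : Rule) (s s' : Fin 6 → ℕ) : Prop :=
  ∀ p, if (letterInfo t.1).1 p = true then s p = t.2.1 p ∧ s' p = t.2.2 p else s' p = s p

variable {I}

/-- The global state as a function to the natural numbers. -/
def val (s : ∀ p, I.game.State p) (p : Fin 6) : ℕ :=
  Fin.val (n := 14 + 3 * I.numColors) (s p)

theorem val_lt (s : ∀ p, I.game.State p) (p : Fin 6) : val s p < 14 + 3 * I.numColors :=
  Fin.isLt (n := 14 + 3 * I.numColors) (s p)

/-- Converts steps between dependent state families into equations between natural numbers, which
can be handled transition by transition. -/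
theorem step_iff {a : I.code.Letter} {s s' : ∀ p, I.game.State p} :
    I.game.Step a s s' ↔ ∃ t ∈ I.rules, t.1 = a ∧ Fires t (val s) (val s') := by
  constructor
  · rintro ⟨⟨t, ht, hta, h⟩, h'⟩
    refine ⟨t, ht, hta, fun p => ?_⟩
    split_ifs with hp
    · rw [hta] at hp
      have := h ⟨p, I.mem_dom.2 hp⟩
      exact ⟨this.1.symm, this.2.symm⟩
    · rw [hta] at hp
      rw [val, h' p (mt I.mem_dom.1 hp), val]
  · rintro ⟨t, ht, hta, h⟩
    refine ⟨⟨t, ht, hta, fun p => ?_⟩, fun p hp => ?_⟩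
    · have := h p
      have hp : (letterInfo a).1 p = true := I.mem_dom.1 p.2
      rw [hta, if_pos hp] at this
      exact ⟨this.1.symm, this.2.symm⟩
    · have := h p
      rw [hta, if_neg (mt I.mem_dom.2 hp)] at this
      exact Fin.ext this

theorem exists_val {s : Fin 6 → ℕ} (h : ∀ p, s p < 14 + 3 * I.numColors) :
    ∃ s' : ∀ p, I.game.State p, val s' = s :=
  ⟨fun p => (⟨s p, h p⟩ : Fin (14 + 3 * I.numColors)), rfl⟩

theorem val_init : val I.game.init = ![0, 1, 1, 0, 1, 1] := rfl

theorem mem_final {s : ∀ p, I.game.State p} {p : Fin 6} :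
    s p ∈ I.game.final p ↔
      (if p = 0 ∨ p = 3 then val s p ∈ [6, 7, 8] else val s p ∈ [1, 3, 4, 5, 8]) ∨
        14 ≤ val s p := by
  have h : s p ∈ I.game.final p ↔ val s p ∈ I.finals p := Iff.rfl
  have hlt := val_lt s p
  rw [h, finals, List.mem_append, List.mem_map]
  refine or_congr (by split_ifs <;> rfl) ⟨?_, fun h => ⟨val s p - 14, ?_, by omega⟩⟩
  · rintro ⟨a, -, h⟩; omega
  · rw [List.mem_range]; omega

end ColoringInstance

namespace ColoringInstance

/-! ### Solutions as functions on the natural numbers -/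

/-- The function `g` is a solution on `[n] × [m]`. -/
structure Solves (I : ColoringInstance) (n m : ℕ) (g : ℕ → ℕ → ℕ) : Prop where
  n_pos : 0 < n
  m_pos : 0 < m
  lt : ∀ x < n, ∀ y < m, g x y < I.numColors
  initial : g 0 0 ∈ I.Ci
  final : g (n - 1) (m - 1) ∈ I.Cf
  square : ∀ x y, x + 1 < n → y + 1 < m → (g x y, g (x + 1) (y + 1)) ∉ I.S
  upper : ∀ x y, x + 1 < n → y < m → (g x y, g (x + 1) y) ∉ I.UT
  lower : ∀ x y, x < n → y + 1 < m → (g x y, g x (y + 1)) ∉ I.LT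

theorem hasSolution_iff (I : ColoringInstance) :
    I.HasSolution ↔ ∃ n m g, I.Solves n m g := by
  constructor
  · rintro ⟨F, h1, h2, h3, h4, h5⟩
    -- The coloring is extended by 0 outside the rectangle; no condition of `Solves` looks there.
    have hg : ∀ {x y} (hx : x < F.n) (hy : y < F.m),
        (if h : x < F.n ∧ y < F.m then (F.f (⟨x, h.1⟩, ⟨y, h.2⟩) : ℕ) else 0) =
          F.f (⟨x, hx⟩, ⟨y, hy⟩) := fun hx hy => dif_pos ⟨hx, hy⟩
    refine ⟨F.n, F.m, fun x y => if h : x < F.n ∧ y < F.m then F.f (⟨x, h.1⟩, ⟨y, h.2⟩) else 0,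
      F.n_pos, F.m_pos, ?_, ?_, ?_, ?_, ?_, ?_⟩
    · intro x hx y hy
      simp only [hg hx hy, Fin.is_lt]
    · simp only [hg F.n_pos F.m_pos]; exact h1
    · simp only [hg (Nat.sub_lt F.n_pos one_pos) (Nat.sub_lt F.m_pos one_pos)]; exact h2
    · intro x y hx hy
      simp only [hg hx hy, hg (x := x) (y := y) (by omega) (by omega)]
      exact Set.disjoint_left.1 h3 ⟨x, y, hx, hy, rfl⟩
    · intro x y hx hy
      simp only [hg hx hy, hg (x := x) (y := y) (by omega) (by omega)]
      exact Set.disjoint_left.1 h4 ⟨x, y, hx, hy, rfl⟩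
    · intro x y hx hy
      simp only [hg hx hy, hg (x := x) (y := y) (by omega) (by omega)]
      exact Set.disjoint_left.1 h5 ⟨x, y, hx, hy, rfl⟩
  · rintro ⟨n, m, g, h⟩
    refine ⟨⟨n, m, h.n_pos, h.m_pos, fun p => ⟨g p.1 p.2, h.lt _ p.1.2 _ p.2.2⟩⟩,
      h.initial, h.final, Set.disjoint_left.2 ?_, Set.disjoint_left.2 ?_,
      Set.disjoint_left.2 ?_⟩
    · rintro _ ⟨x, y, hx, hy, rfl⟩
      exact h.square x y hx hy
    · rintro _ ⟨x, y, hx, hy, rfl⟩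
      exact h.upper x y hx hy
    · rintro _ ⟨x, y, hx, hy, rfl⟩
      exact h.lower x y hx hy

/-! ### Memories of the processes

Every process counts the synchronizations of its pool in its view, and when it is checked it learns
the count of the other process. -/

/-- The update of the memories by the letter `j`. -/
def update (j : ℕ) (f : Fin 6 → ℕ × ℕ) (p : Fin 6) : ℕ × ℕ :=
  if 4 ≤ j ∧ j < 12 then
    (max (max (max (f 0).1 (f 1).1) (max (f 2).1 (f 3).1)) (max (f 4).1 (f 5).1) + 1, (f p).2)
  else if 16 ≤ j ∧ j < 19 then
    ((f p).1, (f 0).1 + (f 1).1 + (f 2).1 + (f 3).1 + (f 4).1 + (f 5).1 - (f p).1)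
  else f p

/-- The memories after the letter `j`. -/
def nextMem (j : ℕ) (f : Fin 6 → ℕ × ℕ) (p : Fin 6) : ℕ × ℕ :=
  if (letterInfo j).1 p = true then
    update j (fun q => if (letterInfo j).1 q = true then f q else (0, 0)) p
  else f p

/-- Processes outside the domain are read as (0, 0). Therefore the maximum in `update` is that of
the two synchronizing processes, and the sum minus the own count is the count of the checked
partner. -/
theorem memStep_eq {I : ColoringInstance} (a : I.code.Letter) (f : Fin 6 → ℕ × ℕ) :
    I.game.memStep (fun a => update a) (0, 0) a f = nextMem a f := by
  classical
  funext p
  simp only [AsyncAutomaton.memStep, nextMem, mem_dom]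

/-- The process `p` with memory `k` allows the letter `j`. -/
def Allows (n m : ℕ) (g : ℕ → ℕ → ℕ) (p : Fin 6) (k : ℕ × ℕ) (j : ℕ) : Prop :=
  (j = 8 → k.1 / 3 + 1 < n) ∧ (j = 9 → k.1 / 3 + 1 < m) ∧
  (j = 10 → k.1 / 3 + 1 = n) ∧ (j = 11 → k.1 / 3 + 1 = m) ∧
  (20 ≤ j → p < 3 → (j - 20) / 3 = g ((k.1 - 1) / 3) ((k.2 - 1) / 3))

/-! ### Invariants -/

/-- The states and the counts of the three processes of a pool. -/
structure PoolInv (n q₀ q₁ q₂ k₀ k₁ k₂ : ℕ) : Prop where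
  le₀ : k₀ ≤ 3 * n
  le₁ : k₁ ≤ 3 * n
  le₂ : k₂ ≤ 3 * n
  counts : (k₀ = 0 ∧ k₁ = 0 ∧ k₂ = 0) ∨ (k₀ % 3 = 1 ∧ k₁ = k₀ ∧ k₂ + 1 = k₀) ∨
    (k₀ % 3 = 1 ∧ k₁ = k₀ + 1 ∧ k₂ = k₀ + 1) ∨ (k₀ % 3 = 0 ∧ k₁ + 1 = k₀ ∧ k₂ = k₀)
  state₀ : q₀ ≤ 6 → (k₀ = 0 ∧ (q₀ = 0 ∨ q₀ = 1)) ∨ (k₀ = 1 ∧ q₀ = 2) ∨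
    (k₀ % 3 = 1 ∧ 1 < k₀ ∧ q₀ = 3) ∨ (k₀ % 3 = 0 ∧ 0 < k₀ ∧ k₀ < 3 * n ∧ q₀ = 5) ∨
    (k₀ = 3 * n ∧ q₀ = 6)
  state₁ : q₁ ≤ 6 → (k₁ = 0 ∧ q₁ = 1) ∨ (k₁ % 3 = 1 ∧ q₁ = 3) ∨ (k₁ % 3 = 2 ∧ q₁ = 4)
  state₂ : q₂ ≤ 6 → (k₂ = 0 ∧ q₂ = 1) ∨ (k₂ % 3 = 2 ∧ q₂ = 4) ∨
    (k₂ % 3 = 0 ∧ 0 < k₂ ∧ q₂ = 5)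

/-- The states, the counts and the answer of `T₀` and `B₀`. -/
inductive PairInv₀ (n m : ℕ) (g : ℕ → ℕ → ℕ) : ℕ → ℕ → ℕ → ℕ → ℕ → Prop
  | alive {q q' k k' o : ℕ} (hq : q ≤ 7) (hq' : q' ≤ 7) : PairInv₀ n m g q q' k k' o
  | initial {k k' : ℕ} (h : k = 1) (h' : k' = 1) : PairInv₀ n m g 10 13 k k' k'
  | mid {k k' : ℕ} (h : k % 3 = 1) (h' : k' % 3 = 1) : PairInv₀ n m g 11 13 k k' k'
  | last {k k' : ℕ} (h : k = 3 * n) (h' : k' = 3 * m) : PairInv₀ n m g 12 13 k k' k'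
  | answer {k k' : ℕ} (h : k % 3 = 1) (h' : k' % 3 = 1) :
      PairInv₀ n m g (14 + 3 * g ((k - 1) / 3) ((k' - 1) / 3)) 8 k k' k'
  | answer_last {k k' : ℕ} (h : k = 3 * n) (h' : k' = 3 * m) :
      PairInv₀ n m g (15 + 3 * g ((k - 1) / 3) ((k' - 1) / 3)) 8 k k' k'

/-- The states, the counts and the answer of `T₁` and `B₁`. -/
inductive PairInv₁ (g : ℕ → ℕ → ℕ) : ℕ → ℕ → ℕ → ℕ → ℕ → Prop
  | alive {q q' k k' o : ℕ} (hq : q ≤ 6) (hq' : q' ≤ 6) : PairInv₁ g q q' k k' o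
  | check {k k' : ℕ} (h : k % 3 = 2) (h' : k' % 3 = 2) : PairInv₁ g 10 13 k k' k'
  | answer {k k' : ℕ} (h : k % 3 = 2) (h' : k' % 3 = 2) :
      PairInv₁ g (14 + 3 * g ((k - 1) / 3) ((k' - 1) / 3)) 8 k k' k'

/-- The kinds of the checks of `T₂` and `B₂`. -/
def CheckKind (i k k' : ℕ) : Prop :=
  (i = 0 ∧ k % 3 = 0 ∧ 0 < k ∧ k' % 3 = 2) ∨ (i = 1 ∧ k % 3 = 2 ∧ k' % 3 = 0 ∧ 0 < k') ∨
    (i = 2 ∧ k % 3 = 0 ∧ 0 < k ∧ k' % 3 = 0 ∧ 0 < k')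

/-- The states, the counts and the answer of `T₂` and `B₂`. -/
inductive PairInv₂ (g : ℕ → ℕ → ℕ) : ℕ → ℕ → ℕ → ℕ → ℕ → Prop
  | alive {q q' k k' o : ℕ} (hq : q ≤ 6) (hq' : q' ≤ 6) : PairInv₂ g q q' k k' o
  | check {i k k' : ℕ} (h : CheckKind i k k') : PairInv₂ g (10 + i) 13 k k' k'
  | answer {i k k' : ℕ} (h : CheckKind i k k') :
      PairInv₂ g (14 + i + 3 * g ((k - 1) / 3) ((k' - 1) / 3)) 8 k k' k'

/-- The invariant of the plays that are consistent with the strategy given by a solution. -/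
structure Inv (n m : ℕ) (g : ℕ → ℕ → ℕ) (s : Fin 6 → ℕ) (f : Fin 6 → ℕ × ℕ) : Prop where
  top : PoolInv n (s 0) (s 1) (s 2) (f 0).1 (f 1).1 (f 2).1
  bot : PoolInv m (s 3) (s 4) (s 5) (f 3).1 (f 4).1 (f 5).1
  pair₀ : PairInv₀ n m g (s 0) (s 3) (f 0).1 (f 3).1 (f 0).2
  pair₁ : PairInv₁ g (s 1) (s 4) (f 1).1 (f 4).1 (f 1).2
  pair₂ : PairInv₂ g (s 2) (s 5) (f 2).1 (f 5).1 (f 2).2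

/-! ### Effect of single moves on the pool and pair invariants. -/

section Transitions

variable {n m q₀ q₁ q₂ k₀ k₁ k₂ : ℕ}

theorem PoolInv.join (h : PoolInv n 0 q₁ q₂ k₀ k₁ k₂) : PoolInv n 1 q₁ q₂ k₀ k₁ k₂ := by
  obtain ⟨h1, h2, h3, h4, h5, h6, h7⟩ := h
  constructor <;> omega

theorem PoolInv.dead₀ (h : PoolInv n q₀ q₁ q₂ k₀ k₁ k₂) {q : ℕ} (hq : 7 ≤ q) :
    PoolInv n q q₁ q₂ k₀ k₁ k₂ := by
  obtain ⟨h1, h2, h3, h4, h5, h6, h7⟩ := h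
  constructor <;> omega

theorem PoolInv.dead₁ (h : PoolInv n q₀ q₁ q₂ k₀ k₁ k₂) {q : ℕ} (hq : 7 ≤ q) :
    PoolInv n q₀ q q₂ k₀ k₁ k₂ := by
  obtain ⟨h1, h2, h3, h4, h5, h6, h7⟩ := h
  constructor <;> omega

theorem PoolInv.dead₂ (h : PoolInv n q₀ q₁ q₂ k₀ k₁ k₂) {q : ℕ} (hq : 7 ≤ q) :
    PoolInv n q₀ q₁ q k₀ k₁ k₂ := by
  obtain ⟨h1, h2, h3, h4, h5, h6, h7⟩ := h
  constructor <;> omega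

theorem PoolInv.first (h : PoolInv n 1 1 q₂ k₀ k₁ k₂) (hn : 0 < n) :
    PoolInv n 2 3 q₂ (max k₀ k₁ + 1) (max k₀ k₁ + 1) k₂ := by
  obtain ⟨h1, h2, h3, h4, h5, h6, h7⟩ := h
  -- The states of the two participants determine their counts modulo 3, which leaves one of the
  -- four shapes of `counts`. The other synchronizations are treated in the same way.
  have hk : k₀ = 0 ∧ k₁ = 0 ∧ k₂ = 0 := by
    replace h5 := h5 (by omega)
    replace h6 := h6 (by omega)
    clear h7
    omega
  clear h4 h5 h6
  constructor <;> omega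

theorem PoolInv.sync₀ (h : PoolInv n 5 4 q₂ k₀ k₁ k₂) :
    PoolInv n 3 3 q₂ (max k₀ k₁ + 1) (max k₀ k₁ + 1) k₂ := by
  obtain ⟨h1, h2, h3, h4, h5, h6, h7⟩ := h
  have hk : k₀ % 3 = 0 ∧ 0 < k₀ ∧ k₀ < 3 * n ∧ k₁ + 1 = k₀ ∧ k₂ = k₀ := by
    replace h5 := h5 (by omega)
    replace h6 := h6 (by omega)
    clear h7
    omega
  clear h4 h5 h6
  have : max k₀ k₁ = k₀ := by omega
  rw [this]
  constructor <;> omega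

theorem PoolInv.sync₁ (h : PoolInv n q₀ 3 q₂ k₀ k₁ k₂) (hq : q₂ ≤ 6) :
    PoolInv n q₀ 4 4 k₀ (max k₁ k₂ + 1) (max k₁ k₂ + 1) := by
  obtain ⟨h1, h2, h3, h4, h5, h6, h7⟩ := h
  have hk : k₁ % 3 = 1 ∧ k₀ = k₁ ∧ k₂ + 1 = k₁ := by
    clear h5
    replace h6 := h6 (by omega)
    replace h7 := h7 (by omega)
    omega
  clear h4 h6 h7
  have : max k₁ k₂ = k₁ := by omega
  rw [this]
  constructor <;> omega

/-- The bound on the round keeps the new count below 3n, which separates the state 5 from the state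
6 reached in `PoolInv.last`. -/
theorem PoolInv.sync₂ (h : PoolInv n q₀ q₁ 4 k₀ k₁ k₂) (hq : q₀ = 2 ∨ q₀ = 3)
    (hk : k₀ / 3 + 1 < n) : PoolInv n 5 q₁ 5 (max k₀ k₂ + 1) k₁ (max k₀ k₂ + 1) := by
  obtain ⟨h1, h2, h3, h4, h5, h6, h7⟩ := h
  have hk : k₀ % 3 = 1 ∧ k₁ = k₀ + 1 ∧ k₂ = k₁ := by
    replace h5 := h5 (by omega)
    clear h6
    replace h7 := h7 (by omega)
    omega
  clear h4 h5 h7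
  have : max k₀ k₂ = k₁ := by omega
  rw [this]
  constructor <;> omega

theorem PoolInv.last (h : PoolInv n q₀ q₁ 4 k₀ k₁ k₂) (hq : q₀ = 2 ∨ q₀ = 3)
    (hk : k₀ / 3 + 1 = n) : PoolInv n 6 q₁ 5 (max k₀ k₂ + 1) k₁ (max k₀ k₂ + 1) := by
  obtain ⟨h1, h2, h3, h4, h5, h6, h7⟩ := h
  have hk : k₀ % 3 = 1 ∧ k₁ = k₀ + 1 ∧ k₂ = k₁ := by
    replace h5 := h5 (by omega)
    clear h6
    replace h7 := h7 (by omega)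
    omega
  clear h4 h5 h7
  have : max k₀ k₂ = k₁ := by omega
  rw [this]
  constructor <;> omega

theorem PoolInv.first_iff (h : PoolInv n 2 q₁ q₂ k₀ k₁ k₂) : k₀ = 1 := by
  obtain ⟨h1, h2, h3, h4, h5, h6, h7⟩ := h
  omega

theorem PoolInv.window₀ (h : PoolInv n q₀ q₁ q₂ k₀ k₁ k₂) (hq : q₀ = 2 ∨ q₀ = 3) :
    k₀ % 3 = 1 := by
  obtain ⟨h1, h2, h3, h4, h5, h6, h7⟩ := h
  omega

theorem PoolInv.window_last (h : PoolInv n 6 q₁ q₂ k₀ k₁ k₂) : k₀ = 3 * n := by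
  obtain ⟨h1, h2, h3, h4, h5, h6, h7⟩ := h
  omega

theorem PoolInv.window₁ (h : PoolInv n q₀ 4 q₂ k₀ k₁ k₂) : k₁ % 3 = 2 := by
  obtain ⟨h1, h2, h3, h4, h5, h6, h7⟩ := h
  omega

theorem PoolInv.window₂ (h : PoolInv n q₀ q₁ 4 k₀ k₁ k₂) : k₂ % 3 = 2 := by
  obtain ⟨h1, h2, h3, h4, h5, h6, h7⟩ := h
  omega

theorem PoolInv.window₃ (h : PoolInv n q₀ q₁ 5 k₀ k₁ k₂) : k₂ % 3 = 0 ∧ 0 < k₂ := by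
  obtain ⟨h1, h2, h3, h4, h5, h6, h7⟩ := h
  omega

variable {g : ℕ → ℕ → ℕ} {q q' k k' o r j : ℕ}

/-- A pair with an unchecked member is `alive`, and this case puts no condition on counts; so moves
of one pool cannot damage it. -/
theorem PairInv₀.top (h : PairInv₀ n m g q q' k k' o) (hq : q ≤ 7) (hr : r ≤ 7) :
    PairInv₀ n m g r q' j k' o := by
  cases h with
  | alive _ h => exact .alive hr h
  | _ => omega

theorem PairInv₀.bot (h : PairInv₀ n m g q q' k k' o) (hq : q' ≤ 7) (hr : r ≤ 7) :
    PairInv₀ n m g q r k j o := by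
  cases h with
  | alive h _ => exact .alive h hr
  | _ => omega

theorem PairInv₁.top (h : PairInv₁ g q q' k k' o) (hq : q ≤ 6) (hr : r ≤ 6) :
    PairInv₁ g r q' j k' o := by
  cases h with
  | alive _ h => exact .alive hr h
  | _ => omega

theorem PairInv₁.bot (h : PairInv₁ g q q' k k' o) (hq : q' ≤ 7) (hr : r ≤ 6) :
    PairInv₁ g q r k j o := by
  cases h with
  | alive h _ => exact .alive h hr
  | _ => omega

theorem PairInv₂.top (h : PairInv₂ g q q' k k' o) (hq : q ≤ 6) (hr : r ≤ 6) :
    PairInv₂ g r q' j k' o := by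
  cases h with
  | alive _ h => exact .alive hr h
  | _ => omega

theorem PairInv₂.bot (h : PairInv₂ g q q' k k' o) (hq : q' ≤ 7) (hr : r ≤ 6) :
    PairInv₂ g q r k j o := by
  cases h with
  | alive h _ => exact .alive h hr
  | _ => omega

end Transitions

/-! ### A bound on the length of plays. -/

/-- The progress of a process in the state `q`. -/
def rank (q : ℕ) : ℕ := if q = 0 then 0 else if q ≤ 6 then 1 else if 10 ≤ q ∧ q ≤ 13 then 2 else 3

theorem rank_le (q : ℕ) : rank q ≤ 3 := by unfold rank; split_ifs <;> omega

/-- The progress of a play. -/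
def progress (s : Fin 6 → ℕ) (f : Fin 6 → ℕ × ℕ) : ℕ :=
  ((f 0).1 + rank (s 0)) + ((f 1).1 + rank (s 1)) + ((f 2).1 + rank (s 2)) +
    ((f 3).1 + rank (s 3)) + ((f 4).1 + rank (s 4)) + ((f 5).1 + rank (s 5))

/-- Six ranks of at most 3, three counts of at most 3n and three of at most 3m. -/
theorem Inv.progress_le {n m : ℕ} {g : ℕ → ℕ → ℕ} {s : Fin 6 → ℕ} {f : Fin 6 → ℕ × ℕ}
    (h : Inv n m g s f) : progress s f ≤ 18 + 9 * n + 9 * m := by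
  have h1 := h.top.le₀
  have h2 := h.top.le₁
  have h3 := h.top.le₂
  have h4 := h.bot.le₀
  have h5 := h.bot.le₁
  have h6 := h.bot.le₂
  have := rank_le (s 0)
  have := rank_le (s 1)
  have := rank_le (s 2)
  have := rank_le (s 3)
  have := rank_le (s 4)
  have := rank_le (s 5)
  unfold progress
  omega

theorem Inv.init (n m : ℕ) (g : ℕ → ℕ → ℕ) :
    Inv n m g ![0, 1, 1, 0, 1, 1] (fun _ => (0, 0)) := by
  refine ⟨?_, ?_, ?_, ?_, ?_⟩
  · constructor <;> simp
  · constructor <;> simp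
  all_goals exact .alive (by simp) (by simp)

section Step

variable {I : ColoringInstance} {n m : ℕ} {g : ℕ → ℕ → ℕ} {s s' : Fin 6 → ℕ} {f : Fin 6 → ℕ × ℕ}

-- Synchronizations act on one pool and on alive pairs only; a check turns an alive pair into a
-- checked one whose top process records the count of its partner. The permissions `ha` matter only
-- for `X₂X₀`, where they decide between another round and the end.
set_option maxHeartbeats 4000000 in
theorem Inv.step_fixed {t : Rule} (h : Inv n m g s f) (hn : 0 < n) (hm : 0 < m)
    (ht : t ∈ fixedRules) (hs : Fires t s s')
    (ha : ∀ p, (letterInfo t.1).1 p = true → Allows n m g p (f p) t.1) :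
    Inv n m g s' (nextMem t.1 f) ∧ progress s f < progress s' (nextMem t.1 f) := by
  obtain ⟨h1, h2, h3, h4, h5⟩ := h
  simp only [fixedRules, List.mem_cons, List.not_mem_nil, or_false] at ht
  casesm* _ ∨ _
  all_goals
    subst ht
    simp [Fires, Fin.forall_fin_succ, letterInfo, letterTable, letterIndex] at hs
    simp [Allows, Fin.forall_fin_succ, letterInfo, letterTable, letterIndex] at ha
    simp only [hs] at h1 h2 h3 h4 h5
    refine ⟨⟨?_, ?_, ?_, ?_, ?_⟩, ?_⟩ <;>
      simp [nextMem, update, letterInfo, letterTable, letterIndex, progress, hs]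
    · first
      | assumption
      | (refine h1.dead₀ ?_; omega)
      | (refine h1.dead₁ ?_; omega)
      | (refine h1.dead₂ ?_; omega)
      | exact h1.join
      | exact h1.first hn
      | exact h1.sync₀
      | (refine h1.sync₁ ?_; omega)
      | (refine h1.sync₂ ?_ ha.1; omega)
      | (refine h1.last ?_ ha.1; omega)
    · first
      | assumption
      | (refine h2.dead₀ ?_; omega)
      | (refine h2.dead₁ ?_; omega)
      | (refine h2.dead₂ ?_; omega)
      | exact h2.join
      | exact h2.first hm
      | exact h2.sync₀
      | (refine h2.sync₁ ?_; omega)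
      | (refine h2.sync₂ ?_ ha.1; omega)
      | (refine h2.last ?_ ha.1; omega)
    · first
      | assumption
      | (refine h3.top ?_ ?_ <;> omega)
      | (refine h3.bot ?_ ?_ <;> omega)
      | exact .initial h1.first_iff h2.first_iff
      | (refine .mid (h1.window₀ ?_) (h2.window₀ ?_) <;> omega)
      | exact .last h1.window_last h2.window_last
    · first
      | assumption
      | (refine h4.top ?_ ?_ <;> omega)
      | (refine h4.bot ?_ ?_ <;> omega)
      | exact .check h1.window₁ h2.window₁
    · first
      | assumption
      | (refine h5.top ?_ ?_ <;> omega)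
      | (refine h5.bot ?_ ?_ <;> omega)
      | exact .check (i := 0) (.inl ⟨rfl, h1.window₃.1, h1.window₃.2, h2.window₂⟩)
      | exact .check (i := 1) (.inr (.inl ⟨rfl, h1.window₂, h2.window₃⟩))
      | exact .check (i := 2) (.inr (.inr ⟨rfl, h1.window₃.1, h1.window₃.2, h2.window₃⟩))
    · clear h1 h2 h3 h4 h5 ha
      norm_num [rank]
      try omega

end Step

end ColoringInstance

namespace ColoringInstance

/-! ### Answers, and the rounds they refer to. -/

section Transitions

variable {n m : ℕ} {g : ℕ → ℕ → ℕ} {q k k' o c i r : ℕ}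

theorem PairInv₀.answer_check (h : PairInv₀ n m g q 13 k k' o)
    (hc : c = g ((k - 1) / 3) ((o - 1) / 3)) (hq : q = 10 ∨ q = 11) :
    PairInv₀ n m g (14 + 3 * c) 8 k k' o := by
  subst hc
  cases h with
  | alive => omega
  | initial h h' => exact .answer (by omega) (by omega)
  | mid h h' => exact .answer h h'
  | last => omega

theorem PairInv₀.answer_final (h : PairInv₀ n m g q 13 k k' o)
    (hc : c = g ((k - 1) / 3) ((o - 1) / 3)) (hq : q = 12) :
    PairInv₀ n m g (15 + 3 * c) 8 k k' o := by
  subst hc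
  cases h with
  | alive => omega
  | initial h h' => omega
  | mid h h' => omega
  | last h h' => exact .answer_last h h'

theorem PairInv₁.answer_check (h : PairInv₁ g q 13 k k' o)
    (hc : c = g ((k - 1) / 3) ((o - 1) / 3)) : PairInv₁ g (14 + 3 * c) 8 k k' o := by
  subst hc
  cases h with
  | alive => omega
  | check h h' => exact .answer h h'

theorem PairInv₂.answer_check (h : PairInv₂ g q 13 k k' o)
    (hc : c = g ((k - 1) / 3) ((o - 1) / 3)) (hr : r = q + 4 + 3 * c) :
    PairInv₂ g r 8 k k' o := by
  subst hc
  cases h with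
  | alive => omega
  | check h =>
    rename_i i
    rw [show r = 14 + i + 3 * g ((k - 1) / 3) ((k' - 1) / 3) by omega]
    exact .answer h

theorem PairInv₀.answer_eq (h : PairInv₀ n m g q 8 k k' o) (hq : q = 14 + 3 * c) :
    c = g ((k - 1) / 3) ((k' - 1) / 3) ∧ k % 3 = 1 ∧ k' % 3 = 1 := by
  cases h with
  | alive => omega
  | answer h h' => exact ⟨by omega, h, h'⟩
  | answer_last h h' => omega

theorem PairInv₀.answer_last_eq (h : PairInv₀ n m g q 8 k k' o) (hq : q = 15 + 3 * c) :
    c = g ((k - 1) / 3) ((k' - 1) / 3) := by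
  cases h with
  | alive => omega
  | answer h h' => omega
  | answer_last h h' => omega

theorem PairInv₁.answer_eq (h : PairInv₁ g q 8 k k' o) (hq : q = 14 + 3 * c) :
    c = g ((k - 1) / 3) ((k' - 1) / 3) ∧ k % 3 = 2 ∧ k' % 3 = 2 := by
  cases h with
  | alive => omega
  | answer h h' => exact ⟨by omega, h, h'⟩

theorem PairInv₂.answer_eq (h : PairInv₂ g q 8 k k' o) (hq : q = 14 + i + 3 * c) (hi : i < 3) :
    c = g ((k - 1) / 3) ((k' - 1) / 3) ∧ CheckKind i k k' := by
  cases h with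
  | alive => omega
  | answer h =>
    rename_i j
    have hj : j < 3 := by unfold CheckKind at h; omega
    obtain rfl : i = j := by omega
    exact ⟨by omega, h⟩

variable {q₀ q₁ q₂ k₀ k₁ k₂ : ℕ}

/-- The count k belongs to the round (k - 1) / 3, so the counts 3x+1, 3x+2, 3x+3 belong to the round
x. When `X₁` has a count of the form 3x+2, no process of the pool has entered the next round. -/
theorem PoolInv.round₀₁ (h : PoolInv n q₀ q₁ q₂ k₀ k₁ k₂) (hk : k₁ % 3 = 2) :
    (k₀ - 1) / 3 = (k₁ - 1) / 3 := by
  have := h.counts; omega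

theorem PoolInv.round₂₁ (h : PoolInv n q₀ q₁ q₂ k₀ k₁ k₂) (hk : k₁ % 3 = 2) :
    (k₂ - 1) / 3 = (k₁ - 1) / 3 := by
  have := h.counts; omega

/-- Here `X₂` stopped at the end of a round while `X₀` has already started the next one. -/
theorem PoolInv.round_succ (h : PoolInv n q₀ q₁ q₂ k₀ k₁ k₂) (hk : k₀ % 3 = 1)
    (hk' : k₂ % 3 = 0) (h0 : 0 < k₂) :
    (k₀ - 1) / 3 = (k₂ - 1) / 3 + 1 ∧ (k₂ - 1) / 3 + 1 < n := by
  have := h.counts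
  have := h.le₀
  omega

theorem PoolInv.round_same (h : PoolInv n q₀ q₁ q₂ k₀ k₁ k₂) (hk : k₀ % 3 = 1)
    (hk' : k₂ % 3 = 2) : (k₀ - 1) / 3 = (k₂ - 1) / 3 ∧ (k₂ - 1) / 3 < n := by
  have := h.counts
  have := h.le₀
  omega

end Transitions

section Step

variable {I : ColoringInstance} {n m : ℕ} {g : ℕ → ℕ → ℕ} {s s' : Fin 6 → ℕ} {f : Fin 6 → ℕ × ℕ}

theorem nextMem_eq {j : ℕ} (hj : 12 ≤ j ∧ j < 16 ∨ 19 ≤ j) (f : Fin 6 → ℕ × ℕ) :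
    nextMem j f = f := by
  have h1 : ¬ (4 ≤ j ∧ j < 12) := by omega
  have h2 : ¬ (16 ≤ j ∧ j < 19) := by omega
  funext p
  by_cases h : (letterInfo j).1 p = true
  · simp only [nextMem, update, if_pos h, if_neg h1, if_neg h2]
  · simp only [nextMem, if_neg h]

/-- An answer moves a pair from checked to answered with the value of g, because the recorded count
is that of the partner; the letters 12 and 14 only retire `T₀`. Each of these transitions raises a
rank to 3. -/
theorem Inv.step_color {t : Rule} {c : ℕ} (h : Inv n m g s f)
    (ht : t ∈ colorRules c ∨ t = initialRule c ∨ t = finalRule c) (hs : Fires t s s')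
    (ha : ∀ p, (letterInfo t.1).1 p = true → Allows n m g p (f p) t.1) :
    Inv n m g s' (nextMem t.1 f) ∧ progress s f < progress s' (nextMem t.1 f) := by
  obtain ⟨h1, h2, h3, h4, h5⟩ := h
  have e0 := letterInfo_answer₀ c
  have e1 := letterInfo_answer₁ c
  have e2 := letterInfo_answer₂ c
  have d1 : (21 + 3 * c - 20) / 3 = c := by omega
  have d2 : (22 + 3 * c - 20) / 3 = c := by omega
  have r0 : rank (14 + 3 * c) = 3 := by
    unfold rank; rw [if_neg, if_neg, if_neg] <;> omega
  have r1 : rank (15 + 3 * c) = 3 := by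
    unfold rank; rw [if_neg, if_neg, if_neg] <;> omega
  have r2 : rank (16 + 3 * c) = 3 := by
    unfold rank; rw [if_neg, if_neg, if_neg] <;> omega
  simp only [colorRules, initialRule, finalRule, List.mem_cons, List.not_mem_nil, or_false,
    or_assoc] at ht
  casesm* _ ∨ _
  all_goals
    subst ht
    first
    | simp only [e0, e1, e2] at hs ha
      simp [Fires, Fin.forall_fin_succ, e0, e1, e2] at hs
      simp [Allows, Fin.forall_fin_succ, d1, d2] at ha
      first
      | replace ha := ha.1.2.2.2.2 (by omega)
      | replace ha := ha.1.2.2.2.2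
      rw [nextMem_eq (.inr (by simp only; omega))]
    | simp [Fires, Fin.forall_fin_succ, letterInfo, letterTable, letterIndex] at hs
      rw [nextMem_eq (.inl (by simp))]
    simp only [hs] at h1 h2 h3 h4 h5
    refine ⟨⟨?_, ?_, ?_, ?_, ?_⟩, ?_⟩ <;> simp only [hs, progress]
    · first
      | assumption
      | (refine h1.dead₀ ?_; omega)
      | (refine h1.dead₁ ?_; omega)
      | (refine h1.dead₂ ?_; omega)
    · first
      | assumption
      | (refine h2.dead₀ ?_; omega)
      | (refine h2.dead₁ ?_; omega)
      | (refine h2.dead₂ ?_; omega)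
    · first
      | assumption
      | (refine h3.top ?_ ?_ <;> omega)
      | exact h3.answer_final ha rfl
      | exact h3.answer_check ha (by simp)
    · first
      | assumption
      | exact h4.answer_check ha
    · first
      | assumption
      | (refine h5.answer_check ha ?_; omega)
    · clear h1 h2 h3 h4 h5 ha
      try simp only [r0, r1, r2]
      norm_num [rank]
      try omega

/-- Each of these states contains an answer of the pair 1, so its counts are 2 modulo 3 and the
other answering pair is in the same two rounds. Both colors are then values of g at one position. -/
theorem Inv.eq_of_equalRules {t : Rule} {c d : ℕ} (h : Inv n m g s f) (ht : t ∈ equalRules c d)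
    (hs : Fires t s s') : c = d := by
  simp only [equalRules, List.mem_cons, List.not_mem_nil, or_false] at ht
  casesm* _ ∨ _
  all_goals
    subst ht
    simp [Fires, loseRule, Fin.forall_fin_succ, letterInfo, letterTable, letterIndex] at hs
    obtain ⟨h1, h2, h3, h4, h5⟩ := h
    simp only [hs] at h3 h4 h5
    obtain ⟨hd, hk, hk'⟩ := h4.answer_eq rfl
  · rw [(h3.answer_eq rfl).1, hd, h1.round₀₁ hk, h2.round₀₁ hk']
  · rw [h3.answer_last_eq rfl, hd, h1.round₀₁ hk, h2.round₀₁ hk']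
  · rw [(h5.answer_eq (i := 0) rfl (by omega)).1, hd, h1.round₂₁ hk, h2.round₂₁ hk']
  · rw [(h5.answer_eq (i := 0) rfl (by omega)).1, hd, h1.round₂₁ hk, h2.round₂₁ hk']
  · rw [(h5.answer_eq (i := 1) rfl (by omega)).1, hd, h1.round₂₁ hk, h2.round₂₁ hk']
  · rw [(h5.answer_eq (i := 1) rfl (by omega)).1, hd, h1.round₂₁ hk, h2.round₂₁ hk']
  · rw [(h5.answer_eq (i := 2) rfl (by omega)).1, hd, h1.round₂₁ hk, h2.round₂₁ hk']

/-- The kind 0 and the answer of the pair 0 fix the counts modulo 3: `T₀` is one round ahead of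
`T₂`, while `B₀` and `B₂` are in the same round. The two colors are the values of g at horizontal
neighbours, which a solution does not allow. -/
theorem Inv.not_fires_upper (h : Inv n m g s f) (hg : I.Solves n m g) {c : ℕ × ℕ}
    (hc : c ∈ I.UT) : ¬ Fires (upperRule c) s s' := by
  intro hs
  simp [Fires, upperRule, loseRule, Fin.forall_fin_succ, letterInfo, letterTable,
    letterIndex] at hs
  obtain ⟨h1, h2, h3, h4, h5⟩ := h
  simp only [hs] at h3 h5
  obtain ⟨e, hk, hk'⟩ := h3.answer_eq rfl
  obtain ⟨e', h6⟩ := h5.answer_eq (i := 0) rfl (by omega)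
  obtain ⟨-, h6, h7, h8⟩ | h6 | h6 := h6
  · obtain ⟨h9, h10⟩ := h1.round_succ hk h6 h7
    obtain ⟨h11, h12⟩ := h2.round_same hk' h8
    refine hg.upper _ _ h10 h12 ?_
    rw [← h9, ← e', ← h11, ← e]
    exact hc
  · omega
  · omega

theorem Inv.not_fires_lower (h : Inv n m g s f) (hg : I.Solves n m g) {c : ℕ × ℕ}
    (hc : c ∈ I.LT) : ¬ Fires (lowerRule c) s s' := by
  intro hs
  simp [Fires, lowerRule, loseRule, Fin.forall_fin_succ, letterInfo, letterTable,
    letterIndex] at hs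
  obtain ⟨h1, h2, h3, h4, h5⟩ := h
  simp only [hs] at h3 h5
  obtain ⟨e, hk, hk'⟩ := h3.answer_eq rfl
  obtain ⟨e', h6⟩ := h5.answer_eq (i := 1) rfl (by omega)
  obtain h6 | ⟨-, h6, h7, h8⟩ | h6 := h6
  · omega
  · obtain ⟨h9, h10⟩ := h2.round_succ hk' h7 h8
    obtain ⟨h11, h12⟩ := h1.round_same hk h6
    refine hg.lower _ _ h12 h10 ?_
    rw [← h9, ← e', ← h11, ← e]
    exact hc
  · omega

theorem Inv.not_fires_square (h : Inv n m g s f) (hg : I.Solves n m g) {c : ℕ × ℕ}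
    (hc : c ∈ I.S) : ¬ Fires (squareRule c) s s' := by
  intro hs
  simp [Fires, squareRule, loseRule, Fin.forall_fin_succ, letterInfo, letterTable,
    letterIndex] at hs
  obtain ⟨h1, h2, h3, h4, h5⟩ := h
  simp only [hs] at h3 h5
  obtain ⟨e, hk, hk'⟩ := h3.answer_eq rfl
  obtain ⟨e', h6⟩ := h5.answer_eq (i := 2) rfl (by omega)
  obtain h6 | h6 | ⟨-, h6, h7, h8, h9⟩ := h6
  · omega
  · omega
  · obtain ⟨h10, h11⟩ := h1.round_succ hk h6 h7
    obtain ⟨h12, h13⟩ := h2.round_succ hk' h8 h9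
    refine hg.square _ _ h11 h13 ?_
    rw [← h10, ← e', ← h12, ← e]
    exact hc

/-- The invariant is preserved by the transitions that the strategy allows, and these transitions
make progress. -/
theorem Inv.step {t : Rule} (h : Inv n m g s f) (hg : I.Solves n m g) (ht : t ∈ I.rules)
    (hs : Fires t s s')
    (ha : ∀ p, (letterInfo t.1).1 p = true → Allows n m g p (f p) t.1) :
    Inv n m g s' (nextMem t.1 f) ∧ progress s f < progress s' (nextMem t.1 f) := by
  rcases mem_rules.1 ht with h' | ⟨c, -, h'⟩ | ⟨c, -, rfl⟩ | ⟨c, -, rfl⟩ | ⟨d, -, c, hcd, h'⟩ |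
    ⟨c, hc, rfl⟩ | ⟨c, hc, rfl⟩ | ⟨c, hc, rfl⟩
  · exact h.step_fixed hg.n_pos hg.m_pos h' hs ha
  · exact h.step_color (.inl h') hs ha
  · exact h.step_color (.inr (.inl rfl)) hs ha
  · exact h.step_color (.inr (.inr rfl)) hs ha
  · rcases h' with h' | h'
    · exact absurd (h.eq_of_equalRules h' hs) (by omega)
    · exact absurd (h.eq_of_equalRules h' hs) (by omega)
  · exact absurd hs (h.not_fires_upper hg hc)
  · exact absurd hs (h.not_fires_lower hg hc)
  · exact absurd hs (h.not_fires_square hg hc)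

end Step

end ColoringInstance

namespace ColoringInstance

/-! ### Progress of the strategy given by a solution -/

section Progress

variable {I : ColoringInstance} {n m : ℕ} {g : ℕ → ℕ → ℕ} {s : Fin 6 → ℕ} {f : Fin 6 → ℕ × ℕ}

/-- The transition `t` can be taken in the state `s` and is allowed with the memories `f`. -/
def Enabled (I : ColoringInstance) (n m : ℕ) (g : ℕ → ℕ → ℕ) (s : Fin 6 → ℕ) (f : Fin 6 → ℕ × ℕ)
    (t : Rule) : Prop :=
  t.1 < 20 + 3 * I.numColors ∧ ∀ p, (letterInfo t.1).1 p = true →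
    s p = t.2.1 p ∧ t.2.2 p < 14 + 3 * I.numColors ∧ Allows n m g p (f p) t.1

/-- Absence of deadlock: when `X₀` waits, either the next synchronization of the pool is ready, or
the partner `X₀` needs has been taken away by a check. The hypotheses `h₁` and `h₂` say at which
counts this can happen. -/
theorem PoolInv.next {n q₀ q₁ q₂ k₀ k₁ k₂ : ℕ} (h : PoolInv n q₀ q₁ q₂ k₀ k₁ k₂)
    (hq : q₀ = 1 ∨ q₀ = 2 ∨ q₀ = 3 ∨ q₀ = 5) (h₁ : 7 ≤ q₁ → k₁ % 3 = 2)
    (h₂ : 7 ≤ q₂ → 0 < k₂ ∧ k₂ % 3 ≠ 1) :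
    (q₀ = 1 ∧ q₁ = 1) ∨ (q₀ = 5 ∧ q₁ = 4) ∨ (q₀ = 5 ∧ 7 ≤ q₁) ∨
      ((q₀ = 2 ∨ q₀ = 3) ∧ (7 ≤ q₂ ∨ (q₁ = 3 ∧ (q₂ = 1 ∨ q₂ = 5)) ∨
        (q₂ = 4 ∧ (k₀ / 3 + 1 < n ∧ k₂ / 3 + 1 < n ∨ k₀ / 3 + 1 = n ∧ k₂ / 3 + 1 = n)))) := by
  obtain ⟨h1, h2, h3, h4, h5, h6, h7⟩ := h
  replace h5 := h5 (by omega)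
  by_cases h0 : q₀ = 1
  · have hk : k₀ = 0 ∧ k₁ = 0 := by clear h6 h7 h₁ h₂; omega
    exact .inl ⟨h0, by clear h2 h3 h4 h5 h7 h₂; omega⟩
  by_cases h0' : q₀ = 5
  · have hk : k₁ % 3 = 2 := by clear h6 h7 h₁ h₂; omega
    refine .inr ?_
    by_cases d₁ : 7 ≤ q₁
    · exact .inr (.inl ⟨h0', d₁⟩)
    · exact .inl ⟨h0', by clear h2 h3 h4 h5 h7 h₂; omega⟩
  refine .inr (.inr (.inr ⟨by omega, ?_⟩))
  have hk : k₀ % 3 = 1 ∧ k₀ < 3 * n := by clear h4 h6 h7 h₁ h₂; omega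
  clear h5 hq
  by_cases d₂ : 7 ≤ q₂
  · exact .inl d₂
  refine .inr ?_
  replace h7 := h7 (by omega)
  clear h₂
  -- Either `X₁X₂` is still to be played in this round, and then `X₁` cannot have been checked as
  -- its count is 1 modulo 3, or it has been played and `X₂` waits for `X₀`.
  have hk' : (k₁ = k₀ ∧ k₂ + 1 = k₀) ∨ (k₁ = k₀ + 1 ∧ k₂ = k₀ + 1) := by omega
  obtain hk' | hk' := hk'
  · refine .inl ⟨?_, by omega⟩
    have : ¬ 7 ≤ q₁ := fun d => by have := h₁ d; omega
    have := h6 (by omega)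
    omega
  · refine .inr ⟨by omega, by omega⟩

theorem PairInv₁.cases {q q' k k' o : ℕ} (h : PairInv₁ g q q' k k' o) :
    (q ≤ 6 ∧ q' ≤ 6) ∨ (7 ≤ q ∧ 7 ≤ q' ∧ k % 3 = 2 ∧ k' % 3 = 2 ∧
      (q' = 13 ∨ (q' = 8 ∧ ∃ c, c = g ((k - 1) / 3) ((k' - 1) / 3) ∧ q = 14 + 3 * c))) := by
  cases h with
  | alive h h' => exact .inl ⟨h, h'⟩
  | check h h' => exact .inr ⟨by omega, by omega, h, h', .inl rfl⟩
  | answer h h' => exact .inr ⟨by omega, by omega, h, h', .inr ⟨rfl, _, rfl, rfl⟩⟩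

theorem PairInv₂.cases {q q' k k' o : ℕ} (h : PairInv₂ g q q' k k' o) :
    (q ≤ 6 ∧ q' ≤ 6) ∨ (7 ≤ q ∧ 7 ≤ q' ∧ (0 < k ∧ k % 3 ≠ 1) ∧ (0 < k' ∧ k' % 3 ≠ 1) ∧
      (q' = 13 ∨ (q' = 8 ∧ ∃ c, c = g ((k - 1) / 3) ((k' - 1) / 3) ∧
        (q = 14 + 3 * c ∨ q = 15 + 3 * c ∨ q = 16 + 3 * c)))) := by
  cases h with
  | alive h h' => exact .inl ⟨h, h'⟩
  | check h =>
    refine .inr ⟨by omega, by omega, ?_, ?_, .inl rfl⟩ <;> unfold CheckKind at h <;> omega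
  | answer h =>
    refine .inr ⟨by omega, by omega, ?_, ?_, .inr ⟨rfl, _, rfl, ?_⟩⟩ <;>
      unfold CheckKind at h <;> omega

theorem Inv.color_lt (h : Inv n m g s f) (hg : I.Solves n m g) (p p' : Fin 6) (hp : p < 3)
    (hp' : 3 ≤ p') : g (((f p).1 - 1) / 3) (((f p').1 - 1) / 3) < I.numColors := by
  have := hg.n_pos
  have := hg.m_pos
  obtain ⟨⟨h1, h2, h3, -, -, -, -⟩, ⟨h4, h5, h6, -, -, -, -⟩, -, -, -⟩ := h
  have e1 : (f p).1 ≤ 3 * n := by fin_cases p <;> first | assumption | simp at hp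
  have e2 : (f p').1 ≤ 3 * m := by fin_cases p' <;> first | assumption | simp at hp'
  exact hg.lt _ (by omega) _ (by omega)

theorem Inv.enabled_answer₀ (h : Inv n m g s f) (hg : I.Solves n m g) (hs : s 3 = 13) :
    ∃ t ∈ I.rules, Enabled I n m g s f t := by
  have hlt := h.color_lt hg 0 3 (by decide) (by decide)
  have h3 := h.pair₀
  have := hg.n_pos
  have := hg.m_pos
  rw [hs] at h3
  generalize hs0 : s 0 = q at h3
  generalize ho : (f 0).2 = o at h3
  generalize hk : (f 0).1 = k at h3 hlt
  generalize hk' : (f 3).1 = k' at h3 hlt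
  cases h3 with
  | alive => omega
  | initial h h' =>
    subst h h'
    refine ⟨initialRule (g 0 0), mem_rules.2 (.inr (.inr (.inl ⟨_, hg.initial, rfl⟩))), ?_⟩
    simp at hlt
    simp [Enabled, initialRule, Fin.forall_fin_succ, letterInfo_answer₀, Allows, hs, hs0, ho, hk]
    omega
  | mid h h' =>
    generalize hc : g ((k - 1) / 3) ((o - 1) / 3) = c at *
    refine ⟨(20 + 3 * c, ![11, 0, 0, 13, 0, 0], ![14 + 3 * c, 0, 0, 8, 0, 0]),
      mem_rules.2 (.inr (.inl ⟨_, hlt, by simp [colorRules]⟩)), ?_⟩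
    simp [Enabled, Fin.forall_fin_succ, letterInfo_answer₀, Allows, hs, hs0, ho, hk, hc]
    omega
  | last h h' =>
    -- The counts are 3n and 3m, so the answer is the final color, which is the only one for which a
    -- transition of kind 12 needs to be provided.
    have e : (k - 1) / 3 = n - 1 := by omega
    have e' : (o - 1) / 3 = m - 1 := by omega
    rw [e, e'] at hlt
    refine ⟨finalRule (g (n - 1) (m - 1)),
      mem_rules.2 (.inr (.inr (.inr (.inl ⟨_, hg.final, rfl⟩)))), ?_⟩
    simp [Enabled, finalRule, Fin.forall_fin_succ, letterInfo_answer₀, Allows, hs, hs0, ho, hk,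
      e, e']
    omega

theorem Inv.enabled_answer₁ (h : Inv n m g s f) (hg : I.Solves n m g) (hs : s 4 = 13) :
    ∃ t ∈ I.rules, Enabled I n m g s f t := by
  have hlt := h.color_lt hg 1 4 (by decide) (by decide)
  have h3 := h.pair₁
  rw [hs] at h3
  generalize hs0 : s 1 = q at h3
  generalize ho : (f 1).2 = o at h3
  generalize hk : (f 1).1 = k at h3 hlt
  generalize hk' : (f 4).1 = k' at h3 hlt
  cases h3 with
  | alive => omega
  | check h h' =>
    generalize hc : g ((k - 1) / 3) ((o - 1) / 3) = c at *
    have e : (21 + 3 * c - 20) / 3 = c := by omega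
    refine ⟨(21 + 3 * c, ![0, 10, 0, 0, 13, 0], ![0, 14 + 3 * c, 0, 0, 8, 0]),
      mem_rules.2 (.inr (.inl ⟨_, hlt, by simp [colorRules]⟩)), ?_⟩
    simp [Enabled, Fin.forall_fin_succ, letterInfo_answer₁, Allows, hs, hs0, ho, hk, hc, e]
    omega

theorem Inv.enabled_answer₂ (h : Inv n m g s f) (hg : I.Solves n m g) (hs : s 5 = 13) :
    ∃ t ∈ I.rules, Enabled I n m g s f t := by
  have hlt := h.color_lt hg 2 5 (by decide) (by decide)
  have h3 := h.pair₂
  rw [hs] at h3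
  generalize hs0 : s 2 = q at h3
  generalize ho : (f 2).2 = o at h3
  generalize hk : (f 2).1 = k at h3 hlt
  generalize hk' : (f 5).1 = k' at h3 hlt
  cases h3 with
  | alive => omega
  | check h =>
    rename_i i
    have hi : i = 0 ∨ i = 1 ∨ i = 2 := by unfold CheckKind at h; omega
    generalize hc : g ((k - 1) / 3) ((o - 1) / 3) = c at *
    have e : (22 + 3 * c - 20) / 3 = c := by omega
    have : (22 + 3 * c, ![0, 0, 10 + i, 0, 0, 13], ![0, 0, 14 + i + 3 * c, 0, 0, 8]) ∈
        colorRules c := by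
      rcases hi with rfl | rfl | rfl <;> simp [colorRules]
    refine ⟨_, mem_rules.2 (.inr (.inl ⟨_, hlt, this⟩)), ?_⟩
    simp [Enabled, Fin.forall_fin_succ, letterInfo_answer₂, Allows, hs, hs0, ho, hk, hc, e]
    omega

theorem mem_rules_fixed {t : Rule} (h : t ∈ fixedRules) : t ∈ I.rules := mem_rules.2 (.inl h)

/-- Besides synchronizations there are two ways on: if the missing partner is still being checked,
its answer is enabled; if it has answered, `T₀` leaves the game by the letter 12 or 14. -/
theorem Inv.enabled_top (h : Inv n m g s f) (hg : I.Solves n m g)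
    (hs : s 0 = 0 ∨ s 0 = 1 ∨ s 0 = 2 ∨ s 0 = 3 ∨ s 0 = 5) :
    ∃ t ∈ I.rules, Enabled I n m g s f t := by
  rcases hs with hs | hs
  · refine ⟨(0, ![0, 0, 0, 0, 0, 0], ![1, 0, 0, 0, 0, 0]), mem_rules_fixed (by decide), ?_⟩
    simp [Enabled, Fin.forall_fin_succ, Allows, letterInfo, letterTable, letterIndex, hs]
    omega
  have hlt₁ := h.color_lt hg 1 4 (by decide) (by decide)
  have hlt₂ := h.color_lt hg 2 5 (by decide) (by decide)
  have h4 := h.pair₁.cases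
  have h5 := h.pair₂.cases
  rcases h.top.next hs (fun hq => by omega) (fun hq => by omega) with
    ⟨h0, h1⟩ | ⟨h0, h1⟩ | ⟨h0, h1⟩ | ⟨h0, h1 | ⟨h1, h2⟩ | ⟨h1, h2⟩⟩
  · refine ⟨(4, ![1, 1, 0, 0, 0, 0], ![2, 3, 0, 0, 0, 0]), mem_rules_fixed (by decide), ?_⟩
    simp [Enabled, Fin.forall_fin_succ, Allows, letterInfo, letterTable, letterIndex, h0, h1]
    omega
  · refine ⟨(4, ![5, 4, 0, 0, 0, 0], ![3, 3, 0, 0, 0, 0]), mem_rules_fixed (by decide), ?_⟩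
    simp [Enabled, Fin.forall_fin_succ, Allows, letterInfo, letterTable, letterIndex, h0, h1]
    omega
  · obtain h4 | ⟨-, -, -, -, h4 | ⟨-, c, hc, h4⟩⟩ := h4
    · omega
    · exact h.enabled_answer₁ hg h4
    · rw [← hc] at hlt₁
      refine ⟨(12, ![5, 14 + 3 * c, 0, 0, 0, 0], ![7, 14 + 3 * c, 0, 0, 0, 0]),
        mem_rules.2 (.inr (.inl ⟨c, hlt₁, by simp [colorRules]⟩)), ?_⟩
      simp [Enabled, Fin.forall_fin_succ, Allows, letterInfo, letterTable, letterIndex, h0, h4]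
      omega
  · obtain h5 | ⟨-, -, -, -, h5 | ⟨-, c, hc, h5⟩⟩ := h5
    · omega
    · exact h.enabled_answer₂ hg h5
    · rw [← hc] at hlt₂
      refine ⟨(14, ![s 0, 0, s 2, 0, 0, 0], ![7, 0, s 2, 0, 0, 0]),
        mem_rules.2 (.inr (.inl ⟨c, hlt₂, ?_⟩)), ?_⟩
      · rcases h0 with h0 | h0 <;> rcases h5 with h5 | h5 | h5 <;> simp [colorRules, h0, h5]
      · simp [Enabled, Fin.forall_fin_succ, Allows, letterInfo, letterTable, letterIndex]
        omega
  · refine ⟨(6, ![0, 3, s 2, 0, 0, 0], ![0, 4, 4, 0, 0, 0]), mem_rules_fixed ?_, ?_⟩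
    · rcases h2 with h2 | h2 <;> rw [h2] <;> decide
    · simp [Enabled, Fin.forall_fin_succ, Allows, letterInfo, letterTable, letterIndex, h1]
      omega
  · rcases h2 with ⟨h2, h3⟩ | ⟨h2, h3⟩
    · refine ⟨(8, ![s 0, 0, 4, 0, 0, 0], ![5, 0, 5, 0, 0, 0]), mem_rules_fixed ?_, ?_⟩
      · rcases h0 with h0 | h0 <;> rw [h0] <;> decide
      · simp [Enabled, Fin.forall_fin_succ, Allows, letterInfo, letterTable, letterIndex, h1]
        omega
    · refine ⟨(10, ![s 0, 0, 4, 0, 0, 0], ![6, 0, 5, 0, 0, 0]), mem_rules_fixed ?_, ?_⟩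
      · rcases h0 with h0 | h0 <;> rw [h0] <;> decide
      · simp [Enabled, Fin.forall_fin_succ, Allows, letterInfo, letterTable, letterIndex, h1]
        omega

theorem Inv.enabled_bot (h : Inv n m g s f) (hg : I.Solves n m g)
    (hs : s 3 = 0 ∨ s 3 = 1 ∨ s 3 = 2 ∨ s 3 = 3 ∨ s 3 = 5) :
    ∃ t ∈ I.rules, Enabled I n m g s f t := by
  rcases hs with hs | hs
  · refine ⟨(1, ![0, 0, 0, 0, 0, 0], ![0, 0, 0, 1, 0, 0]), mem_rules_fixed (by decide), ?_⟩
    simp [Enabled, Fin.forall_fin_succ, Allows, letterInfo, letterTable, letterIndex, hs]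
    omega
  have h4 := h.pair₁.cases
  have h5 := h.pair₂.cases
  rcases h.bot.next hs (fun hq => by omega) (fun hq => by omega) with
    ⟨h0, h1⟩ | ⟨h0, h1⟩ | ⟨h0, h1⟩ | ⟨h0, h1 | ⟨h1, h2⟩ | ⟨h1, h2⟩⟩
  · refine ⟨(5, ![0, 0, 0, 1, 1, 0], ![0, 0, 0, 2, 3, 0]), mem_rules_fixed (by decide), ?_⟩
    simp [Enabled, Fin.forall_fin_succ, Allows, letterInfo, letterTable, letterIndex, h0, h1]
    omega
  · refine ⟨(5, ![0, 0, 0, 5, 4, 0], ![0, 0, 0, 3, 3, 0]), mem_rules_fixed (by decide), ?_⟩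
    simp [Enabled, Fin.forall_fin_succ, Allows, letterInfo, letterTable, letterIndex, h0, h1]
    omega
  · obtain h4 | ⟨-, -, -, -, h4 | ⟨h4, -⟩⟩ := h4
    · omega
    · exact h.enabled_answer₁ hg h4
    · refine ⟨(13, ![0, 0, 0, 5, 8, 0], ![0, 0, 0, 7, 8, 0]), mem_rules_fixed (by decide), ?_⟩
      simp [Enabled, Fin.forall_fin_succ, Allows, letterInfo, letterTable, letterIndex, h0, h4]
      omega
  · obtain h5 | ⟨-, -, -, -, h5 | ⟨h5, -⟩⟩ := h5
    · omega
    · exact h.enabled_answer₂ hg h5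
    · refine ⟨(15, ![0, 0, 0, s 3, 0, 8], ![0, 0, 0, 7, 0, 8]), mem_rules_fixed ?_, ?_⟩
      · rcases h0 with h0 | h0 <;> rw [h0] <;> decide
      · simp [Enabled, Fin.forall_fin_succ, Allows, letterInfo, letterTable, letterIndex, h5]
        omega
  · refine ⟨(7, ![0, 0, 0, 0, 3, s 5], ![0, 0, 0, 0, 4, 4]), mem_rules_fixed ?_, ?_⟩
    · rcases h2 with h2 | h2 <;> rw [h2] <;> decide
    · simp [Enabled, Fin.forall_fin_succ, Allows, letterInfo, letterTable, letterIndex, h1]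
      omega
  · rcases h2 with ⟨h2, h3⟩ | ⟨h2, h3⟩
    · refine ⟨(9, ![0, 0, 0, s 3, 0, 4], ![0, 0, 0, 5, 0, 5]), mem_rules_fixed ?_, ?_⟩
      · rcases h0 with h0 | h0 <;> rw [h0] <;> decide
      · simp [Enabled, Fin.forall_fin_succ, Allows, letterInfo, letterTable, letterIndex, h1]
        omega
    · refine ⟨(11, ![0, 0, 0, s 3, 0, 4], ![0, 0, 0, 6, 0, 5]), mem_rules_fixed ?_, ?_⟩
      · rcases h0 with h0 | h0 <;> rw [h0] <;> decide
      · simp [Enabled, Fin.forall_fin_succ, Allows, letterInfo, letterTable, letterIndex, h1]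
        omega

end Progress

end ColoringInstance

namespace ColoringInstance

/-! ### The strategy given by a solution -/

section Strategy

variable {I : ColoringInstance} {n m : ℕ} {g : ℕ → ℕ → ℕ}

theorem Allows.of_env {p : Fin 6} {k : ℕ × ℕ} {j : ℕ} (h : (letterInfo j).2 = false) :
    Allows n m g p k j := by
  rcases letter_cases j with hj | ⟨c, rfl⟩ | ⟨c, rfl⟩ | ⟨c, rfl⟩
  · have : ∀ j < 20, (letterInfo j).2 = false → j ≠ 8 ∧ j ≠ 9 ∧ j ≠ 10 ∧ j ≠ 11 := by decide
    obtain ⟨h1, h2, h3, h4⟩ := this j hj h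
    exact ⟨fun e => absurd e h1, fun e => absurd e h2, fun e => absurd e h3,
      fun e => absurd e h4, fun e => by omega⟩
  · rw [letterInfo_answer₀] at h; cases h
  · rw [letterInfo_answer₁] at h; cases h
  · rw [letterInfo_answer₂] at h; cases h

/-- The memories of the processes after a play. -/
noncomputable def memory (u : I.game.Trace) : Fin 6 → ℕ × ℕ :=
  I.game.mem (fun a => update a) (0, 0) u

/-- The strategy given by a solution. -/
noncomputable def strategy (I : ColoringInstance) (n m : ℕ) (g : ℕ → ℕ → ℕ) : I.game.Strategy where
  allow p u := {a | Allows n m g p (memory u p) a}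
  env p u _ a ha := by
    refine Allows.of_env ?_
    rw [mem_ctrl] at ha
    exact Bool.eq_false_iff.2 ha
  view p u w _ h := by
    obtain ⟨v, rfl, hv, -⟩ := h
    rw [memory, AsyncAutomaton.mem_mul _ _ _ hv]
    rfl

/-- The length bound is carried along because every letter increases the progress; it gives the
finiteness of the set of consistent plays. -/
theorem strategy_inv (hg : I.Solves n m g) {u : I.game.Trace}
    (hu : (strategy I n m g).Consistent u) :
    ∃ s, I.game.PlayState u s ∧ Inv n m g (val s) (memory u) ∧
      I.game.length u ≤ progress (val s) (memory u) := by
  induction u using I.game.trace_induction with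
  | one =>
    refine ⟨_, .nil, ?_, by simp [I.game.length_one]⟩
    rw [val_init, memory, AsyncAutomaton.mem_one]
    exact Inv.init n m g
  | snoc u a ih =>
    obtain ⟨h1, h2⟩ := hu.of_snoc
    obtain ⟨s, hs, hi, hl⟩ := ih h1
    obtain ⟨s', hs'⟩ := hu.1
    obtain ⟨t, ht, hst⟩ := hs'.exists_step
    obtain rfl := hs.unique ht
    obtain ⟨t, ht, hta, hf⟩ := step_iff.1 hst
    have := hi.step hg ht hf fun p hp => by
      rw [hta] at hp ⊢
      exact h2 p (I.mem_dom.2 hp)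
    have hm : memory (u * I.game.letter a) = nextMem t.1 (memory u) := by
      rw [memory, AsyncAutomaton.mem_snoc, memStep_eq, hta]; rfl
    rw [← hm] at this
    refine ⟨s', hs', this.1, ?_⟩
    rw [I.game.length_mul, I.game.length_letter]
    have := this.2
    omega

theorem PairInv₀.cases {q q' k k' o : ℕ} (h : PairInv₀ n m g q q' k k' o) :
    (q ≤ 7 ∧ q' ≤ 7) ∨ q' = 13 ∨ (q' = 8 ∧ 14 ≤ q) := by
  cases h <;> omega

/-- If no process is being checked and neither `T₀` nor `B₀` is waiting, then all processes are in
final states. -/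
theorem Inv.final {s : Fin 6 → ℕ} {f : Fin 6 → ℕ × ℕ} (h : Inv n m g s f) (h3 : s 3 ≠ 13)
    (h4 : s 4 ≠ 13) (h5 : s 5 ≠ 13)
    (ht : ¬ (s 0 = 0 ∨ s 0 = 1 ∨ s 0 = 2 ∨ s 0 = 3 ∨ s 0 = 5))
    (hb : ¬ (s 3 = 0 ∨ s 3 = 1 ∨ s 3 = 2 ∨ s 3 = 3 ∨ s 3 = 5)) (p : Fin 6) :
    (if p = 0 ∨ p = 3 then s p ∈ [6, 7, 8] else s p ∈ [1, 3, 4, 5, 8]) ∨ 14 ≤ s p := by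
  obtain ⟨⟨-, -, -, -, t0, t1, t2⟩, ⟨-, -, -, -, b0, b1, b2⟩, c0, c1, c2⟩ := h
  replace c0 := c0.cases
  replace c1 := c1.cases
  replace c2 := c2.cases
  fin_cases p <;> simp
  · clear t1 t2 b0 b1 b2 c1 c2 hb; omega
  · clear t0 t2 b0 b1 b2 c0 c2 ht hb
    rcases c1 with h | ⟨h1, h2, -, -, h3 | ⟨h3, c, -, h6⟩⟩ <;> omega
  · clear t0 t1 b0 b1 b2 c0 c1 ht hb
    rcases c2 with h | ⟨h1, h2, -, -, h3 | ⟨h3, c, -, h6⟩⟩ <;> omega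
  · clear t0 t1 t2 b1 b2 c1 c2 ht; omega
  · clear t0 t1 t2 b0 b2 c0 c2 ht hb; omega
  · clear t0 t1 t2 b0 b1 c0 c1 ht hb; omega

theorem strategy_final (hg : I.Solves n m g) {u : I.game.Trace}
    (hu : (strategy I n m g).Maximal u) {s : ∀ p, I.game.State p} (hs : I.game.PlayState u s)
    (p : Fin 6) : s p ∈ I.game.final p := by
  obtain ⟨s', hs', hi, -⟩ := strategy_inv hg hu.1
  obtain rfl := hs.unique hs'
  -- An enabled transition would extend the maximal play by one letter.
  have key : ¬ ∃ t ∈ I.rules, Enabled I n m g (val s) (memory u) t := by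
    rintro ⟨t, ht, hlt, h⟩
    let a : I.code.Letter := ⟨t.1, by rw [length_letters]; exact hlt⟩
    obtain ⟨s', hs'⟩ := exists_val (I := I)
      (s := fun p => if (letterInfo t.1).1 p = true then t.2.2 p else val s p) fun p => by
        split_ifs with hp
        · exact (h p hp).2.1
        · exact val_lt s p
    have hst : I.game.Step a s s' := step_iff.2 ⟨t, ht, rfl, fun p => by
      rw [hs']
      split_ifs with hp
      · exact ⟨(h p hp).1, if_pos hp⟩
      · exact if_neg hp⟩
    have hc : (strategy I n m g).Consistent (u * I.game.letter a) :=
      hu.1.snoc ⟨s', hs.step hst⟩ fun p hp => (h p (I.mem_dom.1 hp)).2.2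
    have := congrArg I.game.length (hu.2 _ hc ⟨_, rfl⟩)
    rw [I.game.length_mul, I.game.length_letter] at this
    omega
  exact mem_final.2 (hi.final (fun h => key (hi.enabled_answer₀ hg h))
    (fun h => key (hi.enabled_answer₁ hg h)) (fun h => key (hi.enabled_answer₂ hg h))
    (fun h => key (hi.enabled_top hg h)) (fun h => key (hi.enabled_bot hg h)) p)

theorem hasWinningStrategy_of_hasSolution (h : I.HasSolution) : I.game.HasWinningStrategy := by
  obtain ⟨n, m, g, hg⟩ := (hasSolution_iff I).1 h
  refine ⟨strategy I n m g, ?_, fun u hu s hs p => strategy_final hg hu hs p⟩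
  refine ((List.finite_length_le I.code.Letter (18 + 9 * n + 9 * m)).image I.game.ofWord).subset ?_
  intro u hu
  obtain ⟨s, -, hi, hl⟩ := strategy_inv hg hu
  obtain ⟨w, rfl⟩ := I.game.exists_ofWord u
  refine ⟨w, ?_, rfl⟩
  have hw : I.game.length (I.game.ofWord w) = w.length := by
    clear hu hi hl
    induction w using List.reverseRecOn with
    | nil => exact I.game.length_one
    | append_singleton w a ih =>
      rw [I.game.ofWord_snoc, I.game.length_mul, ih, I.game.length_letter]; simp
  have := hi.progress_le
  change w.length ≤ _
  omega

end Strategy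

end ColoringInstance

namespace ColoringInstance

variable {I : ColoringInstance} {σ : I.game.Strategy}

/-! ### Plays that are consistent with a strategy -/

/-- The trace of the letter `j`. -/
def tr (I : ColoringInstance) (j : ℕ) : I.game.Trace :=
  if h : j < I.code.letters.length then I.game.letter ⟨j, h⟩ else 1

theorem letterInfo_of_mem_traceDom_tr {j : ℕ} {p : Fin 6} (h : p ∈ I.game.traceDom (I.tr j)) :
    (letterInfo j).1 p = true := by
  unfold tr at h
  split_ifs at h with hj
  · rw [I.game.traceDom_letter] at h; exact I.mem_dom.1 h
  · rw [I.game.traceDom_one] at h; exact h.elim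

theorem notMem_traceDom_tr {j : ℕ} {p : Fin 6} (h : (letterInfo j).1 p = false) :
    p ∉ I.game.traceDom (I.tr j) := fun hp => by
  rw [letterInfo_of_mem_traceDom_tr hp] at h; cases h

theorem notMem_traceDom_mul {u v : I.game.Trace} {p : Fin 6} (hu : p ∉ I.game.traceDom u)
    (hv : p ∉ I.game.traceDom v) : p ∉ I.game.traceDom (u * v) := by
  rw [I.game.traceDom_mul]; exact fun h => h.elim hu hv

/-- The process `p` allows the letter `j` after `u`. -/
def Allowed (σ : I.game.Strategy) (p : Fin 6) (u : I.game.Trace) (j : ℕ) : Prop :=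
  ∀ h : j < I.code.letters.length, (⟨j, h⟩ : I.code.Letter) ∈ σ.allow p u

theorem allowed_of_environment {u : I.game.Trace} (hu : I.game.IsPlay u) {j : ℕ}
    (hj : (letterInfo j).2 = false) (p : Fin 6) : Allowed σ p u j := fun h =>
  σ.env p u hu _ fun hc => by rw [I.mem_ctrl.1 hc] at hj; cases hj

theorem Allowed.mul {u v : I.game.Trace} {p : Fin 6} {j : ℕ} (h : Allowed σ p u j)
    (hp : I.game.IsPlay (u * v)) (hv : p ∉ I.game.traceDom v) : Allowed σ p (u * v) j := by
  intro hj
  rw [σ.allow_mul hp hv]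
  exact h hj

/-- The play `u` is consistent with the strategy and leads to the global state `s`. -/
def Reach (σ : I.game.Strategy) (u : I.game.Trace) (s : Fin 6 → ℕ) : Prop :=
  σ.Consistent u ∧ ∃ s', I.game.PlayState u s' ∧ val s' = s

theorem Reach.isPlay {u : I.game.Trace} {s : Fin 6 → ℕ} (h : Reach σ u s) : I.game.IsPlay u := h.1.1

theorem reach_one : Reach σ 1 ![0, 1, 1, 0, 1, 1] :=
  ⟨DistributedGame.Strategy.consistent_one, _, .nil, val_init⟩

theorem Reach.step {u : I.game.Trace} {s s' : Fin 6 → ℕ} (h : Reach σ u s) {t : Rule}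
    (ht : t ∈ I.rules) (hlt : t.1 < 20 + 3 * I.numColors) (hf : Fires t s s')
    (hs' : ∀ p, s' p < 14 + 3 * I.numColors)
    (ha : ∀ p, (letterInfo t.1).1 p = true → Allowed σ p u t.1) :
    Reach σ (u * I.tr t.1) s' := by
  obtain ⟨h1, r, hr, rfl⟩ := h
  obtain ⟨r', rfl⟩ := exists_val hs'
  have hl : t.1 < I.code.letters.length := by rw [length_letters]; exact hlt
  have hp := hr.step (a := (⟨t.1, hl⟩ : I.code.Letter)) (step_iff.2 ⟨t, ht, rfl, hf⟩)
  rw [tr, dif_pos hl]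
  exact ⟨h1.snoc ⟨_, hp⟩ fun p hp => ha p (I.mem_dom.1 hp) hl, _, hp, rfl⟩

/-- The step of a transition that does not involve colors. -/
theorem Reach.step_fixed {u : I.game.Trace} {s s' : Fin 6 → ℕ} (h : Reach σ u s) {t : Rule}
    (ht : t ∈ fixedRules) (hf : Fires t s s') (hs' : ∀ p, s' p < 14)
    (ha : ∀ p, (letterInfo t.1).1 p = true → Allowed σ p u t.1) :
    Reach σ (u * I.tr t.1) s' := by
  have : ∀ t ∈ fixedRules, t.1 < 20 := by decide
  exact h.step (mem_rules_fixed ht) (by have := this t ht; omega) hf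
    (fun p => by have := hs' p; omega) ha

/-- The transitions that are possible after the play `u`. -/
theorem Reach.of_stuck (hσ : σ.Winning) {u : I.game.Trace} {s : Fin 6 → ℕ} (h : Reach σ u s)
    (D : Set (Fin 6))
    (hD : ∀ t ∈ I.rules, t.1 < 20 + 3 * I.numColors → ∀ r : Fin 6 → ℕ, (∀ p ∈ D, r p = s p) →
      (∀ p, (letterInfo t.1).1 p = true → r p = t.2.1 p) →
      (∃ p ∈ D, (letterInfo t.1).1 p = true) →
      (∀ p, (letterInfo t.1).1 p = true → p ∈ D) ∧
        ∃ p, (letterInfo t.1).1 p = true ∧ ¬ Allowed σ p u t.1) (p : Fin 6) (hp : p ∈ D) :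
    (if p = 0 ∨ p = 3 then s p ∈ [6, 7, 8] else s p ∈ [1, 3, 4, 5, 8]) ∨ 14 ≤ s p := by
  obtain ⟨h1, s', hs', rfl⟩ := h
  refine mem_final.1 (hσ.final_of_stuck h1 hs' D (fun r r' a hr hstep hex => ?_) p hp)
  obtain ⟨t, ht, hta, hf⟩ := step_iff.1 hstep
  obtain ⟨q, hq, hqa⟩ := hex
  have hlt : t.1 < 20 + 3 * I.numColors := by rw [← length_letters, hta]; exact a.2
  obtain ⟨h2, q', h3, h4⟩ := hD t ht hlt (val r) (fun p hp => congrArg (Fin.val (n := 14 + 3 * I.numColors)) (hr p hp))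
    (fun p hp => by have := hf p; rw [if_pos hp] at this; exact this.1)
    ⟨q, hq, by rw [hta]; exact I.mem_dom.1 hqa⟩
  refine ⟨fun p hp => h2 p (by rw [hta]; exact I.mem_dom.1 hp), q', I.mem_dom.2 (hta ▸ h3),
    fun hal => h4 fun hl => ?_⟩
  have : (⟨t.1, hl⟩ : I.code.Letter) = a := Fin.ext hta
  rwa [this]

/-! ### The environment wins -/

/-- The transitions that involve colors are only possible after a check. -/
theorem mem_fixedRules_or {t : Rule} (ht : t ∈ I.rules) :
    t ∈ fixedRules ∨ ∃ p, (letterInfo t.1).1 p = true ∧ (t.2.1 p = 8 ∨ 10 ≤ t.2.1 p) := by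
  have lose : ∀ q : Fin 6 → ℕ, (∃ p, q p = 8) →
      ∃ p, (letterInfo (loseRule q).1).1 p = true ∧
        ((loseRule q).2.1 p = 8 ∨ 10 ≤ (loseRule q).2.1 p) := fun q ⟨p, hp⟩ =>
    ⟨p, (by decide : ∀ p : Fin 6, (letterInfo 19).1 p = true) p, .inl hp⟩
  rcases mem_rules.1 ht with h | ⟨c, -, h⟩ | ⟨c, -, rfl⟩ | ⟨c, -, rfl⟩ | ⟨d, -, c, -, h⟩ |
    ⟨c, -, rfl⟩ | ⟨c, -, rfl⟩ | ⟨c, -, rfl⟩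
  · exact .inl h
  · right
    simp only [colorRules, List.mem_cons, List.not_mem_nil, or_false] at h
    rcases h with rfl | rfl | rfl | rfl | rfl | rfl | rfl | rfl | rfl | rfl | rfl | rfl
    · exact ⟨1, rfl, .inr (by simp; omega)⟩
    iterate 6 exact ⟨2, rfl, .inr (by simp; omega)⟩
    · exact ⟨3, by rw [letterInfo_answer₀]; rfl, .inr (by simp)⟩
    · exact ⟨4, by rw [letterInfo_answer₁]; rfl, .inr (by simp)⟩
    iterate 3 exact ⟨5, by rw [letterInfo_answer₂]; rfl, .inr (by simp)⟩
  · exact .inr ⟨3, by rw [initialRule, letterInfo_answer₀]; rfl, .inr (by simp [initialRule])⟩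
  · exact .inr ⟨3, by rw [finalRule, letterInfo_answer₀]; rfl, .inr (by simp [finalRule])⟩
  · right
    simp only [equalRules, List.mem_cons, List.not_mem_nil, or_false] at h
    rcases h with h | h <;> rcases h with rfl | rfl | rfl | rfl | rfl | rfl | rfl
    all_goals first | exact lose _ ⟨3, rfl⟩ | exact lose _ ⟨4, rfl⟩
  all_goals exact .inr (lose _ ⟨3, rfl⟩)

/-- The letter 19 belongs to the environment and leads to the state 9 everywhere, which is not final
and from which no transition starts. -/
theorem Reach.not_lose (hσ : σ.Winning) {u : I.game.Trace} {s : Fin 6 → ℕ} (h : Reach σ u s) :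
    loseRule s ∉ I.rules := by
  intro hl
  have h' : Reach σ (u * I.tr 19) ![9, 9, 9, 9, 9, 9] :=
    h.step hl (by change 19 < _; omega)
      (by simp [Fires, Fin.forall_fin_succ, loseRule, letterInfo, letterTable, letterIndex])
      (by simp [Fin.forall_fin_succ]; omega) fun p _ => allowed_of_environment h.isPlay rfl p
  have := h'.of_stuck hσ Set.univ (fun t ht _ r hr hs _ => ?_) 0 trivial
  · simp at this
  · exfalso
    have h9 : ∀ p : Fin 6, (![9, 9, 9, 9, 9, 9] : Fin 6 → ℕ) p = 9 := by decide
    replace hs : ∀ p, (letterInfo t.1).1 p = true → 9 = t.2.1 p := fun p hp => by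
      rw [← hs p hp, hr p trivial, h9]
    rcases mem_fixedRules_or ht with h | ⟨p, hp, h⟩
    · have : ∀ t ∈ fixedRules, ∃ p, (letterInfo t.1).1 p = true ∧ 9 ≠ t.2.1 p := by decide
      obtain ⟨p, h1, h2⟩ := this t h
      exact h2 (hs p h1)
    · have := hs p hp
      omega

end ColoringInstance

namespace ColoringInstance

variable {I : ColoringInstance} {σ : I.game.Strategy}

/-! ### Plays without checks -/

/-- The synchronization of the pool `X` after `k` synchronizations, when it plays `n` rounds
(`n = 0` means that there is no last round). -/
def syncLetter (X n k : ℕ) : ℕ := if k + 1 = 3 * n then 10 + X else 4 + X + 2 * (k % 3)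

/-- The trace of the first `k` synchronizations of the pool `X`. -/
def run (I : ColoringInstance) (X n : ℕ) : ℕ → I.game.Trace
  | 0 => I.tr X
  | k + 1 => run I X n k * I.tr (syncLetter X n k)

/-- The state of `X₀` after `k` synchronizations. -/
def st₀ (n k : ℕ) : ℕ :=
  if k = 0 then 1 else if k = 3 * n then 6 else if k % 3 = 0 then 5 else if k < 3 then 2 else 3

/-- The state of `X₁` after `k` synchronizations. -/
def st₁ (k : ℕ) : ℕ := if k = 0 then 1 else if k % 3 = 1 then 3 else 4

/-- The state of `X₂` after `k` synchronizations. -/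
def st₂ (k : ℕ) : ℕ := if k ≤ 1 then 1 else if k % 3 = 2 then 4 else 5

theorem syncLetter_cases (X n k : ℕ) : syncLetter X n k = 4 + X ∨ syncLetter X n k = 6 + X ∨
    syncLetter X n k = 8 + X ∨ syncLetter X n k = 10 + X := by
  unfold syncLetter; split_ifs <;> omega

theorem notMem_traceDom_run_one {n k : ℕ} {p : Fin 6} (hp : p < 3) :
    p ∉ I.game.traceDom (I.run 1 n k) := by
  induction k with
  | zero => exact notMem_traceDom_tr (by revert p; decide)
  | succ k ih =>
    refine notMem_traceDom_mul ih (notMem_traceDom_tr ?_)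
    clear ih
    rcases syncLetter_cases 1 n k with h | h | h | h <;> rw [h] <;> revert p <;> decide

/-- The synchronizations of a pool: the letter, and the states of the pool before and after it. -/
inductive SyncStep (X : ℕ) : ℕ → ℕ → ℕ → ℕ → ℕ → ℕ → ℕ → Prop
  | first₀ : SyncStep X (4 + X) 1 1 1 2 3 1
  | first₁ : SyncStep X (6 + X) 2 3 1 2 4 4
  | first₂ : SyncStep X (8 + X) 2 4 4 5 4 5
  | firstLast : SyncStep X (10 + X) 2 4 4 6 4 5
  | next₀ : SyncStep X (4 + X) 5 4 5 3 3 5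
  | next₁ : SyncStep X (6 + X) 3 3 5 3 4 4
  | next₂ : SyncStep X (8 + X) 3 4 4 5 4 5
  | last : SyncStep X (10 + X) 3 4 4 6 4 5

theorem syncStep (X : ℕ) {n k : ℕ} (hk : k < 3 * n ∨ n = 0) :
    SyncStep X (syncLetter X n k) (st₀ n k) (st₁ k) (st₂ k) (st₀ n (k + 1)) (st₁ (k + 1))
      (st₂ (k + 1)) := by
  have h : k = 0 ∨
      k = 1 ∨
      (k = 2 ∧ n ≠ 1) ∨
      (k = 2 ∧ n = 1) ∨
      (k % 3 = 0 ∧ 3 ≤ k) ∨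
      (k % 3 = 1 ∧ 3 ≤ k) ∨
      (k % 3 = 2 ∧ 3 ≤ k ∧ k + 1 ≠ 3 * n) ∨
      (k % 3 = 2 ∧ 3 ≤ k ∧ k + 1 = 3 * n) := by omega
  have key : ∀ {j a b c a' b' c'}, SyncStep X j a b c a' b' c' → syncLetter X n k = j →
      st₀ n k = a → st₁ k = b → st₂ k = c → st₀ n (k + 1) = a' → st₁ (k + 1) = b' →
      st₂ (k + 1) = c' → SyncStep X (syncLetter X n k) (st₀ n k) (st₁ k) (st₂ k) (st₀ n (k + 1))
        (st₁ (k + 1)) (st₂ (k + 1)) := by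
    rintro _ _ _ _ _ _ _ h rfl rfl rfl rfl rfl rfl rfl
    exact h
  rcases h with h | h | h | h | h | h | h | h
  · refine key .first₀ ?_ ?_ ?_ ?_ ?_ ?_ ?_ <;> simp only [syncLetter, st₀, st₁, st₂] <;>
      split_ifs <;> first | omega | contradiction
  · refine key .first₁ ?_ ?_ ?_ ?_ ?_ ?_ ?_ <;> simp only [syncLetter, st₀, st₁, st₂] <;>
      split_ifs <;> first | omega | contradiction
  · refine key .first₂ ?_ ?_ ?_ ?_ ?_ ?_ ?_ <;> simp only [syncLetter, st₀, st₁, st₂] <;>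
      split_ifs <;> first | omega | contradiction
  · refine key .firstLast ?_ ?_ ?_ ?_ ?_ ?_ ?_ <;> simp only [syncLetter, st₀, st₁, st₂] <;>
      split_ifs <;> first | omega | contradiction
  · refine key .next₀ ?_ ?_ ?_ ?_ ?_ ?_ ?_ <;> simp only [syncLetter, st₀, st₁, st₂] <;>
      split_ifs <;> first | omega | contradiction
  · refine key .next₁ ?_ ?_ ?_ ?_ ?_ ?_ ?_ <;> simp only [syncLetter, st₀, st₁, st₂] <;>
      split_ifs <;> first | omega | contradiction
  · refine key .next₂ ?_ ?_ ?_ ?_ ?_ ?_ ?_ <;> simp only [syncLetter, st₀, st₁, st₂] <;>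
      split_ifs <;> first | omega | contradiction
  · refine key .last ?_ ?_ ?_ ?_ ?_ ?_ ?_ <;> simp only [syncLetter, st₀, st₁, st₂] <;>
      split_ifs <;> first | omega | contradiction

theorem top_rule {n k : ℕ} (hk : k < 3 * n ∨ n = 0) (d e f : ℕ) : ∃ t ∈ fixedRules,
    t.1 = syncLetter 0 n k ∧ Fires t ![st₀ n k, st₁ k, st₂ k, d, e, f]
      ![st₀ n (k + 1), st₁ (k + 1), st₂ (k + 1), d, e, f] := by
  have h := syncStep 0 hk
  generalize syncLetter 0 n k = j, st₀ n k = a, st₁ k = b, st₂ k = c, st₀ n (k + 1) = a',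
    st₁ (k + 1) = b', st₂ (k + 1) = c' at h
  cases h
  · exact ⟨fixedRules[4], List.getElem_mem _, rfl, by
      simp [fixedRules, Fires, Fin.forall_fin_succ, letterInfo, letterTable, letterIndex]⟩
  · exact ⟨fixedRules[8], List.getElem_mem _, rfl, by
      simp [fixedRules, Fires, Fin.forall_fin_succ, letterInfo, letterTable, letterIndex]⟩
  · exact ⟨fixedRules[12], List.getElem_mem _, rfl, by
      simp [fixedRules, Fires, Fin.forall_fin_succ, letterInfo, letterTable, letterIndex]⟩
  · exact ⟨fixedRules[16], List.getElem_mem _, rfl, by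
      simp [fixedRules, Fires, Fin.forall_fin_succ, letterInfo, letterTable, letterIndex]⟩
  · exact ⟨fixedRules[6], List.getElem_mem _, rfl, by
      simp [fixedRules, Fires, Fin.forall_fin_succ, letterInfo, letterTable, letterIndex]⟩
  · exact ⟨fixedRules[10], List.getElem_mem _, rfl, by
      simp [fixedRules, Fires, Fin.forall_fin_succ, letterInfo, letterTable, letterIndex]⟩
  · exact ⟨fixedRules[14], List.getElem_mem _, rfl, by
      simp [fixedRules, Fires, Fin.forall_fin_succ, letterInfo, letterTable, letterIndex]⟩
  · exact ⟨fixedRules[18], List.getElem_mem _, rfl, by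
      simp [fixedRules, Fires, Fin.forall_fin_succ, letterInfo, letterTable, letterIndex]⟩

theorem bot_rule {n k : ℕ} (hk : k < 3 * n ∨ n = 0) (d e f : ℕ) : ∃ t ∈ fixedRules,
    t.1 = syncLetter 1 n k ∧ Fires t ![d, e, f, st₀ n k, st₁ k, st₂ k]
      ![d, e, f, st₀ n (k + 1), st₁ (k + 1), st₂ (k + 1)] := by
  have h := syncStep 1 hk
  generalize syncLetter 1 n k = j, st₀ n k = a, st₁ k = b, st₂ k = c, st₀ n (k + 1) = a',
    st₁ (k + 1) = b', st₂ (k + 1) = c' at h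
  cases h
  · exact ⟨fixedRules[5], List.getElem_mem _, rfl, by
      simp [fixedRules, Fires, Fin.forall_fin_succ, letterInfo, letterTable, letterIndex]⟩
  · exact ⟨fixedRules[9], List.getElem_mem _, rfl, by
      simp [fixedRules, Fires, Fin.forall_fin_succ, letterInfo, letterTable, letterIndex]⟩
  · exact ⟨fixedRules[13], List.getElem_mem _, rfl, by
      simp [fixedRules, Fires, Fin.forall_fin_succ, letterInfo, letterTable, letterIndex]⟩
  · exact ⟨fixedRules[17], List.getElem_mem _, rfl, by
      simp [fixedRules, Fires, Fin.forall_fin_succ, letterInfo, letterTable, letterIndex]⟩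
  · exact ⟨fixedRules[7], List.getElem_mem _, rfl, by
      simp [fixedRules, Fires, Fin.forall_fin_succ, letterInfo, letterTable, letterIndex]⟩
  · exact ⟨fixedRules[11], List.getElem_mem _, rfl, by
      simp [fixedRules, Fires, Fin.forall_fin_succ, letterInfo, letterTable, letterIndex]⟩
  · exact ⟨fixedRules[15], List.getElem_mem _, rfl, by
      simp [fixedRules, Fires, Fin.forall_fin_succ, letterInfo, letterTable, letterIndex]⟩
  · exact ⟨fixedRules[19], List.getElem_mem _, rfl, by
      simp [fixedRules, Fires, Fin.forall_fin_succ, letterInfo, letterTable, letterIndex]⟩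

/-- The process `p` allows the first `k` synchronizations of its pool `X`. -/
def AllowsRun (σ : I.game.Strategy) (X n k : ℕ) : Prop :=
  ∀ i < k, ∀ p, (letterInfo (syncLetter X n i)).1 p = true →
    Allowed σ p (I.run X n i) (syncLetter X n i)

theorem st_lt {n k : ℕ} : st₀ n k < 14 ∧ st₁ k < 14 ∧ st₂ k < 14 := by
  refine ⟨?_, ?_, ?_⟩ <;> simp only [st₀, st₁, st₂] <;> split_ifs <;> omega

/-- The trace v is invisible to the top pool: its letters commute with v, and what the pool allows
after its own run it also allows when v has been played. This is the independence of the two clocks.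
-/
theorem Reach.top_run {n k d e f : ℕ} {v : I.game.Trace} (h : Reach σ v ![0, 1, 1, d, e, f])
    (hd : d < 14) (he : e < 14) (hf : f < 14) (hv : ∀ p : Fin 6, p < 3 → p ∉ I.game.traceDom v)
    (hk : k ≤ 3 * n ∨ n = 0) (ha : AllowsRun σ 0 n k) :
    Reach σ (I.run 0 n k * v) ![st₀ n k, st₁ k, st₂ k, d, e, f] := by
  have comm : ∀ {j}, (∀ p : Fin 6, (letterInfo j).1 p = true → p < 3) →
      I.tr j * v = v * I.tr j := fun {j} hj =>
    I.game.mul_comm_of_disjoint (Set.disjoint_left.2 fun p h1 =>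
      hv p (hj p (letterInfo_of_mem_traceDom_tr h1)))
  induction k with
  | zero =>
    rw [run, comm (by decide)]
    refine h.step_fixed (t := fixedRules[0]) (List.getElem_mem _) ?_ ?_ ?_
    · simp [fixedRules, Fires, Fin.forall_fin_succ, letterInfo, letterTable, letterIndex, st₀, st₁,
        st₂]
    · simp [Fin.forall_fin_succ, st₀, st₁, st₂, hd, he, hf]
    · exact fun p _ => allowed_of_environment h.isPlay rfl p
  | succ k ih =>
    have ih := ih (by omega) fun i hi => ha i (by omega)
    obtain ⟨t, ht, htj, hfires⟩ := top_rule (n := n) (k := k) (by omega) d e f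
    have hdom : ∀ p, (letterInfo t.1).1 p = true → p < 3 := by
      rcases syncLetter_cases 0 n k with h | h | h | h <;> rw [htj, h] <;> decide
    have hst := st_lt (n := n) (k := k + 1)
    rw [run, ← htj, mul_assoc, comm hdom, ← mul_assoc]
    refine ih.step_fixed ht hfires ?_ fun p hp => ?_
    · simp [Fin.forall_fin_succ, hd, he, hf, hst]
    · exact (htj ▸ ha k (by omega) p (htj ▸ hp)).mul ih.isPlay (hv p (hdom p hp))

theorem Reach.bot_run {n k d e f : ℕ} {v : I.game.Trace} (h : Reach σ v ![d, e, f, 0, 1, 1])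
    (hd : d < 14) (he : e < 14) (hf : f < 14) (hv : ∀ p : Fin 6, 3 ≤ p → p ∉ I.game.traceDom v)
    (hk : k ≤ 3 * n ∨ n = 0) (ha : AllowsRun σ 1 n k) :
    Reach σ (I.run 1 n k * v) ![d, e, f, st₀ n k, st₁ k, st₂ k] := by
  have comm : ∀ {j}, (∀ p : Fin 6, (letterInfo j).1 p = true → 3 ≤ p) →
      I.tr j * v = v * I.tr j := fun {j} hj =>
    I.game.mul_comm_of_disjoint (Set.disjoint_left.2 fun p h1 =>
      hv p (hj p (letterInfo_of_mem_traceDom_tr h1)))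
  induction k with
  | zero =>
    rw [run, comm (by decide)]
    refine h.step_fixed (t := fixedRules[1]) (List.getElem_mem _) ?_ ?_ ?_
    · simp [fixedRules, Fires, Fin.forall_fin_succ, letterInfo, letterTable, letterIndex, st₀, st₁,
        st₂]
    · simp [Fin.forall_fin_succ, st₀, st₁, st₂, hd, he, hf]
    · exact fun p _ => allowed_of_environment h.isPlay rfl p
  | succ k ih =>
    have ih := ih (by omega) fun i hi => ha i (by omega)
    obtain ⟨t, ht, htj, hfires⟩ := bot_rule (n := n) (k := k) (by omega) d e f
    have hdom : ∀ p, (letterInfo t.1).1 p = true → 3 ≤ p := by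
      rcases syncLetter_cases 1 n k with h | h | h | h <;> rw [htj, h] <;> decide
    have hst := st_lt (n := n) (k := k + 1)
    rw [run, ← htj, mul_assoc, comm hdom, ← mul_assoc]
    refine ih.step_fixed ht hfires ?_ fun p hp => ?_
    · simp [Fin.forall_fin_succ, hd, he, hf, hst]
    · exact (htj ▸ ha k (by omega) p (htj ▸ hp)).mul ih.isPlay (hv p (hdom p hp))

/-- Before the very last synchronization the intended number of rounds is not visible. -/
theorem run_congr {X n k : ℕ} (hk : k < 3 * n) : I.run X n k = I.run X 0 k := by
  induction k with
  | zero => rfl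
  | succ k ih =>
    have : syncLetter X n k = syncLetter X 0 k := by
      simp only [syncLetter]; split_ifs <;> first | omega | contradiction
    rw [run, run, ih (by omega), this]

theorem length_run (X n k : ℕ) (hX : X < 2) : I.game.length (I.run X n k) = k + 1 := by
  have key : ∀ j < 20, I.game.length (I.tr j) = 1 := fun j hj => by
    rw [tr, dif_pos (by rw [length_letters]; omega), I.game.length_letter]
  induction k with
  | zero => exact key X (by omega)
  | succ k ih =>
    rw [run, I.game.length_mul, ih, key]
    rcases syncLetter_cases X n k with h | h | h | h <;> omega

/-! ### The number of rounds of a winning strategy. -/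

/-- If the next synchronization is not allowed after `k` synchronizations, then the last
synchronization of a pool is. -/
theorem allowed_last_zero (hσ : σ.Winning) {k : ℕ} (ha : AllowsRun σ 0 0 k)
    (h : ¬ AllowsRun σ 0 0 (k + 1)) : k % 3 = 2 ∧
      ∀ p, (letterInfo 10).1 p = true → Allowed σ p (I.run 0 0 k) 10 := by
  -- The environment retires `B₀`. The bottom pool is then in final states and no check can take
  -- place, so the top pool has to reach a final state by itself.
  have hq : Reach σ (I.tr 3) ![0, 1, 1, 7, 1, 1] := by
    have := (reach_one (σ := σ)).step_fixed (t := fixedRules[3]) (s' := ![0, 1, 1, 7, 1, 1])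
      (List.getElem_mem _)
      (by simp [fixedRules, Fires, Fin.forall_fin_succ, letterInfo, letterTable, letterIndex])
      (by simp [Fin.forall_fin_succ])
      fun p _ => allowed_of_environment (reach_one (σ := σ)).isPlay rfl p
    rwa [one_mul] at this
  have hdom : ∀ p : Fin 6, p < 3 → p ∉ I.game.traceDom (I.tr 3) := fun p hp =>
    notMem_traceDom_tr (by revert p; decide)
  have hr := hq.top_run (n := 0) (k := k) (by omega) (by omega) (by omega) hdom (.inr rfl) ha
  obtain ⟨q, hq, hna⟩ : ∃ p, (letterInfo (syncLetter 0 0 k)).1 p = true ∧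
      ¬ Allowed σ p (I.run 0 0 k) (syncLetter 0 0 k) := by
    by_contra! hc
    refine h fun i hi p hp => ?_
    rcases Nat.lt_succ_iff_lt_or_eq.1 hi with hi | rfl
    exacts [ha i hi p hp, hc p hp]
  have hmul : ∀ {j p}, (letterInfo j).1 p = true → (∀ p, (letterInfo j).1 p = true → p < 3) →
      Allowed σ p (I.run 0 0 k * I.tr 3) j → Allowed σ p (I.run 0 0 k) j :=
    fun {j p} h1 h2 h h' => by
      have := h h'
      rwa [σ.allow_mul hr.isPlay (hdom p (h2 p h1))] at this
  have hs := syncStep 0 (n := 0) (k := k) (.inr rfl)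
  have h0 : st₀ 0 (k + 1) ≠ 6 := by simp only [st₀]; split_ifs <;> omega
  have hk : syncLetter 0 0 k = 8 → k % 3 = 2 := by
    simp only [syncLetter]; split_ifs <;> omega
  -- In such a state `T₀` is not final, and only the next synchronization is possible, or the last
  -- one in place of `X₂X₀`. If the former is refused, the latter must be allowed.
  have key : ∀ {j a b c a' b' c' : ℕ}, SyncStep 0 j a b c a' b' c' → a' ≠ 6 →
      (a = 1 ∨ a = 2 ∨ a = 3 ∨ a = 5) ∧ (∀ p, (letterInfo j).1 p = true → p < 3) ∧
      ∀ t ∈ I.rules, (∀ p, (letterInfo t.1).1 p = true → ![a, b, c, 7, 1, 1] p = t.2.1 p) →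
        t.1 = j ∨ (j = 8 ∧ t.1 = 10) := by
    rintro j a b c a' b' c' h h6
    have fixed : ∀ t ∈ I.rules, (∀ p, (letterInfo t.1).1 p = true → ![a, b, c, 7, 1, 1] p = t.2.1 p) →
        t ∈ fixedRules := fun t ht h => by
      refine (mem_fixedRules_or ht).resolve_right ?_
      rintro ⟨p, hp, hp'⟩
      rw [← h p hp] at hp'
      clear hp h
      cases ‹SyncStep _ _ _ _ _ _ _ _› <;> revert p <;> decide
    refine ⟨?_, ?_, fun t ht h' => ?_⟩
    · cases h <;> simp
    · cases h <;> decide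
    · replace fixed := fixed t ht h'
      clear ht
      have : ∀ t ∈ fixedRules, (∀ p, (letterInfo t.1).1 p = true → ![a, b, c, 7, 1, 1] p = t.2.1 p) →
          t.1 = j ∨ (j = 8 ∧ t.1 = 10) := by
        cases h <;> first | exact absurd rfl h6 | decide
      exact this t fixed h'
  replace key := key hs h0
  generalize syncLetter 0 0 k = j at key hk hq hna
  obtain ⟨h1, h2, h3⟩ := key
  by_contra hc
  have := hr.of_stuck hσ Set.univ (fun t ht _ r hr' hs' _ => ⟨fun _ _ => trivial, ?_⟩) 0 trivial
  · simp at this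
    omega
  · rcases h3 t ht fun p hp => by rw [← hs' p hp, hr' p trivial] with h4 | ⟨h4, h5⟩
    · rw [h4]
      exact ⟨q, hq, fun h => hna (hmul hq h2 h)⟩
    · by_contra! hall
      refine hc ⟨hk h4, fun p hp => hmul hp (by decide) ?_⟩
      rw [h5] at hall
      exact hall p hp

/-- The mirror image, where `T₀` quits so that the bottom pool is alone. -/
theorem allowed_last_one (hσ : σ.Winning) {k : ℕ} (ha : AllowsRun σ 1 0 k)
    (h : ¬ AllowsRun σ 1 0 (k + 1)) : k % 3 = 2 ∧
      ∀ p, (letterInfo 11).1 p = true → Allowed σ p (I.run 1 0 k) 11 := by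
  have hq : Reach σ (I.tr 2) ![7, 1, 1, 0, 1, 1] := by
    have := (reach_one (σ := σ)).step_fixed (t := fixedRules[2]) (s' := ![7, 1, 1, 0, 1, 1])
      (List.getElem_mem _)
      (by simp [fixedRules, Fires, Fin.forall_fin_succ, letterInfo, letterTable, letterIndex])
      (by simp [Fin.forall_fin_succ])
      fun p _ => allowed_of_environment (reach_one (σ := σ)).isPlay rfl p
    rwa [one_mul] at this
  have hdom : ∀ p : Fin 6, 3 ≤ p → p ∉ I.game.traceDom (I.tr 2) := fun p hp =>
    notMem_traceDom_tr (by revert p; decide)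
  have hr := hq.bot_run (n := 0) (k := k) (by omega) (by omega) (by omega) hdom (.inr rfl) ha
  obtain ⟨q, hq, hna⟩ : ∃ p, (letterInfo (syncLetter 1 0 k)).1 p = true ∧
      ¬ Allowed σ p (I.run 1 0 k) (syncLetter 1 0 k) := by
    by_contra! hc
    refine h fun i hi p hp => ?_
    rcases Nat.lt_succ_iff_lt_or_eq.1 hi with hi | rfl
    exacts [ha i hi p hp, hc p hp]
  have hmul : ∀ {j p}, (letterInfo j).1 p = true → (∀ p, (letterInfo j).1 p = true → 3 ≤ p) →
      Allowed σ p (I.run 1 0 k * I.tr 2) j → Allowed σ p (I.run 1 0 k) j :=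
    fun {j p} h1 h2 h h' => by
      have := h h'
      rwa [σ.allow_mul hr.isPlay (hdom p (h2 p h1))] at this
  have hs := syncStep 1 (n := 0) (k := k) (.inr rfl)
  have h0 : st₀ 0 (k + 1) ≠ 6 := by simp only [st₀]; split_ifs <;> omega
  have hk : syncLetter 1 0 k = 9 → k % 3 = 2 := by
    simp only [syncLetter]; split_ifs <;> omega
  have key : ∀ {j a b c a' b' c' : ℕ}, SyncStep 1 j a b c a' b' c' → a' ≠ 6 →
      (a = 1 ∨ a = 2 ∨ a = 3 ∨ a = 5) ∧ (∀ p, (letterInfo j).1 p = true → 3 ≤ p) ∧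
      ∀ t ∈ I.rules, (∀ p, (letterInfo t.1).1 p = true → ![7, 1, 1, a, b, c] p = t.2.1 p) →
        t.1 = j ∨ (j = 9 ∧ t.1 = 11) := by
    rintro j a b c a' b' c' h h6
    have fixed : ∀ t ∈ I.rules, (∀ p, (letterInfo t.1).1 p = true → ![7, 1, 1, a, b, c] p = t.2.1 p) →
        t ∈ fixedRules := fun t ht h => by
      refine (mem_fixedRules_or ht).resolve_right ?_
      rintro ⟨p, hp, hp'⟩
      rw [← h p hp] at hp'
      clear hp h
      cases ‹SyncStep _ _ _ _ _ _ _ _› <;> revert p <;> decide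
    refine ⟨?_, ?_, fun t ht h' => ?_⟩
    · cases h <;> simp
    · cases h <;> decide
    · replace fixed := fixed t ht h'
      clear ht
      have : ∀ t ∈ fixedRules, (∀ p, (letterInfo t.1).1 p = true → ![7, 1, 1, a, b, c] p = t.2.1 p) →
          t.1 = j ∨ (j = 9 ∧ t.1 = 11) := by
        cases h <;> first | exact absurd rfl h6 | decide
      exact this t fixed h'
  replace key := key hs h0
  generalize syncLetter 1 0 k = j at key hk hq hna
  obtain ⟨h1, h2, h3⟩ := key
  by_contra hc
  have := hr.of_stuck hσ Set.univ (fun t ht _ r hr' hs' _ => ⟨fun _ _ => trivial, ?_⟩) 3 trivial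
  · simp at this
    omega
  · rcases h3 t ht fun p hp => by rw [← hs' p hp, hr' p trivial] with h4 | ⟨h4, h5⟩
    · rw [h4]
      exact ⟨q, hq, fun h => hna (hmul hq h2 h)⟩
    · by_contra! hall
      refine hc ⟨hk h4, fun p hp => hmul hp (by decide) ?_⟩
      rw [h5] at hall
      exact hall p hp

/-- The pool `X` is allowed to play some positive number of rounds. -/
theorem exists_allowsRun (hσ : σ.Winning) {X : ℕ} (hX : X < 2)
    (hc : ∀ k, AllowsRun σ X 0 k → σ.Consistent (I.run X 0 k))
    (hl : ∀ k, AllowsRun σ X 0 k → ¬ AllowsRun σ X 0 (k + 1) → k % 3 = 2 ∧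
      ∀ p, (letterInfo (10 + X)).1 p = true → Allowed σ p (I.run X 0 k) (10 + X)) :
    ∃ n, 0 < n ∧ AllowsRun σ X n (3 * n) := by
  -- If the pool never refused, its runs would be infinitely many consistent plays, as their lengths
  -- differ.
  obtain ⟨k, h1, h2⟩ : ∃ k, AllowsRun σ X 0 k ∧ ¬ AllowsRun σ X 0 (k + 1) := by
    by_contra! h
    have hall : ∀ k, AllowsRun σ X 0 k := fun k => by
      induction k with
      | zero => exact fun i hi => absurd hi (Nat.not_lt_zero i)
      | succ k ih => exact h k ih
    refine Set.infinite_of_injective_forall_mem (f := I.run X 0) (fun k l hkl => ?_)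
      (fun k => hc k (hall k)) hσ.1
    have := congrArg I.game.length hkl
    rw [length_run _ _ _ hX, length_run _ _ _ hX] at this
    omega
  obtain ⟨h3, h4⟩ := hl k h1 h2
  -- The refusal occurs at k = 3x+2, so the last synchronization is the one of index k in the round
  -- x, and k + 1 = 3(x + 1).
  refine ⟨k / 3 + 1, by omega, fun i hi p hp => ?_⟩
  rw [run_congr hi]
  rcases Nat.lt_or_ge i k with hik | hik
  · have : syncLetter X (k / 3 + 1) i = syncLetter X 0 i := by
      simp only [syncLetter]; split_ifs <;> first | omega | contradiction
    rw [this] at hp ⊢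
    exact h1 i hik p hp
  · obtain rfl : i = k := by omega
    have : syncLetter X (i / 3 + 1) i = 10 + X := by
      simp only [syncLetter]; split_ifs <;> omega
    rw [this] at hp ⊢
    exact h4 p hp

/-- The pools play positive numbers of rounds, independently of each other. -/
theorem exists_rounds (hσ : σ.Winning) : ∃ n m, 0 < n ∧ 0 < m ∧ ∀ k l, k ≤ 3 * n → l ≤ 3 * m →
    Reach σ (I.run 0 n k * I.run 1 m l) ![st₀ n k, st₁ k, st₂ k, st₀ m l, st₁ l, st₂ l] := by
  have hone : ∀ p : Fin 6, p ∉ I.game.traceDom 1 := fun p => by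
    rw [I.game.traceDom_one]; exact id
  obtain ⟨n, hn, h0⟩ := exists_allowsRun hσ (X := 0) (by omega) (fun k ha =>
    (((reach_one (σ := σ)).top_run (n := 0) (by omega) (by omega) (by omega) (fun p _ => hone p)
      (.inr rfl) ha).1).of_mul) fun k => allowed_last_zero hσ
  obtain ⟨m, hm, h1⟩ := exists_allowsRun hσ (X := 1) (by omega) (fun k ha =>
    (((reach_one (σ := σ)).bot_run (n := 0) (by omega) (by omega) (by omega) (fun p _ => hone p)
      (.inr rfl) ha).1).of_mul) fun k => allowed_last_one hσ
  refine ⟨n, m, hn, hm, fun k l hk hl => ?_⟩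
  have hb := (reach_one (σ := σ)).bot_run (n := m) (k := l) (by omega) (by omega) (by omega)
    (fun p _ => hone p) (.inl hl) fun i hi => h1 i (by omega)
  rw [mul_one] at hb
  have hst := st_lt (n := m) (k := l)
  exact hb.top_run hst.1 hst.2.1 hst.2.2 (fun p hp => notMem_traceDom_run_one hp) (.inl hk)
    fun i hi => h0 i (by omega)

end ColoringInstance

namespace ColoringInstance

variable {I : ColoringInstance} {σ : I.game.Strategy}

/-! ### Answers -/

theorem Reach.lt {u : I.game.Trace} {s : Fin 6 → ℕ} (h : Reach σ u s) (p : Fin 6) :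
    s p < 14 + 3 * I.numColors := by
  obtain ⟨-, s', -, rfl⟩ := h
  exact val_lt s' p

/-- The checked processes `T_l` and `B_l` allow the answer `j` after `u` and the check. -/
def Answers (σ : I.game.Strategy) (u : I.game.Trace) (l j : ℕ) : Prop :=
  ∀ p, (letterInfo (16 + l)).1 p = true → Allowed σ p (u * I.tr (16 + l)) j

theorem Reach.check {u : I.game.Trace} {s s' : Fin 6 → ℕ} {t : Rule} {l : ℕ} (h : Reach σ u s)
    (ht : t ∈ fixedRules) (hl : t.1 = 16 + l) (hl3 : l < 3) (hf : Fires t s s') :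
    Reach σ (u * I.tr (16 + l)) s' := by
  have h14 : ∀ t ∈ fixedRules, ∀ p, t.2.2 p < 14 := by decide
  rw [← hl]
  refine h.step (mem_rules_fixed ht) (by omega) hf (fun p => ?_) fun p _ =>
    allowed_of_environment h.isPlay ?_ p
  · have := hf p
    split_ifs at this
    · have := h14 t ht p; omega
    · rw [this]; exact h.lt p
  · rw [hl]; interval_cases l <;> rfl

/-- If `T_l` and `B_l` answer a check after `u`, then they give the same answer after `u * v` if they
do not play in `v`. -/
theorem Reach.answer {u v w : I.game.Trace} {s s' s'' : Fin 6 → ℕ} {t t' : Rule} {l : ℕ}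
    (h : Reach σ w s) (hw : w = u * v)
    (hv : ∀ p, (letterInfo (16 + l)).1 p = true → p ∉ I.game.traceDom v)
    (hans : Answers σ u l t'.1) (ht : t ∈ fixedRules) (hl : t.1 = 16 + l) (hl3 : l < 3)
    (ht' : t' ∈ I.rules) (hlt : t'.1 < 20 + 3 * I.numColors)
    (hdom : (letterInfo t'.1).1 = (letterInfo (16 + l)).1) (hf : Fires t s s')
    (hf' : Fires t' s' s'') (hs'' : ∀ p, t'.2.2 p < 14 + 3 * I.numColors) :
    Reach σ (w * (I.tr (16 + l) * I.tr t'.1)) s'' := by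
  have hc := h.check ht hl hl3 hf
  rw [← mul_assoc]
  refine hc.step ht' hlt hf' (fun p => ?_) fun p hp => ?_
  · have := hf' p
    split_ifs at this
    · rw [this.2]; exact hs'' p
    · rw [this]; exact hc.lt p
  · have hcomm : w * I.tr (16 + l) = u * I.tr (16 + l) * v := by
      rw [hw, mul_assoc, mul_assoc, I.game.mul_comm_of_disjoint (u := v)]
      exact Set.disjoint_left.2 fun p h1 h2 => hv p (letterInfo_of_mem_traceDom_tr h2) h1
    rw [hdom] at hp
    have hplay := hc.isPlay
    rw [hcomm] at hplay ⊢
    exact (hans p hp).mul hplay (hv p hp)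

/-- The transitions that are possible for a checked process are answers. -/
theorem answer_cases {t : Rule} (ht : t ∈ I.rules) {p : Fin 6} (hp : (letterInfo t.1).1 p = true)
    (h10 : 10 ≤ t.2.1 p) (h13 : t.2.1 p ≤ 13) :
    ∃ c, (∃ k w, t = (20 + 3 * c, ![k, 0, 0, 13, 0, 0], ![w, 0, 0, 8, 0, 0]) ∧
        (k = 10 ∧ c ∈ I.Ci ∧ w = 14 + 3 * c ∨ k = 11 ∧ w = 14 + 3 * c ∨
          k = 12 ∧ c ∈ I.Cf ∧ w = 15 + 3 * c)) ∨
      t = (21 + 3 * c, ![0, 10, 0, 0, 13, 0], ![0, 14 + 3 * c, 0, 0, 8, 0]) ∨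
      ∃ i, t = (22 + 3 * c, ![0, 0, 10 + i, 0, 0, 13], ![0, 0, 14 + 3 * c + i, 0, 0, 8]) := by
  have lose : ∀ (q : Fin 6 → ℕ), (∀ p, q p < 10 ∨ 14 ≤ q p) → t ≠ loseRule q := by
    rintro q hq rfl
    have : (loseRule q).2.1 p = q p := rfl
    have := hq p
    omega
  rcases mem_rules.1 ht with h | ⟨c, -, h⟩ | ⟨c, hc, rfl⟩ | ⟨c, hc, rfl⟩ | ⟨d, -, c, -, h⟩ |
    ⟨c, -, rfl⟩ | ⟨c, -, rfl⟩ | ⟨c, -, rfl⟩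
  · have : ∀ t ∈ fixedRules, ∀ p, (letterInfo t.1).1 p = true → t.2.1 p < 10 := by decide
    have := this t h p hp
    omega
  · clear ht lose
    refine ⟨c, ?_⟩
    simp only [colorRules, List.mem_cons, List.not_mem_nil, or_false] at h
    rcases h with rfl | rfl | rfl | rfl | rfl | rfl | rfl | rfl | rfl | rfl | rfl | rfl
    iterate 7
      exfalso
      fin_cases p <;> simp at h10 h13; omega
    · exact .inl ⟨11, _, rfl, .inr (.inl ⟨rfl, rfl⟩)⟩
    · exact .inr (.inl rfl)
    · exact .inr (.inr ⟨0, rfl⟩)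
    · exact .inr (.inr ⟨1, by simp; omega⟩)
    · exact .inr (.inr ⟨2, by simp; omega⟩)
  · exact ⟨c, .inl ⟨10, _, rfl, .inl ⟨rfl, hc, rfl⟩⟩⟩
  · exact ⟨c, .inl ⟨12, _, rfl, .inr (.inr ⟨rfl, hc, rfl⟩)⟩⟩
  · exfalso
    clear ht
    simp only [equalRules, List.mem_cons, List.not_mem_nil, or_false] at h
    rcases h with h | h <;> rcases h with h | h | h | h | h | h | h <;>
      exact lose _ (by simp [Fin.forall_fin_succ]; try omega) h
  all_goals exact absurd rfl (lose _ (by simp [Fin.forall_fin_succ]; try omega))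

/-- The pair `T₀, B₀` answers the color `c` to a check of kind `k` after `u`, and the state of `T₀`
is then `w`. -/
structure Answer₀ (σ : I.game.Strategy) (u : I.game.Trace) (k c w : ℕ) : Prop where
  lt : c < I.numColors
  answers : Answers σ u 0 (20 + 3 * c)
  mem : (20 + 3 * c, ![k, 0, 0, 13, 0, 0], ![w, 0, 0, 8, 0, 0]) ∈ I.rules
  cases : k = 10 ∧ c ∈ I.Ci ∧ w = 14 + 3 * c ∨ k = 11 ∧ w = 14 + 3 * c ∨
    k = 12 ∧ c ∈ I.Cf ∧ w = 15 + 3 * c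

/-- The pair `T₁, B₁` answers the color `c` to a check after `u`. -/
structure Answer₁ (σ : I.game.Strategy) (u : I.game.Trace) (c : ℕ) : Prop where
  lt : c < I.numColors
  answers : Answers σ u 1 (21 + 3 * c)
  mem : (21 + 3 * c, ![0, 10, 0, 0, 13, 0], ![0, 14 + 3 * c, 0, 0, 8, 0]) ∈ I.rules

/-- The pair `T₂, B₂` answers the color `c` to a check of kind `i` after `u`. -/
structure Answer₂ (σ : I.game.Strategy) (u : I.game.Trace) (i c : ℕ) : Prop where
  lt : c < I.numColors
  answers : Answers σ u 2 (22 + 3 * c)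
  mem : (22 + 3 * c, ![0, 0, 10 + i, 0, 0, 13], ![0, 0, 14 + 3 * c + i, 0, 0, 8]) ∈ I.rules
  kind : i < 3

/-! ### Existence and stability of the answers of the three pairs. -/

section Exists

variable {u : I.game.Trace} {s₀ s₁ s₂ s₃ s₄ s₅ : ℕ}

/-- The argument is local to `T₀` and `B₀`, since the other processes may well continue: in their
checked states these two can only play an answer together, so refusing all answers would freeze `B₀`
in the non-final state 13. -/
theorem Reach.exists_answer₀ (hσ : σ.Winning) {k : ℕ}
    (h : Reach σ u ![s₀, s₁, s₂, s₃, s₄, s₅])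
    (hk : (16, ![s₀, 0, 0, s₃, 0, 0], ![k, 0, 0, 13, 0, 0]) ∈ fixedRules)
    (hk10 : 10 ≤ k) (hk12 : k ≤ 12) : ∃ c w, Answer₀ σ u k c w := by
  have hc : Reach σ (u * I.tr 16) ![k, s₁, s₂, 13, s₄, s₅] := h.check (l := 0) hk rfl (by omega)
    (by simp [Fires, Fin.forall_fin_succ, letterInfo, letterTable, letterIndex])
  by_contra! hno
  have := hc.of_stuck hσ {0, 3} (fun t ht hlt r hr hs hex => ?_) 3 (by simp)
  · simp at this
  · have h0 := hr 0 (by simp)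
    have h3 := hr 3 (by simp)
    simp at h0 h3
    obtain ⟨p, hpD, hp⟩ := hex
    have hpp : p = 0 ∨ p = 3 := hpD
    have hsp := hs p hp
    have hrp : 10 ≤ r p ∧ r p ≤ 13 := by rcases hpp with rfl | rfl <;> omega
    obtain ⟨c, ⟨k', w, rfl, hkw⟩ | rfl | ⟨i, rfl⟩⟩ := answer_cases ht hp (by omega) (by omega)
    · have hkk : k = k' := by rw [← h0]; exact hs 0 (by rw [letterInfo_answer₀]; rfl)
      subst hkk
      simp only [letterInfo_answer₀] at hlt ⊢
      refine ⟨by simp [Fin.forall_fin_succ], ?_⟩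
      by_contra! hall
      exact hno c w ⟨by omega, fun p hp => hall p hp, ht, hkw⟩
    · rw [letterInfo_answer₁] at hp
      rcases hpp with rfl | rfl <;> cases hp
    · rw [letterInfo_answer₂] at hp
      rcases hpp with rfl | rfl <;> cases hp

theorem Reach.exists_answer₁ (hσ : σ.Winning) (h : Reach σ u ![s₀, 4, s₂, s₃, 4, s₅]) :
    ∃ c, Answer₁ σ u c := by
  have hc : Reach σ (u * I.tr 17) ![s₀, 10, s₂, s₃, 13, s₅] :=
    h.check (t := (17, ![0, 4, 0, 0, 4, 0], ![0, 10, 0, 0, 13, 0])) (l := 1) (by decide) rfl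
      (by omega) (by simp [Fires, Fin.forall_fin_succ, letterInfo, letterTable, letterIndex])
  by_contra! hno
  have := hc.of_stuck hσ {1, 4} (fun t ht hlt r hr hs hex => ?_) 4 (by simp)
  · simp at this
  · have h0 := hr 1 (by simp)
    have h3 := hr 4 (by simp)
    simp at h0 h3
    obtain ⟨p, hpD, hp⟩ := hex
    have hpp : p = 1 ∨ p = 4 := hpD
    have hsp := hs p hp
    have hrp : 10 ≤ r p ∧ r p ≤ 13 := by rcases hpp with rfl | rfl <;> omega
    obtain ⟨c, ⟨k', w, rfl, hkw⟩ | rfl | ⟨i, rfl⟩⟩ := answer_cases ht hp (by omega) (by omega)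
    · rw [letterInfo_answer₀] at hp
      rcases hpp with rfl | rfl <;> cases hp
    · simp only [letterInfo_answer₁] at hlt ⊢
      refine ⟨by simp [Fin.forall_fin_succ], ?_⟩
      by_contra! hall
      exact hno c ⟨by omega, fun p hp => hall p hp, ht⟩
    · rw [letterInfo_answer₂] at hp
      rcases hpp with rfl | rfl <;> cases hp

theorem Reach.exists_answer₂ (hσ : σ.Winning) {i : ℕ}
    (h : Reach σ u ![s₀, s₁, s₂, s₃, s₄, s₅])
    (hi : (18, ![0, 0, s₂, 0, 0, s₅], ![0, 0, 10 + i, 0, 0, 13]) ∈ fixedRules)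
    (hi3 : i < 3) : ∃ c, Answer₂ σ u i c := by
  have hc : Reach σ (u * I.tr 18) ![s₀, s₁, 10 + i, s₃, s₄, 13] := h.check (l := 2) hi rfl (by omega)
    (by simp [Fires, Fin.forall_fin_succ, letterInfo, letterTable, letterIndex])
  by_contra! hno
  have := hc.of_stuck hσ {2, 5} (fun t ht hlt r hr hs hex => ?_) 5 (by simp)
  · simp at this
  · have h0 := hr 2 (by simp)
    have h3 := hr 5 (by simp)
    simp at h0 h3
    obtain ⟨p, hpD, hp⟩ := hex
    have hpp : p = 2 ∨ p = 5 := hpD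
    have hsp := hs p hp
    have hrp : 10 ≤ r p ∧ r p ≤ 13 := by rcases hpp with rfl | rfl <;> omega
    obtain ⟨c, ⟨k', w, rfl, hkw⟩ | rfl | ⟨j, rfl⟩⟩ := answer_cases ht hp (by omega) (by omega)
    · rw [letterInfo_answer₀] at hp
      rcases hpp with rfl | rfl <;> cases hp
    · rw [letterInfo_answer₁] at hp
      rcases hpp with rfl | rfl <;> cases hp
    · have hij : i = j := by
        have : r 2 = 10 + j := hs 2 (by rw [letterInfo_answer₂]; rfl)
        omega
      subst hij
      simp only [letterInfo_answer₂] at hlt ⊢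
      refine ⟨by simp [Fin.forall_fin_succ], ?_⟩
      by_contra! hall
      exact hno c ⟨by omega, fun p hp => hall p hp, ht, hi3⟩

variable {v w : I.game.Trace}

theorem Reach.answer₀ {k c x : ℕ} (h : Reach σ w ![s₀, s₁, s₂, s₃, s₄, s₅])
    (ha : Answer₀ σ u k c x) (hw : w = u * v) (hv₀ : 0 ∉ I.game.traceDom v)
    (hv₁ : 3 ∉ I.game.traceDom v)
    (hk : (16, ![s₀, 0, 0, s₃, 0, 0], ![k, 0, 0, 13, 0, 0]) ∈ fixedRules) :
    Reach σ (w * (I.tr 16 * I.tr (20 + 3 * c))) ![x, s₁, s₂, 8, s₄, s₅] := by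
  have hlt := ha.lt
  have hx : x < 14 + 3 * I.numColors := by
    rcases ha.cases with ⟨-, -, h⟩ | ⟨-, h⟩ | ⟨-, -, h⟩ <;> omega
  refine h.answer (l := 0) (t := (16, ![s₀, 0, 0, s₃, 0, 0], ![k, 0, 0, 13, 0, 0]))
    (t' := (20 + 3 * c, ![k, 0, 0, 13, 0, 0], ![x, 0, 0, 8, 0, 0])) (s' := ![k, s₁, s₂, 13, s₄, s₅]) hw (fun p hp => ?_) ha.answers hk rfl
    (by omega) ha.mem (by simp; omega) (by rw [letterInfo_answer₀]; rfl)
    (by simp [Fires, Fin.forall_fin_succ, letterInfo, letterTable, letterIndex])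
    (by simp [Fires, Fin.forall_fin_succ, letterInfo_answer₀]) ?_
  · have : p = 0 ∨ p = 3 := by revert p; decide
    rcases this with rfl | rfl <;> assumption
  · simp [Fin.forall_fin_succ, hx]; omega

theorem Reach.answer₁ {c : ℕ} (h : Reach σ w ![s₀, 4, s₂, s₃, 4, s₅]) (ha : Answer₁ σ u c)
    (hw : w = u * v) (hv₀ : 1 ∉ I.game.traceDom v) (hv₁ : 4 ∉ I.game.traceDom v) :
    Reach σ (w * (I.tr 17 * I.tr (21 + 3 * c))) ![s₀, 14 + 3 * c, s₂, s₃, 8, s₅] := by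
  have hlt := ha.lt
  refine h.answer (t := (17, ![0, 4, 0, 0, 4, 0], ![0, 10, 0, 0, 13, 0])) (l := 1)
    (t' := (21 + 3 * c, ![0, 10, 0, 0, 13, 0], ![0, 14 + 3 * c, 0, 0, 8, 0])) (s' := ![s₀, 10, s₂, s₃, 13, s₅]) hw (fun p hp => ?_) ha.answers (by decide) rfl
    (by omega) ha.mem (by simp; omega) (by rw [letterInfo_answer₁]; rfl)
    (by simp [Fires, Fin.forall_fin_succ, letterInfo, letterTable, letterIndex])
    (by simp [Fires, Fin.forall_fin_succ, letterInfo_answer₁]) ?_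
  · have : p = 1 ∨ p = 4 := by revert p; decide
    rcases this with rfl | rfl <;> assumption
  · simp [Fin.forall_fin_succ]; omega

theorem Reach.answer₂ {i c : ℕ} (h : Reach σ w ![s₀, s₁, s₂, s₃, s₄, s₅])
    (ha : Answer₂ σ u i c) (hw : w = u * v) (hv₀ : 2 ∉ I.game.traceDom v)
    (hv₁ : 5 ∉ I.game.traceDom v)
    (hi : (18, ![0, 0, s₂, 0, 0, s₅], ![0, 0, 10 + i, 0, 0, 13]) ∈ fixedRules) :
    Reach σ (w * (I.tr 18 * I.tr (22 + 3 * c))) ![s₀, s₁, 14 + 3 * c + i, s₃, s₄, 8] := by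
  have hlt := ha.lt
  have hi3 := ha.kind
  refine h.answer (l := 2) (t := (18, ![0, 0, s₂, 0, 0, s₅], ![0, 0, 10 + i, 0, 0, 13]))
    (t' := (22 + 3 * c, ![0, 0, 10 + i, 0, 0, 13], ![0, 0, 14 + 3 * c + i, 0, 0, 8])) (s' := ![s₀, s₁, 10 + i, s₃, s₄, 13]) hw (fun p hp => ?_) ha.answers hi
    rfl (by omega) ha.mem (by simp; omega) (by rw [letterInfo_answer₂]; rfl)
    (by simp [Fires, Fin.forall_fin_succ, letterInfo, letterTable, letterIndex])
    (by simp [Fires, Fin.forall_fin_succ, letterInfo_answer₂]) ?_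
  · have : p = 2 ∨ p = 5 := by revert p; decide
    rcases this with rfl | rfl <;> assumption
  · simp [Fin.forall_fin_succ]; omega

end Exists

end ColoringInstance

namespace ColoringInstance

variable {I : ColoringInstance} {σ : I.game.Strategy} {n m : ℕ}

/-! ### Plays of both pools -/

/-- The play of `k` synchronizations of the top pool and `l` synchronizations of the bottom pool. -/
def pos (I : ColoringInstance) (n m k l : ℕ) : I.game.Trace := I.run 0 n k * I.run 1 m l

theorem pos_succ_left (k l : ℕ) :
    I.pos n m (k + 1) l = I.pos n m k l * I.tr (syncLetter 0 n k) := by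
  rw [pos, pos, run, mul_assoc, mul_assoc, I.game.mul_comm_of_disjoint (u := I.run 1 m l)]
  refine Set.disjoint_right.2 fun p hp => notMem_traceDom_run_one ?_
  have := letterInfo_of_mem_traceDom_tr hp
  clear hp
  rcases syncLetter_cases 0 n k with h | h | h | h <;> rw [h] at this <;> clear h <;> revert p <;>
    decide

theorem pos_succ_right (k l : ℕ) :
    I.pos n m k (l + 1) = I.pos n m k l * I.tr (syncLetter 1 m l) := by
  rw [pos, pos, run, mul_assoc]

theorem notMem_traceDom_sync {X k i : ℕ} (hX : X < 2) (hi : i < 3) (hk : k % 3 = (i + 1) % 3)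
    (p : Fin 6) (hp : (p : ℕ) % 3 = i) : p ∉ I.game.traceDom (I.tr (syncLetter X n k)) := by
  refine notMem_traceDom_tr ?_
  -- The last synchronization replaces `X₂X₀` and has the same domain, so it matters only for i = 1.
  have : syncLetter X n k = 4 + X + 2 * ((i + 1) % 3) ∨
      (i = 1 ∧ syncLetter X n k = 10 + X) := by
    simp only [syncLetter]; split_ifs <;> omega
  rcases this with h | ⟨rfl, h⟩ <;> rw [h] <;> clear h hk
  · revert p; interval_cases X <;> interval_cases i <;> decide
  · revert p; interval_cases X <;> decide

/-- The pair `T_i, B_i` does not take part in every third synchronization. -/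
theorem exists_suffix {k l k' l' i : ℕ} (hi : i < 3) (hk : k' = k ∨ k' = k + 1 ∧ k % 3 = (i + 1) % 3)
    (hl : l' = l ∨ l' = l + 1 ∧ l % 3 = (i + 1) % 3) : ∃ v, I.pos n m k' l' = I.pos n m k l * v ∧
      ∀ p : Fin 6, (p : ℕ) % 3 = i → p ∉ I.game.traceDom v := by
  have hone : ∀ p : Fin 6, p ∉ I.game.traceDom 1 := fun p => by
    rw [I.game.traceDom_one]; exact id
  obtain ⟨v, hv, hvd⟩ : ∃ v, I.pos n m k' l = I.pos n m k l * v ∧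
      ∀ p : Fin 6, (p : ℕ) % 3 = i → p ∉ I.game.traceDom v := by
    rcases hk with rfl | ⟨rfl, hk⟩
    · exact ⟨1, (mul_one _).symm, fun p _ => hone p⟩
    · exact ⟨_, pos_succ_left _ _, notMem_traceDom_sync (by omega) hi hk⟩
  rcases hl with rfl | ⟨rfl, hl⟩
  · exact ⟨v, hv, hvd⟩
  · refine ⟨v * I.tr (syncLetter 1 m l), by rw [pos_succ_right, hv, mul_assoc], fun p hp =>
      notMem_traceDom_mul (hvd p hp) (notMem_traceDom_sync (by omega) hi hl p hp)⟩

section Pairs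

variable {s₀ s₁ s₂ s₃ s₄ s₅ k l k' l' k'' l'' c d e : ℕ}

/-- Both pairs are checked at the counts k, l, but each answers as it would at earlier counts,
provided that it was absent from the synchronizations in between. The check of the first pair does
not involve the second. -/
theorem Reach.answers₀₁ (h : Reach σ (I.pos n m k l) ![s₀, 4, s₂, s₃, 4, s₅])
    (hd : Answer₁ σ (I.pos n m k' l') d) (hk' : k = k' ∨ k = k' + 1 ∧ k' % 3 = 2)
    (hl' : l = l' ∨ l = l' + 1 ∧ l' % 3 = 2) {q : ℕ}
    (hc : Answer₀ σ (I.pos n m k'' l'') q c e) (hk'' : k = k'' ∨ k = k'' + 1 ∧ k'' % 3 = 1)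
    (hl'' : l = l'' ∨ l = l'' + 1 ∧ l'' % 3 = 1)
    (hq : (16, ![s₀, 0, 0, s₃, 0, 0], ![q, 0, 0, 13, 0, 0]) ∈ fixedRules) :
    ∃ u, Reach σ u ![e, 14 + 3 * d, s₂, 8, 8, s₅] := by
  obtain ⟨v, hv, hvd⟩ := exists_suffix (I := I) (n := n) (m := m) (i := 1) (by omega) hk' hl'
  obtain ⟨w, hw, hwd⟩ := exists_suffix (I := I) (n := n) (m := m) (i := 0) (by omega) hk'' hl''
  refine ⟨_, (h.answer₁ hd hv (hvd 1 rfl) (hvd 4 rfl)).answer₀ hc (by rw [hw, mul_assoc]) ?_ ?_ hq⟩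
  · exact notMem_traceDom_mul (hwd 0 rfl) (notMem_traceDom_mul (notMem_traceDom_tr rfl)
      (notMem_traceDom_tr (by rw [letterInfo_answer₁]; rfl)))
  · exact notMem_traceDom_mul (hwd 3 rfl) (notMem_traceDom_mul (notMem_traceDom_tr rfl)
      (notMem_traceDom_tr (by rw [letterInfo_answer₁]; rfl)))

theorem Reach.answers₁₂ (h : Reach σ (I.pos n m k l) ![s₀, 4, s₂, s₃, 4, s₅])
    (hd : Answer₁ σ (I.pos n m k' l') d) (hk' : k = k' ∨ k = k' + 1 ∧ k' % 3 = 2)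
    (hl' : l = l' ∨ l = l' + 1 ∧ l' % 3 = 2) {i : ℕ} (hc : Answer₂ σ (I.pos n m k l) i c)
    (hi : (18, ![0, 0, s₂, 0, 0, s₅], ![0, 0, 10 + i, 0, 0, 13]) ∈ fixedRules) :
    ∃ u, Reach σ u ![s₀, 14 + 3 * d, 14 + 3 * c + i, s₃, 8, 8] := by
  obtain ⟨v, hv, hvd⟩ := exists_suffix (I := I) (n := n) (m := m) (i := 1) (by omega) hk' hl'
  refine ⟨_, (h.answer₁ hd hv (hvd 1 rfl) (hvd 4 rfl)).answer₂ hc rfl ?_ ?_ hi⟩ <;>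
    exact notMem_traceDom_mul (notMem_traceDom_tr rfl)
      (notMem_traceDom_tr (by rw [letterInfo_answer₁]; rfl))

theorem Reach.answers₂₀ (h : Reach σ (I.pos n m k l) ![s₀, s₁, s₂, s₃, s₄, s₅])
    {i : ℕ} (hc : Answer₂ σ (I.pos n m k' l') i c) (hk' : k = k' ∨ k = k' + 1 ∧ k' % 3 = 0)
    (hl' : l = l' ∨ l = l' + 1 ∧ l' % 3 = 0) {q : ℕ}
    (hd : Answer₀ σ (I.pos n m k'' l'') q d e) (hk'' : k = k'' ∨ k = k'' + 1 ∧ k'' % 3 = 1)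
    (hl'' : l = l'' ∨ l = l'' + 1 ∧ l'' % 3 = 1)
    (hi : (18, ![0, 0, s₂, 0, 0, s₅], ![0, 0, 10 + i, 0, 0, 13]) ∈ fixedRules)
    (hq : (16, ![s₀, 0, 0, s₃, 0, 0], ![q, 0, 0, 13, 0, 0]) ∈ fixedRules) :
    ∃ u, Reach σ u ![e, s₁, 14 + 3 * c + i, 8, s₄, 8] := by
  obtain ⟨v, hv, hvd⟩ := exists_suffix (I := I) (n := n) (m := m) (i := 2) (by omega) hk' hl'
  obtain ⟨w, hw, hwd⟩ := exists_suffix (I := I) (n := n) (m := m) (i := 0) (by omega) hk'' hl''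
  refine ⟨_, (h.answer₂ hc hv (hvd 2 rfl) (hvd 5 rfl) hi).answer₀ hd (by rw [hw, mul_assoc]) ?_ ?_
    hq⟩
  · exact notMem_traceDom_mul (hwd 0 rfl) (notMem_traceDom_mul (notMem_traceDom_tr rfl)
      (notMem_traceDom_tr (by rw [letterInfo_answer₂]; rfl)))
  · exact notMem_traceDom_mul (hwd 3 rfl) (notMem_traceDom_mul (notMem_traceDom_tr rfl)
      (notMem_traceDom_tr (by rw [letterInfo_answer₂]; rfl)))

end Pairs

theorem mem_rules_equal {c d : ℕ} (hc : c < I.numColors) (hd : d < I.numColors) (h : c ≠ d)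
    {t : Rule} (ht : t ∈ equalRules c d) : t ∈ I.rules := by
  refine mem_rules.2 (.inr (.inr (.inr (.inr (.inl ?_)))))
  rcases Nat.lt_or_gt_of_ne h with h | h
  exacts [⟨d, hd, c, h, .inl ht⟩, ⟨c, hc, d, h, .inr ht⟩]

/-! ### The coloring of a winning strategy -/

/-- The pools play `n` and `m` rounds independently of each other. -/
def Rounds (σ : I.game.Strategy) (n m : ℕ) : Prop := ∀ k l, k ≤ 3 * n → l ≤ 3 * m →
  Reach σ (I.pos n m k l) ![st₀ n k, st₁ k, st₂ k, st₀ m l, st₁ l, st₂ l]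

/-- The state of `X₀` in the middle of the round `x`. -/
def mid (x : ℕ) : ℕ := if x = 0 then 2 else 3

theorem mid_cases (x : ℕ) : mid x = 2 ∨ mid x = 3 := by unfold mid; split_ifs <;> simp

/-- The kind of the check of `T₀` and `B₀` in the middle of the rounds `x` and `y`. -/
def kind (x y : ℕ) : ℕ := if x = 0 ∧ y = 0 then 10 else 11

theorem check_mid (x y : ℕ) :
    (16, ![mid x, 0, 0, mid y, 0, 0], ![kind x y, 0, 0, 13, 0, 0]) ∈ fixedRules := by
  by_cases hx : x = 0 <;> by_cases hy : y = 0 <;> simp [mid, kind, hx, hy, fixedRules]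

section States

variable (x : ℕ)

theorem st₀_one : st₀ n (3 * x + 1) = mid x := by
  simp only [st₀, mid]; split_ifs <;> first | omega | contradiction

theorem st₀_two : st₀ n (3 * x + 2) = mid x := by
  simp only [st₀, mid]; split_ifs <;> first | omega | contradiction

theorem st₀_three (h : x + 1 < n) : st₀ n (3 * x + 3) = 5 := by
  simp only [st₀]; split_ifs <;> first | omega | contradiction

theorem st₀_four : st₀ n (3 * x + 4) = 3 := by
  simp only [st₀]; split_ifs <;> first | omega | contradiction

theorem st₀_last : st₀ (x + 1) (3 * x + 3) = 6 := by
  simp only [st₀]; split_ifs <;> first | omega | contradiction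

theorem st₁_two : st₁ (3 * x + 2) = 4 := by
  simp only [st₁]; split_ifs <;> first | omega | contradiction

theorem st₁_three : st₁ (3 * x + 3) = 4 := by
  simp only [st₁]; split_ifs <;> first | omega | contradiction

theorem st₁_four : st₁ (3 * x + 4) = 3 := by
  simp only [st₁]; split_ifs <;> first | omega | contradiction

theorem st₂_two : st₂ (3 * x + 2) = 4 := by
  simp only [st₂]; split_ifs <;> omega

theorem st₂_three : st₂ (3 * x + 3) = 5 := by
  simp only [st₂]; split_ifs <;> omega

theorem st₂_four : st₂ (3 * x + 4) = 5 := by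
  simp only [st₂]; split_ifs <;> omega

end States

/-- The pair 1 is the reference: its window meets the windows of both other pairs within the same
round. -/
theorem Rounds.exists_coloring (hσ : σ.Winning) (hr : Rounds σ n m) : ∃ f : ℕ → ℕ → ℕ,
    ∀ x y, x < n → y < m → Answer₁ σ (I.pos n m (3 * x + 2) (3 * y + 2)) (f x y) := by
  have : ∀ x y, ∃ c, x < n → y < m → Answer₁ σ (I.pos n m (3 * x + 2) (3 * y + 2)) c := by
    intro x y
    by_cases h : x < n ∧ y < m
    · have hr := hr (3 * x + 2) (3 * y + 2) (by omega) (by omega)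
      rw [st₁_two, st₁_two] at hr
      obtain ⟨c, hc⟩ := hr.exists_answer₁ hσ
      exact ⟨c, fun _ _ => hc⟩
    · exact ⟨0, fun h1 h2 => absurd ⟨h1, h2⟩ h⟩
  choose f hf using this
  exact ⟨f, hf⟩

/-! ### Comparing the answers of two pairs in one play. -/

section Colors

variable {f : ℕ → ℕ → ℕ} {x y : ℕ}

/-- The answers of `T₀` and `B₀` in the middle of the rounds agree with the coloring. -/
theorem Rounds.answer₀ (hσ : σ.Winning) (hr : Rounds σ n m) (hx : x < n) (hy : y < m) {c : ℕ}
    (hc : Answer₁ σ (I.pos n m (3 * x + 2) (3 * y + 2)) c) :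
    Answer₀ σ (I.pos n m (3 * x + 1) (3 * y + 1)) (kind x y) c (14 + 3 * c) := by
  have h := hr (3 * x + 1) (3 * y + 1) (by omega) (by omega)
  rw [st₀_one, st₀_one] at h
  have hk : kind x y = 10 ∨ kind x y = 11 := by unfold kind; split_ifs <;> simp
  obtain ⟨d, e, hd⟩ := h.exists_answer₀ hσ (check_mid x y) (by omega) (by omega)
  -- The kind 12 only occurs after the last round, so the state records an ordinary answer.
  have he : e = 14 + 3 * d := by
    rcases hd.cases with h | h | h <;> omega
  subst he
  -- At these counts both pairs can be checked: the pair 0 was absent from both synchronizations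
  -- `X₁X₂` just played, so its answer is still that of (3x+1, 3y+1).
  have h := hr (3 * x + 2) (3 * y + 2) (by omega) (by omega)
  rw [st₀_two, st₀_two, st₁_two, st₁_two, st₂_two, st₂_two] at h
  obtain ⟨u, hu⟩ := h.answers₀₁ hc (.inl rfl) (.inl rfl) hd (by omega) (by omega) (check_mid x y)
  obtain rfl : d = c := by
    by_contra hne
    exact hu.not_lose hσ (mem_rules_equal hd.lt hc.lt hne (by simp [equalRules]))
  exact hd

/-- At the counts (3n, 3m) the pair 0 can only answer an allowed final color, and it is compared
with the pair 1, which was absent from the last synchronization of each pool. -/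
theorem Rounds.final (hσ : σ.Winning) (hr : Rounds σ (x + 1) (y + 1)) {c : ℕ}
    (hc : Answer₁ σ (I.pos (x + 1) (y + 1) (3 * x + 2) (3 * y + 2)) c) : c ∈ I.Cf := by
  have h := hr (3 * x + 3) (3 * y + 3) (by omega) (by omega)
  rw [st₀_last, st₀_last, st₁_three, st₁_three, st₂_three, st₂_three] at h
  have h12 : (16, ![6, 0, 0, 6, 0, 0], ![12, 0, 0, 13, 0, 0]) ∈ fixedRules := by decide
  obtain ⟨d, e, hd⟩ := h.exists_answer₀ hσ h12 (by omega) (by omega)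
  obtain ⟨u, hu⟩ := h.answers₀₁ hc (by omega) (by omega) hd (.inl rfl) (.inl rfl) h12
  rcases hd.cases with h | h | ⟨-, hd', rfl⟩
  · omega
  · omega
  · obtain rfl : d = c := by
      by_contra hne
      exact hu.not_lose hσ (mem_rules_equal hd.lt hc.lt hne (by simp [equalRules]))
    exact hd'

/-- `T₁` is absent from `T₂T₀`, so at (3x+3, 3y+2) the pair 1 still answers the color of (3x+2,
3y+2). The bound on x ensures that `T₀` is in the state 5 and not in the state 6. -/
theorem Rounds.answer_upper (hσ : σ.Winning) (hr : Rounds σ n m) (hx : x + 1 < n) (hy : y < m)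
    {c : ℕ} (hc : Answer₁ σ (I.pos n m (3 * x + 2) (3 * y + 2)) c) :
    Answer₂ σ (I.pos n m (3 * x + 3) (3 * y + 2)) 0 c := by
  have h := hr (3 * x + 3) (3 * y + 2) (by omega) (by omega)
  rw [st₀_three x hx, st₀_two, st₁_two, st₁_three, st₂_two, st₂_three] at h
  have hi : (18, ![0, 0, 5, 0, 0, 4], ![0, 0, 10 + 0, 0, 0, 13]) ∈ fixedRules := by decide
  obtain ⟨d, hd⟩ := h.exists_answer₂ hσ hi (by omega)
  obtain ⟨u, hu⟩ := h.answers₁₂ hc (by omega) (.inl rfl) hd hi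
  obtain rfl : d = c := by
    by_contra hne
    refine hu.not_lose hσ (mem_rules_equal hd.lt hc.lt hne ?_)
    rcases mid_cases y with h | h <;> rw [h] <;> simp [equalRules]
  exact hd

theorem Rounds.answer_lower (hσ : σ.Winning) (hr : Rounds σ n m) (hx : x < n) (hy : y + 1 < m)
    {c : ℕ} (hc : Answer₁ σ (I.pos n m (3 * x + 2) (3 * y + 2)) c) :
    Answer₂ σ (I.pos n m (3 * x + 2) (3 * y + 3)) 1 c := by
  have h := hr (3 * x + 2) (3 * y + 3) (by omega) (by omega)
  rw [st₀_three y hy, st₀_two, st₁_two, st₁_three, st₂_two, st₂_three] at h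
  have hi : (18, ![0, 0, 4, 0, 0, 5], ![0, 0, 10 + 1, 0, 0, 13]) ∈ fixedRules := by decide
  obtain ⟨d, hd⟩ := h.exists_answer₂ hσ hi (by omega)
  obtain ⟨u, hu⟩ := h.answers₁₂ hc (.inl rfl) (by omega) hd hi
  rw [show 14 + 3 * d + 1 = 15 + 3 * d by omega] at hu
  obtain rfl : d = c := by
    by_contra hne
    refine hu.not_lose hσ (mem_rules_equal hd.lt hc.lt hne ?_)
    rcases mid_cases x with h | h <;> rw [h] <;> simp [equalRules]
  exact hd

theorem Rounds.answer_square (hσ : σ.Winning) (hr : Rounds σ n m) (hx : x + 1 < n) (hy : y + 1 < m)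
    {c : ℕ} (hc : Answer₁ σ (I.pos n m (3 * x + 2) (3 * y + 2)) c) :
    Answer₂ σ (I.pos n m (3 * x + 3) (3 * y + 3)) 2 c := by
  have h := hr (3 * x + 3) (3 * y + 3) (by omega) (by omega)
  rw [st₀_three y hy, st₀_three x hx, st₁_three, st₁_three, st₂_three, st₂_three] at h
  have hi : (18, ![0, 0, 5, 0, 0, 5], ![0, 0, 10 + 2, 0, 0, 13]) ∈ fixedRules := by decide
  obtain ⟨d, hd⟩ := h.exists_answer₂ hσ hi (by omega)
  obtain ⟨u, hu⟩ := h.answers₁₂ hc (by omega) (by omega) hd hi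
  rw [show 14 + 3 * d + 2 = 16 + 3 * d by omega] at hu
  obtain rfl : d = c := by
    by_contra hne
    exact hu.not_lose hσ (mem_rules_equal hd.lt hc.lt hne (by simp [equalRules]))
  exact hd

/-- The common position is (3x+4, 3y+2): `T₂` is absent from the synchronization that opens the
round x+1, and `B₀` from the one that leads to 3y+2. The pair 2 thus answers for (x, y) and the pair
0 for (x+1, y). -/
theorem Rounds.upper (hσ : σ.Winning) (hr : Rounds σ n m) (hx : x + 1 < n) (hy : y < m) {c d : ℕ}
    (hc : Answer₁ σ (I.pos n m (3 * x + 2) (3 * y + 2)) c)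
    (hd : Answer₁ σ (I.pos n m (3 * (x + 1) + 2) (3 * y + 2)) d) : (c, d) ∉ I.UT := by
  intro hcd
  have hc := hr.answer_upper hσ hx hy hc
  have hd := hr.answer₀ hσ hx hy hd
  have h := hr (3 * x + 4) (3 * y + 2) (by omega) (by omega)
  rw [st₀_four, st₀_two, st₁_two, st₁_four, st₂_two, st₂_four] at h
  have hq := check_mid (x + 1) y
  rw [mid, if_neg (by omega)] at hq
  obtain ⟨u, hu⟩ := h.answers₂₀ hc (by omega) (.inl rfl) hd (by omega) (by omega) (by decide) hq
  exact hu.not_lose hσ (mem_rules.2 (.inr (.inr (.inr (.inr (.inr (.inl ⟨_, hcd, rfl⟩)))))))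

theorem Rounds.lower (hσ : σ.Winning) (hr : Rounds σ n m) (hx : x < n) (hy : y + 1 < m) {c d : ℕ}
    (hc : Answer₁ σ (I.pos n m (3 * x + 2) (3 * y + 2)) c)
    (hd : Answer₁ σ (I.pos n m (3 * x + 2) (3 * (y + 1) + 2)) d) : (c, d) ∉ I.LT := by
  intro hcd
  have hc := hr.answer_lower hσ hx hy hc
  have hd := hr.answer₀ hσ hx hy hd
  have h := hr (3 * x + 2) (3 * y + 4) (by omega) (by omega)
  rw [st₀_four, st₀_two, st₁_two, st₁_four, st₂_two, st₂_four] at h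
  have hq := check_mid x (y + 1)
  rw [mid.eq_def (y + 1), if_neg (by omega)] at hq
  obtain ⟨u, hu⟩ := h.answers₂₀ hc (.inl rfl) (by omega) hd (by omega) (by omega) (by decide) hq
  rw [show 14 + 3 * c + 1 = 15 + 3 * c by omega] at hu
  exact hu.not_lose hσ (mem_rules.2 (.inr (.inr (.inr (.inr (.inr (.inr (.inl ⟨_, hcd, rfl⟩))))))))

/-- At (3x+4, 3y+4) both pools have just opened the next round, and neither `T₂` nor `B₂` has
noticed it. -/
theorem Rounds.square (hσ : σ.Winning) (hr : Rounds σ n m) (hx : x + 1 < n) (hy : y + 1 < m)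
    {c d : ℕ} (hc : Answer₁ σ (I.pos n m (3 * x + 2) (3 * y + 2)) c)
    (hd : Answer₁ σ (I.pos n m (3 * (x + 1) + 2) (3 * (y + 1) + 2)) d) : (c, d) ∉ I.S := by
  intro hcd
  have hc := hr.answer_square hσ hx hy hc
  have hd := hr.answer₀ hσ hx hy hd
  have h := hr (3 * x + 4) (3 * y + 4) (by omega) (by omega)
  rw [st₀_four, st₀_four, st₁_four, st₁_four, st₂_four, st₂_four] at h
  have hq := check_mid (x + 1) (y + 1)
  rw [mid, if_neg (by omega), mid, if_neg (by omega)] at hq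
  obtain ⟨u, hu⟩ := h.answers₂₀ hc (by omega) (by omega) hd (by omega) (by omega) (by decide) hq
  rw [show 14 + 3 * c + 2 = 16 + 3 * c by omega] at hu
  exact hu.not_lose hσ (mem_rules.2 (.inr (.inr (.inr (.inr (.inr (.inr (.inr ⟨_, hcd, rfl⟩))))))))

end Colors

theorem hasSolution_of_hasWinningStrategy (h : I.game.HasWinningStrategy) : I.HasSolution := by
  obtain ⟨σ, hσ⟩ := h
  obtain ⟨n, m, hn, hm, hr⟩ := exists_rounds hσ
  obtain ⟨n, rfl⟩ := Nat.exists_eq_succ_of_ne_zero hn.ne'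
  obtain ⟨m, rfl⟩ := Nat.exists_eq_succ_of_ne_zero hm.ne'
  replace hr : Rounds σ (n + 1) (m + 1) := hr
  obtain ⟨f, hf⟩ := hr.exists_coloring hσ
  refine I.hasSolution_iff.2 ⟨n + 1, m + 1, f, ⟨hn, hm, fun x hx y hy => (hf x y hx hy).lt, ?_,
    hr.final hσ (hf n m (by omega) (by omega)),
    fun x y hx hy => hr.square hσ hx hy (hf _ _ (by omega) (by omega)) (hf _ _ hx hy),
    fun x y hx hy => hr.upper hσ hx hy (hf _ _ (by omega) hy) (hf _ _ hx hy),
    fun x y hx hy => hr.lower hσ hx hy (hf _ _ hx (by omega)) (hf _ _ hx hy)⟩⟩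
  -- At the position (0, 0) the check has the kind 10, which admits only initial colors.
  rcases (hr.answer₀ hσ hn hm (hf 0 0 hn hm)).cases with ⟨-, h, -⟩ | ⟨h, -⟩ | ⟨h, -⟩
  · exact h
  · simp [kind] at h
  · simp [kind] at h

end ColoringInstance
/-- There is an effective reduction from the bipartite coloring problem to the distributed control
problem with six processes, arranged as two pools of three. -/
theorem mainTheorem3 :
    ∃ reduction : ColoringInstance → GameCode 6, Computable reduction ∧
      ∀ I : ColoringInstance, ∃ h : (reduction I).WellFormed,
        ((reduction I).toGame h).TwoPools ∧
          (((reduction I).toGame h).HasWinningStrategy ↔ I.HasSolution) := by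
  exact ⟨ColoringInstance.code, ColoringInstance.primrec_code.to_comp, fun I => ⟨I.wellFormed, I.twoPools,
    ColoringInstance.hasSolution_of_hasWinningStrategy,
    ColoringInstance.hasWinningStrategy_of_hasSolution⟩⟩
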